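/- **Representation formula for the biharmonic Schrödinger equation on the half space.** *Notation.* For $\kappa\in\mathbb R$, $\lambda\in\mathbb C$ put $$\widehat{v}(\kappa,\lambda)=\int_{\mathbb R}\int_0^\infty e^{-i\kappa x-i\lambda y}v(x,y)\,dy\,dx\ (\Im\lambda\le 0),\qquad \tilde g(\kappa,\eta,t)=\int_0^t e^{\eta\tau}\int_{\mathbb R}e^{-i\kappa x}g(x,\tau)\,dx\,d\tau,$$ $$E(\kappa,\lambda;x,y,t)=\exp\big(i(\kappa^2+\lambda^2)^2t+i\kappa x+i\lambda y\big).$$ For $0<\varepsilon<\pi/4$ let $\sqrt{z}^{*}=|z|^{1/2}e^{i\arg z/2}$ with $\arg z\in[\varepsilon,2\pi+\varepsilon)$, and $\nu_\kappa(\lambda)=\sqrt{-\lambda^2-2\kappa^2}^{*}$. With $\nu=\nu_\kappa(\lambda)$ and $\tilde g_j=\tilde g_j(\kappa,-i(\kappa^2+\lambda^2)^2,t)$ let $$G(\kappa,\lambda,t)=\frac{2\lambda}{\nu-\lambda}\widehat{u_0}(\kappa,-\nu)-\frac{\lambda+\nu}{\nu-\lambda}\widehat{u_0}(\kappa,-\lambda)+2(\lambda^2\nu+\lambda\nu^2)\tilde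 g_0+2i(\lambda^2+\lambda\nu)\tilde g_1 .$$ Let $D_\kappa^+=\{\lambda:\Im\lambda>0,\ \Re[i(\kappa^2+\lambda^2)^2]>0\}$, with $\partial D_\kappa^+$ oriented so that $D_\kappa^+$ lies on its left. Thus $\partial D_\kappa^+$ consists of the path $-\infty\to0\to i|\kappa|$ followed by the left half of the hyperbola branch $\Im\lambda=\sqrt{\kappa^2+(\Re\lambda)^2}$ traversed outwards, and of the path $i\infty\to i|\kappa|$ followed by the right half of that branch traversed outwards. Let $\Gamma_\kappa$ be the contour obtained from $\partial D_\kappa^+$ by replacing both half hyperbolas by rays in their asymptotic directions: $-\infty\to0\to i|\kappa|\to i|\kappa|+e^{3\pi i/4}\infty$ together with $i\infty\to0\to e^{i\pi/4}\infty$. Integrals over unbounded $\lambda$-contours are improper integrals, convergent at each end separately. *Statement.* There is an absolute integer $N$ such that the following holds. Let $T>0$, $0<\varepsilon<\pi/4$, and let $u$ be of class $C^N$ on $\mathbb R\times[0,\infty)\times[0,T]$ with $(1+|x|+|y|)^{N}|D^n u|$ bounded there for all $n\le N$. Suppose that $$iu_t+\Delta^2u=0\ \text{ in }\mathbb R\times(0,\infty)\times(0,T),\qquad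 u(x,0,t)=g_0(x,t),\quad u_y(x,0,t)=g_1(x,t)\quad(0<t<T),\qquad u(x,y,0)=u_0(x,y)\quad(y>0).$$ Then for all $x\in\mathbb R$, $y>0$, $0<t<T$: for every $\kappa\in\mathbb R$ the inner ($\lambda$-) integrals below converge, they are integrable functions of $\kappa$, and $$u(x,y,t)=\frac1{(2\pi)^2}\int_{-\infty}^\infty\int_{-\infty}^\infty E(\kappa,\lambda;x,y,t)\,\widehat{u_0}(\kappa,\lambda)\,d\lambda\,d\kappa+\frac1{(2\pi)^2}\int_{-\infty}^\infty\int_{\partial D_\kappa^+}E(\kappa,\lambda;x,y,t)\,G(\kappa,\lambda,t)\,d\lambda\,d\kappa .$$ Moreover, for every $\kappa$ the integral over $\Gamma_\kappa$ converges and $\int_{\partial D_\kappa^+}EG\,d\lambda=\int_{\Gamma_\kappa}EG\,d\lambda$, so that the formula also holds with $\partial D_\kappa^+$ replaced by $\Gamma_\kappa$. -/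

import Mathlib

open Set Filter Topology MeasureTheory

noncomputable section

namespace BiharmonicSchrodinger

/-! ### Domain, smoothness and decay, the initial-boundary value problem -/

/-- The closed space-time domain `ℝ × [0,∞) × [0,T]`; points are `(x, y, t)`. -/
def closedDomain (T : ℝ) : Set (ℝ × ℝ × ℝ) :=
  univ ×ˢ (Ici 0 ×ˢ Icc 0 T)

/-- `u` is `C^N` up to the boundary of the half space-time domain, and all its derivatives of
order at most `N` decay like `(1 + |x| + |y|)^{-N}`, uniformly in `t ∈ [0,T]`. -/
def SmoothDecaying (N : ℕ) (T : ℝ) (u : ℝ × ℝ × ℝ → ℂ) : Prop :=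
  ContDiffOn ℝ N u (closedDomain T) ∧
    ∀ n ≤ N, ∃ C : ℝ, ∀ x y t : ℝ, 0 ≤ y → 0 ≤ t → t ≤ T →
      (1 + |x| + |y|) ^ N *
        ‖iteratedFDerivWithin ℝ n u (closedDomain T) (x, y, t)‖ ≤ C

/-- `Δ²u = ∂ₓ⁴u + 2∂ₓ²∂ᵧ²u + ∂ᵧ⁴u` at `(x, y, t)`. -/
def biLaplacian (u : ℝ × ℝ × ℝ → ℂ) (x y t : ℝ) : ℂ :=
  iteratedDeriv 4 (fun ξ => u (ξ, y, t)) x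
    + 2 * iteratedDeriv 2 (fun ξ => iteratedDeriv 2 (fun η => u (ξ, η, t)) y) x
    + iteratedDeriv 4 (fun η => u (x, η, t)) y

/-- `i u_t + Δ²u = 0` in `ℝ × (0,∞) × (0,T)` with Dirichlet data `g₀`, Neumann data `g₁` and
initial datum `u₀`. -/
structure IsSolution (T : ℝ) (u₀ g₀ g₁ : ℝ → ℝ → ℂ) (u : ℝ × ℝ × ℝ → ℂ) : Prop where
  pde : ∀ x y t : ℝ, 0 < y → 0 < t → t < T →
    Complex.I * deriv (fun τ => u (x, y, τ)) t + biLaplacian u x y t = 0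
  dirichlet : ∀ x t : ℝ, 0 < t → t < T → u (x, 0, t) = g₀ x t
  neumann : ∀ x t : ℝ, 0 < t → t < T →
    derivWithin (fun η => u (x, η, t)) (Ici 0) 0 = g₁ x t
  initial : ∀ x y : ℝ, 0 < y → u (x, y, 0) = u₀ x y

/-! ### Transforms -/

/-- Half space Fourier transform (used for `κ` real and `Im l ≤ 0`). -/
def halfSpaceFT (v : ℝ → ℝ → ℂ) (κ : ℝ) (l : ℂ) : ℂ :=
  ∫ x : ℝ, ∫ y in Ioi (0 : ℝ), Complex.exp (-Complex.I * x * κ - Complex.I * y * l) * v x y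

/-- Fourier transform in `x` of a function of `(x, t)`. -/
def xFT (g : ℝ → ℝ → ℂ) (κ t : ℝ) : ℂ :=
  ∫ x : ℝ, Complex.exp (-Complex.I * x * κ) * g x t

/-- The `t`-transform `g̃(κ, η, t) = ∫₀ᵗ exp(η τ) ĝ(κ, τ) dτ`. -/
def tTransform (g : ℝ → ℝ → ℂ) (κ : ℝ) (η : ℂ) (t : ℝ) : ℂ :=
  ∫ τ in (0 : ℝ)..t, Complex.exp (η * τ) * xFT g κ τ

/-! ### The rotated square root, the map `ν_κ`, and the integrands -/

/-- The argument of `z` chosen in `[ε, 2π + ε)`. -/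
def argStar (ε : ℝ) (z : ℂ) : ℝ :=
  toIcoMod Real.two_pi_pos ε (Complex.arg z)

/-- The square root with branch cut rotated by `ε`: `|z|^{1/2} exp(i arg z / 2)`,
`arg z ∈ [ε, 2π + ε)`. -/
def sqrtStar (ε : ℝ) (z : ℂ) : ℂ :=
  (Real.sqrt ‖z‖ : ℂ) * Complex.exp (Complex.I * (argStar ε z / 2 : ℝ))

/-- `ν_κ(l) = √(-l² - 2κ²)` with the rotated branch. -/
def nu (ε κ : ℝ) (l : ℂ) : ℂ :=
  sqrtStar ε (-l ^ 2 - 2 * (κ : ℂ) ^ 2)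

/-- `E(κ, l; x, y, t) = exp(i(κ² + l²)² t + iκx + ily)`. -/
def E (κ : ℝ) (l : ℂ) (x y t : ℝ) : ℂ :=
  Complex.exp (Complex.I * ((κ : ℂ) ^ 2 + l ^ 2) ^ 2 * t + Complex.I * κ * x + Complex.I * l * y)

/-- The integrand `G(κ, l, t)`, built from `u₀`, `g₀`, `g₁` only. -/
def G (ε : ℝ) (u₀ g₀ g₁ : ℝ → ℝ → ℂ) (κ : ℝ) (l : ℂ) (t : ℝ) : ℂ :=
  (2 * l / (nu ε κ l - l) * halfSpaceFT u₀ κ (-nu ε κ l)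
      - (l + nu ε κ l) / (nu ε κ l - l) * halfSpaceFT u₀ κ (-l))
    + (2 * (l ^ 2 * nu ε κ l + l * nu ε κ l ^ 2)
          * tTransform g₀ κ (-Complex.I * ((κ : ℂ) ^ 2 + l ^ 2) ^ 2) t
      + 2 * Complex.I * (l ^ 2 + l * nu ε κ l)
          * tTransform g₁ κ (-Complex.I * ((κ : ℂ) ^ 2 + l ^ 2) ^ 2) t)

/-! ### Contours -/

/-- `I = ∫_γ f(l) dl` along the unbounded curve `γ : [0,∞) → ℂ`, as an improper integral:
integrable on each bounded piece `[0, R]`, and the integrals over `[0, R]` converge to `I`. -/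
def HasCurveIntegral (γ : ℝ → ℂ) (f : ℂ → ℂ) (I : ℂ) : Prop :=
  (∀ R : ℝ, 0 ≤ R → IntervalIntegrable (fun s => f (γ s) * deriv γ s) volume 0 R) ∧
    Tendsto (fun R : ℝ => ∫ s in (0 : ℝ)..R, f (γ s) * deriv γ s) atTop (𝓝 I)

/-- The half line from `0` to `-∞`. -/
def negAxis (s : ℝ) : ℂ := -s

/-- `I = ∫_{-∞}^{∞} f(l) dl` as an improper integral, convergent at both ends separately. -/
def HasRealLineIntegral (f : ℂ → ℂ) (I : ℂ) : Prop :=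
  ∃ I₁ I₂ : ℂ, HasCurveIntegral negAxis f I₁ ∧
    HasCurveIntegral (fun s => (s : ℂ)) f I₂ ∧ I = -I₁ + I₂

/-- `I = ∫ f(l) dl` along the segment from `0` to `i|κ|`. -/
def HasSegmentIntegral (κ : ℝ) (f : ℂ → ℂ) (I : ℂ) : Prop :=
  IntervalIntegrable (fun s : ℝ => f (s * Complex.I) * Complex.I) volume 0 |κ| ∧
    I = ∫ s in (0 : ℝ)..|κ|, f (s * Complex.I) * Complex.I

/-- `D_κ = {l : Re[i(κ² + l²)²] > 0}`. -/
def D (κ : ℝ) : Set ℂ :=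
  {l | 0 < (Complex.I * ((κ : ℂ) ^ 2 + l ^ 2) ^ 2).re}

/-- `D_κ⁺ = D_κ ∩ ℂ₊`. -/
def DPlus (κ : ℝ) : Set ℂ :=
  D κ ∩ {l | 0 < l.im}

theorem mem_DPlus (κ : ℝ) (l : ℂ) :
    l ∈ DPlus κ ↔ l.re * (κ ^ 2 + l.re ^ 2 - l.im ^ 2) < 0 ∧ 0 < l.im := by
  have h : (Complex.I * ((κ : ℂ) ^ 2 + l ^ 2) ^ 2).re
      = -(4 * l.im * (l.re * (κ ^ 2 + l.re ^ 2 - l.im ^ 2))) := by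
    simp [pow_two]
    ring
  simp only [DPlus, D, mem_inter_iff, mem_ofPred_eq, h]
  constructor
  · rintro ⟨h1, h2⟩
    exact ⟨by by_contra h3; push Not at h3; nlinarith [mul_nonneg h2.le h3], h2⟩
  · rintro ⟨h1, h2⟩
    exact ⟨by nlinarith [mul_pos h2 (neg_pos.2 h1)], h2⟩

theorem closure_DPlus (κ : ℝ) : closure (DPlus κ) =
    {l | 0 ≤ l.im ∧ ((0 ≤ l.re ∧ κ ^ 2 + l.re ^ 2 ≤ l.im ^ 2) ∨
      (l.re ≤ 0 ∧ l.im ^ 2 ≤ κ ^ 2 + l.re ^ 2))} := by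
  apply Subset.antisymm
  · apply closure_minimal
    · intro l hl
      rw [mem_DPlus] at hl
      refine ⟨hl.2.le, ?_⟩
      rcases le_total 0 l.re with h | h
      · left
        refine ⟨h, ?_⟩
        by_contra h3
        push Not at h3
        nlinarith [mul_nonneg h (sub_nonneg.2 h3.le)]
      · right
        refine ⟨h, ?_⟩
        by_contra h3
        push Not at h3
        nlinarith [mul_nonneg (neg_nonneg.2 h) (sub_nonneg.2 h3.le)]
    · have c1 : Continuous (fun l : ℂ => κ ^ 2 + l.re ^ 2) := by fun_prop
      have c2 : Continuous (fun l : ℂ => l.im ^ 2) := by fun_prop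
      exact (isClosed_le continuous_const Complex.continuous_im).inter
        (((isClosed_le continuous_const Complex.continuous_re).inter (isClosed_le c1 c2)).union
          ((isClosed_le Complex.continuous_re continuous_const).inter (isClosed_le c2 c1)))
  · rintro l ⟨h0, h⟩
    have key : ∀ p q : ℝ, (∀ δ : ℝ, 0 < δ → l + δ * (p + q * Complex.I) ∈ DPlus κ) →
        l ∈ closure (DPlus κ) := by
      intro p q hpq
      have hc : Continuous (fun δ : ℝ => l + δ * (p + q * Complex.I)) := by fun_prop
      have ht : Tendsto (fun δ : ℝ => l + δ * (p + q * Complex.I)) (𝓝[>] 0) (𝓝 l) := by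
        have := hc.tendsto 0
        simp only [Complex.ofReal_zero, zero_mul, add_zero] at this
        exact this.mono_left nhdsWithin_le_nhds
      exact mem_closure_of_tendsto ht (by filter_upwards [self_mem_nhdsWithin] with δ hδ using hpq δ hδ)
    rcases h with ⟨h1, h2⟩ | ⟨h1, h2⟩
    · have h3 : l.re ≤ l.im := by nlinarith [sq_nonneg κ]
      apply key 1 2
      intro δ hδ
      rw [mem_DPlus]
      simp
      constructor
      · apply mul_neg_of_pos_of_neg <;> nlinarith [mul_nonneg hδ.le h1, mul_nonneg hδ.le h0, mul_pos hδ hδ, mul_nonneg hδ.le (sub_nonneg.2 h3)]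
      · nlinarith
    · rcases h0.lt_or_eq with h3 | h3
      · apply key (-1) 0
        intro δ hδ
        rw [mem_DPlus]
        simp
        exact ⟨mul_neg_of_neg_of_pos (by linarith)
          (by nlinarith [mul_nonneg hδ.le (neg_nonneg.2 h1)]), h3⟩
      · apply key (-2) 1
        intro δ hδ
        rw [mem_DPlus]
        simp [← h3]
        exact ⟨mul_neg_of_neg_of_pos (by linarith)
          (by nlinarith [mul_nonneg hδ.le (neg_nonneg.2 h1), sq_nonneg κ, sq_nonneg l.re,
            mul_pos hδ hδ]), hδ⟩

/-- The half line from `i|κ|` to `i∞`. -/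
def imAxis (κ s : ℝ) : ℂ := ((|κ| + s : ℝ) : ℂ) * Complex.I

/-- The right half, starting at `i|κ|`, of the upper branch of `(Im l)² = κ² + (Re l)²`. -/
def rightHyperbola (κ s : ℝ) : ℂ := s + (Real.sqrt (κ ^ 2 + s ^ 2) : ℂ) * Complex.I

/-- The left half, starting at `i|κ|`, of the upper branch of `(Im l)² = κ² + (Re l)²`. -/
def leftHyperbola (κ s : ℝ) : ℂ := -s + (Real.sqrt (κ ^ 2 + s ^ 2) : ℂ) * Complex.I

/-- The topological boundary of `D_κ⁺` is the union of the five pieces of the contour. -/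
theorem frontier_DPlus (κ : ℝ) : frontier (DPlus κ) =
    negAxis '' Ici 0 ∪ (fun s : ℝ => (s : ℂ) * Complex.I) '' Icc 0 |κ| ∪
      leftHyperbola κ '' Ici 0 ∪ imAxis κ '' Ici 0 ∪ rightHyperbola κ '' Ici 0 := by
  have ho : IsOpen (DPlus κ) := by
    have c1 : Continuous (fun l : ℂ => (Complex.I * ((κ : ℂ) ^ 2 + l ^ 2) ^ 2).re) := by fun_prop
    exact (isOpen_lt continuous_const c1).inter (isOpen_lt continuous_const Complex.continuous_im)
  rw [ho.frontier_eq, closure_DPlus]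
  ext l
  simp only [Set.mem_sdiff, mem_DPlus, mem_ofPred_eq, mem_union, mem_image, mem_Ici, mem_Icc]
  constructor
  · rintro ⟨⟨h0, h⟩, hn⟩
    rcases h0.lt_or_eq with h3 | h3
    · have hz : l.re * (κ ^ 2 + l.re ^ 2 - l.im ^ 2) = 0 := by
        have h4 : 0 ≤ l.re * (κ ^ 2 + l.re ^ 2 - l.im ^ 2) := by
          by_contra h5
          exact hn ⟨not_le.1 h5, h3⟩
        rcases h with ⟨h1, h2⟩ | ⟨h1, h2⟩
        · nlinarith [mul_nonneg h1 (sub_nonneg.2 h2)]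
        · nlinarith [mul_nonneg (neg_nonneg.2 h1) (sub_nonneg.2 h2)]
      rcases mul_eq_zero.1 hz with h4 | h4
      · rcases le_total l.im |κ| with h5 | h5
        · left; left; left; right
          exact ⟨l.im, ⟨h0, h5⟩, by apply Complex.ext <;> simp [h4]⟩
        · left; right
          exact ⟨l.im - |κ|, by linarith, by apply Complex.ext <;> simp [imAxis, h4]⟩
      · have h6 : Real.sqrt (κ ^ 2 + l.re ^ 2) = l.im := by
          rw [show κ ^ 2 + l.re ^ 2 = l.im ^ 2 by linarith, Real.sqrt_sq h0]
        rcases le_total 0 l.re with h5 | h5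
        · right
          exact ⟨l.re, h5, by apply Complex.ext <;> simp [rightHyperbola, h6]⟩
        · left; left; right
          exact ⟨-l.re, by linarith, by apply Complex.ext <;> simp [leftHyperbola, h6]⟩
    · rcases h with ⟨h1, h2⟩ | ⟨h1, h2⟩
      · have h4 : l.re = 0 := by
          rw [← h3] at h2
          nlinarith [sq_nonneg κ, sq_nonneg l.re]
        left; left; left; left
        exact ⟨0, le_rfl, by apply Complex.ext <;> simp [negAxis, h4, ← h3]⟩
      · left; left; left; left
        exact ⟨-l.re, by linarith, by apply Complex.ext <;> simp [negAxis, ← h3]⟩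
  · rintro ((((⟨s, hs, rfl⟩ | ⟨s, hs, rfl⟩) | ⟨s, hs, rfl⟩) | ⟨s, hs, rfl⟩) | ⟨s, hs, rfl⟩)
    · simp [negAxis, hs]
      right
      positivity
    · simp [hs.1]
      right
      nlinarith [sq_abs κ, hs.1, hs.2, abs_nonneg κ]
    · have := Real.sq_sqrt (show 0 ≤ κ ^ 2 + s ^ 2 by positivity)
      simp [leftHyperbola, hs, this, Real.sqrt_nonneg]
    · have h1 : κ ^ 2 ≤ (|κ| + s) ^ 2 := by nlinarith [sq_abs κ, abs_nonneg κ]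
      have h2 : 0 ≤ |κ| + s := by positivity
      simp [imAxis, h1, h2]
    · have := Real.sq_sqrt (show 0 ≤ κ ^ 2 + s ^ 2 by positivity)
      simp [rightHyperbola, hs, this, Real.sqrt_nonneg]

/-- `I = ∫_{∂D_κ⁺} f(l) dl`, with `D_κ⁺` to the left of its boundary (see `frontier_DPlus`).
The component in `Re l < 0` is bounded by `-∞ → 0 → i|κ|` followed by the left half hyperbola
traversed outwards; the component in `Re l > 0` by `i∞ → i|κ|` followed by the right half
hyperbola traversed outwards. -/
def HasBoundaryIntegral (κ : ℝ) (f : ℂ → ℂ) (I : ℂ) : Prop :=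
  ∃ I₁ I₂ I₃ I₄ I₅ : ℂ, HasCurveIntegral negAxis f I₁ ∧ HasSegmentIntegral κ f I₂ ∧
    HasCurveIntegral (leftHyperbola κ) f I₃ ∧ HasCurveIntegral (imAxis κ) f I₄ ∧
    HasCurveIntegral (rightHyperbola κ) f I₅ ∧
    I = (-I₁ + I₂ + I₃) + (-I₄ + I₅)

/-- The ray from `i|κ|` to infinity in the direction `e^{3πi/4}`. -/
def leftRay (κ s : ℝ) : ℂ := -s + ((|κ| + s : ℝ) : ℂ) * Complex.I

/-- The ray from `0` to infinity in the direction `e^{πi/4}`. -/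
def rightRay (s : ℝ) : ℂ := s + (s : ℂ) * Complex.I

/-- `I = ∫ f(l) dl` over the asymptotic form of the contour, in which both half hyperbolas are
replaced by rays in their asymptotic directions: `-∞ → 0 → i|κ| → i|κ| + e^{3πi/4}∞` on the
left, `i∞ → 0 → e^{πi/4}∞` on the right. -/
def HasAsymptoticBoundaryIntegral (κ : ℝ) (f : ℂ → ℂ) (I : ℂ) : Prop :=
  ∃ I₁ I₂ I₃ I₄ I₅ : ℂ, HasCurveIntegral negAxis f I₁ ∧ HasSegmentIntegral κ f I₂ ∧
    HasCurveIntegral (leftRay κ) f I₃ ∧ HasCurveIntegral (imAxis 0) f I₄ ∧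
    HasCurveIntegral rightRay f I₅ ∧
    I = (-I₁ + I₂ + I₃) + (-I₄ + I₅)

end BiharmonicSchrodinger

end

open Set Filter Topology MeasureTheory

noncomputable section

namespace BiharmonicSchrodinger

/-! This is the unified transform (Fokas) method. Write `û(κ,y,t)` for the Fourier transform of `u`
in `x`, `U(l)` and `U₀(l)` for the half-line transforms in `y` of `û(κ,·,t)` and `û(κ,·,0)`, and `η
= -i(κ²+l²)²`. Transforming the equation in `x` and `y` and integrating `e^{ητ}` times the result
over `[0,t]` gives, for `Im l ≤ 0`, the global relation `e^{ηt} U(l) - U₀(l) = W(l)`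
(`global_relation`). Here `W`, called `boundaryData`, is an entire function of `l`, a combination of
the time transforms `T₀, …, T₃` of the traces of `u, u_y, u_yy, u_yyy` at `y = 0`.

Multiply by `E` on the real `l`-axis and integrate. Inversion in `y` yields `∫_ℝ E W dl = 2π e^{iκx}
û(κ,y,t) - A(κ)`, where `A(κ)` is the inner integral of the initial datum. Inversion in `x` then
gives the formula, once `∫_{∂D⁺} E G dl = ∫_ℝ E W dl` is known.

The unknown `T₂, T₃` are eliminated from `W(l)` by means of the relations at `-l` and `-ν`. Both
points lie in the closed lower half plane, and they share the same `η` because `ν² = -l² - 2κ²`. The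
weights `(l+ν)/(ν-l)` and `-2l/(ν-l)` reproduce the `T₂, T₃` part of `W(l)`, so that `E G = E W -
e^{iκx+ily} (U(-l) + 2l S)`, with `S` the divided difference of `U` between `-l` and `-ν`
(`eliminate_boundary_values`, `E_mul_G_eq`). Only the point `l = i|κ|`, where `ν = l`, is excluded;
written with `S`, the right side has no pole there.

Two contour deformations finish the argument (`contour_integrals`). (a) `E W` is continuous and
`O(e^{-y Im l}/(1+|l|))` on the part of the closed upper half plane where `Re η ≥ 0`
(`isDecaying_boundaryTerm`), so `∂D⁺` may be pushed through that region to the real axis. (b) The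
reflected term has the same decay in each closed quadrant, with a branch of `ν` chosen separately
there (`isDecaying_reflected`), so its integral around each component of `D⁺` vanishes. The decay
allows a Jordan-type estimate for the arcs at infinity (`tendsto_integral_sub_of_homotopy`). The
same deformations replace the hyperbolas by rays.

Convergence on the real axis is only conditional: `U` and `U₀` decay like `1/|l|` when the trace at
`y = 0` does not vanish. For `U₀` the phase `(κ²+l²)²t` provides convergence with a bound that keeps
the decay in `κ` (`exists_oscillatory_limit`). For `U`, an integration by parts in `l` reduces to an
absolutely convergent inversion (`IsC2Decaying.hasRealLineIntegral`). -/

/-! ### Curves and contour deformation -/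

/-- A curve on `[0, ∞)` of class `C¹`, twice differentiable away from `0`, of at most linear
growth and bounded speed. -/
structure IsTameCurve (γ γ' : ℝ → ℂ) : Prop where
  cont : ContinuousOn γ (Ici 0)
  cont_deriv : ContinuousOn γ' (Ici 0)
  hasDerivAt : ∀ s, 0 < s → HasDerivAt γ (γ' s) s
  differentiableAt : ∀ s, 0 < s → DifferentiableAt ℝ γ' s
  growth : ∃ C, ∀ s, 0 ≤ s → ‖γ s‖ ≤ C * (1 + s)
  speed : ∃ C, ∀ s, 0 ≤ s → ‖γ' s‖ ≤ C

/-- Cauchy's theorem for the straight-line homotopy, from the divergence theorem on `[0,R] × [0,1]`.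
Holomorphy is needed only for `s > 0` and `0 < θ < 1`, and continuity up to the boundary. This
matters because the curves run along the axes, where the integrands built from `ν` need not be
holomorphic. -/
theorem integral_homotopy {a a' b b' : ℝ → ℂ} (ha : IsTameCurve a a') (hb : IsTameCurve b b')
    {F : ℂ → ℂ} {S : Set ℂ} (hF : ContinuousOn F S)
    (hmem : ∀ s, 0 ≤ s → ∀ θ : ℝ, θ ∈ Icc (0 : ℝ) 1 → a s + θ * (b s - a s) ∈ S)
    (hdiff : ∀ s, 0 < s → ∀ θ : ℝ, θ ∈ Ioo (0 : ℝ) 1 →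
      DifferentiableAt ℂ F (a s + θ * (b s - a s)))
    {R : ℝ} (hR : 0 ≤ R) :
    (∫ s in (0 : ℝ)..R, F (a s) * a' s) - ∫ s in (0 : ℝ)..R, F (b s) * b' s =
      (∫ θ in (0 : ℝ)..1, F (a 0 + θ * (b 0 - a 0)) * (b 0 - a 0)) -
        ∫ θ in (0 : ℝ)..1, F (a R + θ * (b R - a R)) * (b R - a R) := by
  set Γ : ℝ × ℝ → ℂ := fun p => a p.1 + p.2 * (b p.1 - a p.1) with hΓ
  set Γ₁ : ℝ × ℝ → ℂ := fun p => a' p.1 + p.2 * (b' p.1 - a' p.1) with hΓ₁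
  -- The pulled-back form is `F(Γ) ∂_sΓ ds + F(Γ) ∂_θΓ dθ`. Its closedness `∂_s f + ∂_θ g = 0`
  -- follows from complex differentiability of `F` and equality of the mixed derivatives of `Γ`.
  set f : ℝ × ℝ → ℂ := fun p => F (Γ p) * (b p.1 - a p.1) with hf
  set g : ℝ × ℝ → ℂ := fun p => -(F (Γ p) * Γ₁ p) with hg
  have hsub : (uIcc 0 R ×ˢ uIcc (0 : ℝ) 1 : Set (ℝ × ℝ)) ⊆ Ici 0 ×ˢ Icc 0 1 := by
    rw [uIcc_of_le hR, uIcc_of_le zero_le_one]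
    exact prod_mono Icc_subset_Ici_self le_rfl
  have cfst : ∀ {h : ℝ → ℂ}, ContinuousOn h (Ici 0) →
      ContinuousOn (fun p : ℝ × ℝ => h p.1) (uIcc 0 R ×ˢ uIcc (0 : ℝ) 1) := fun hh =>
    hh.comp continuousOn_fst fun p hp => (hsub hp).1
  have csnd : ContinuousOn (fun p : ℝ × ℝ => (p.2 : ℂ)) (uIcc 0 R ×ˢ uIcc (0 : ℝ) 1) :=
    (Complex.continuous_ofReal.comp continuous_snd).continuousOn
  have cΓ : ContinuousOn Γ (uIcc 0 R ×ˢ uIcc (0 : ℝ) 1) :=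
    (cfst ha.cont).add (csnd.mul ((cfst hb.cont).sub (cfst ha.cont)))
  have cΓ₁ : ContinuousOn Γ₁ (uIcc 0 R ×ˢ uIcc (0 : ℝ) 1) :=
    (cfst ha.cont_deriv).add (csnd.mul ((cfst hb.cont_deriv).sub (cfst ha.cont_deriv)))
  have cFΓ : ContinuousOn (fun p => F (Γ p)) (uIcc 0 R ×ˢ uIcc (0 : ℝ) 1) :=
    hF.comp cΓ fun p hp => hmem p.1 (hsub hp).1 p.2 (hsub hp).2
  have key : ∀ p ∈ Ioo (min 0 R) (max 0 R) ×ˢ Ioo (min (0 : ℝ) 1) (max 0 1) \ (∅ : Set (ℝ × ℝ)),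
      ∃ f' g' : ℝ × ℝ →L[ℝ] ℂ, HasFDerivAt f f' p ∧ HasFDerivAt g g' p ∧
        f' (1, 0) + g' (0, 1) = 0 := by
    rintro ⟨s, θ⟩ ⟨⟨h1, h2⟩, -⟩
    rw [min_eq_left hR, max_eq_right hR] at h1
    simp only [zero_le_one, inf_of_le_left, sup_of_le_right] at h2
    have hs : 0 < s := h1.1
    have l1 : HasFDerivAt (fun p : ℝ × ℝ => p.1) (ContinuousLinearMap.fst ℝ ℝ ℝ) (s, θ) :=
      hasFDerivAt_fst
    have l2 : HasFDerivAt (fun p : ℝ × ℝ => (p.2 : ℂ))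
        (Complex.ofRealCLM.comp (ContinuousLinearMap.snd ℝ ℝ ℝ)) (s, θ) :=
      Complex.ofRealCLM.hasFDerivAt.comp (s, θ) hasFDerivAt_snd
    have la := (ha.hasDerivAt s hs).hasFDerivAt.comp (s, θ) l1
    have lb := (hb.hasDerivAt s hs).hasFDerivAt.comp (s, θ) l1
    have la' := (ha.differentiableAt s hs).hasDerivAt.hasFDerivAt.comp (s, θ) l1
    have lb' := (hb.differentiableAt s hs).hasDerivAt.hasFDerivAt.comp (s, θ) l1
    have lΓ := la.add (l2.mul (lb.sub la))
    have lΓ₁ := la'.add (l2.mul (lb'.sub la'))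
    have lF := ((hdiff s hs θ h2).hasDerivAt.hasFDerivAt.restrictScalars ℝ).comp
      (x := ((s, θ) : ℝ × ℝ)) (f := Γ) lΓ
    have lf := lF.mul (lb.sub la)
    have lg := (lF.mul lΓ₁).neg
    refine ⟨_, _, lf, lg, ?_⟩
    simp [hΓ]
    ring
  choose! f' g' hf' hg' h0 using key
  have hzero : ∀ᵐ p ∂(volume.restrict (uIcc 0 R ×ˢ uIcc (0 : ℝ) 1) : Measure (ℝ × ℝ)),
      f' p (1, 0) + g' p (0, 1) = 0 := by
    rw [show (volume.restrict (uIcc 0 R ×ˢ uIcc (0 : ℝ) 1) : Measure (ℝ × ℝ)) =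
      volume.restrict (Ioo (min 0 R) (max 0 R) ×ˢ Ioo (min (0 : ℝ) 1) (max 0 1)) from ?_]
    · exact (ae_restrict_iff' (measurableSet_Ioo.prod measurableSet_Ioo)).2
        (Eventually.of_forall fun p hp => h0 p (by simpa using hp))
    · rw [Measure.volume_eq_prod, ← Measure.prod_restrict, ← Measure.prod_restrict]
      simp only [uIcc]
      rw [restrict_Ioo_eq_restrict_Icc, restrict_Ioo_eq_restrict_Icc]
  have main := integral2_divergence_prod_of_hasFDerivAt_off_countable f g f' g' 0 0 R 1 ∅
    countable_empty (cFΓ.mul ((cfst hb.cont).sub (cfst ha.cont))) (cFΓ.mul cΓ₁).neg hf' hg'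
    ((integrable_zero _ _ _).congr (hzero.mono fun p hp => hp.symm))
  have hlhs : (∫ s in (0 : ℝ)..R, ∫ θ in (0 : ℝ)..1, f' (s, θ) (1, 0) + g' (s, θ) (0, 1)) = 0 := by
    rw [intervalIntegral.integral_of_le hR, ← integral_Ioc_eq_integral_Ioo.symm]
    rw [setIntegral_congr_fun (g := fun _ => (0 : ℂ)) measurableSet_Ioo]
    · simp
    intro s hs
    simp only
    rw [intervalIntegral.integral_of_le zero_le_one, ← integral_Ioc_eq_integral_Ioo.symm,
      setIntegral_congr_fun (g := fun _ => (0 : ℂ)) measurableSet_Ioo]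
    · simp
    intro θ hθ
    exact h0 (s, θ) (by simpa [hR] using ⟨hs, hθ⟩)
  rw [hlhs] at main
  simp only [hf, hg, hΓ, hΓ₁, Complex.ofReal_one, Complex.ofReal_zero, one_mul, zero_mul,
    add_zero, add_sub_cancel, intervalIntegral.integral_neg] at main
  linear_combination -main

theorem integral_mul_exp_neg_le {y R : ℝ} (hy : 0 < y) (hR : 0 < R) :
    ∫ θ in (0 : ℝ)..1, Real.exp (-y * (θ * R)) ≤ 1 / (y * R) := by
  have h : ∀ θ : ℝ, HasDerivAt (fun θ => -(1 / (y * R)) * Real.exp (-y * (θ * R)))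
      (Real.exp (-y * (θ * R))) θ := by
    intro θ
    have h1 : HasDerivAt (fun θ : ℝ => -y * (θ * R)) (-y * R) θ := by
      simpa using ((hasDerivAt_id θ).mul_const R).const_mul (-y)
    exact (h1.exp.const_mul (-(1 / (y * R)))).congr_deriv (by field_simp)
  rw [intervalIntegral.integral_eq_sub_of_hasDerivAt (fun θ _ => h θ)
    (by apply Continuous.intervalIntegrable; fun_prop)]
  simp
  positivity

/-- Contour deformation for a function that decays like `exp (-y Im l) / (1 + |l|)`. -/
theorem tendsto_integral_sub_of_homotopy {a a' b b' : ℝ → ℂ} (ha : IsTameCurve a a')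
    (hb : IsTameCurve b b') {F : ℂ → ℂ} {S : Set ℂ} (hF : ContinuousOn F S)
    {y C : ℝ} (hy : 0 < y)
    (hbd : ∀ l ∈ S, ‖F l‖ ≤ C * Real.exp (-y * l.im) / (1 + ‖l‖))
    (hmem : ∀ s, 0 ≤ s → ∀ θ : ℝ, θ ∈ Icc (0 : ℝ) 1 → a s + θ * (b s - a s) ∈ S)
    (hdiff : ∀ s, 0 < s → ∀ θ : ℝ, θ ∈ Ioo (0 : ℝ) 1 →
      DifferentiableAt ℂ F (a s + θ * (b s - a s)))
    (him : ∀ s, 0 ≤ s → ∀ θ : ℝ, θ ∈ Icc (0 : ℝ) 1 → θ * s ≤ (a s + θ * (b s - a s)).im)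
    (hnorm : ∀ s, 0 ≤ s → ∀ θ : ℝ, θ ∈ Icc (0 : ℝ) 1 → s ≤ ‖a s + θ * (b s - a s)‖) :
    Tendsto (fun R => (∫ s in (0 : ℝ)..R, F (a s) * a' s) - ∫ s in (0 : ℝ)..R, F (b s) * b' s)
      atTop (𝓝 (∫ θ in (0 : ℝ)..1, F (a 0 + θ * (b 0 - a 0)) * (b 0 - a 0))) := by
  have hC : 0 ≤ C := by
    have := (norm_nonneg _).trans (hbd _ (hmem 0 le_rfl 0 (by simp)))
    by_contra h
    push Not at h
    have h2 := Real.exp_pos (-y * (a 0 + ((0 : ℝ) : ℂ) * (b 0 - a 0)).im)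
    have h3 : 0 < 1 + ‖a 0 + ((0 : ℝ) : ℂ) * (b 0 - a 0)‖ := by positivity
    have := div_neg_of_neg_of_pos (mul_neg_of_neg_of_pos h h2) h3
    linarith
  obtain ⟨Ca, hCa⟩ := ha.growth
  obtain ⟨Cb, hCb⟩ := hb.growth
  have hend : Tendsto (fun R => ∫ θ in (0 : ℝ)..1, F (a R + θ * (b R - a R)) * (b R - a R))
      atTop (𝓝 0) := by
    have hlim : Tendsto (fun R : ℝ => (C * (Cb + Ca) / y) * R⁻¹) atTop (𝓝 0) := by
      simpa using tendsto_inv_atTop_zero.const_mul (C * (Cb + Ca) / y)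
    apply squeeze_zero_norm' _ hlim
    filter_upwards [eventually_gt_atTop 0] with R hR
    have hba : ‖b R - a R‖ ≤ (Cb + Ca) * (1 + R) :=
      (norm_sub_le _ _).trans (by linarith [hCa R hR.le, hCb R hR.le])
    have hCC : 0 ≤ Cb + Ca := by
      by_contra h
      push Not at h
      nlinarith [norm_nonneg (b R - a R)]
    -- Jordan's lemma on the far rung: its length `O(1+R)` cancels the factor `1/(1+|l|)`, and
    -- `exp(-yθR)` integrates to at most `1/(yR)`.
    calc ‖∫ θ in (0 : ℝ)..1, F (a R + θ * (b R - a R)) * (b R - a R)‖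
        ≤ ∫ θ in (0 : ℝ)..1, (C * (Cb + Ca)) * Real.exp (-y * (θ * R)) := by
          apply intervalIntegral.norm_integral_le_of_norm_le zero_le_one
          · refine Eventually.of_forall fun θ hθ => ?_
            have hθ' : θ ∈ Icc (0 : ℝ) 1 := Ioc_subset_Icc_self hθ
            have h1 := hbd _ (hmem R hR.le θ hθ')
            have h2 := him R hR.le θ hθ'
            have h3 := hnorm R hR.le θ hθ'
            have h4 : Real.exp (-y * (a R + θ * (b R - a R)).im) ≤ Real.exp (-y * (θ * R)) :=
              Real.exp_le_exp.2 (by nlinarith)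
            rw [norm_mul]
            calc _ ≤ (C * Real.exp (-y * (θ * R)) / (1 + R)) * ((Cb + Ca) * (1 + R)) := by
                  gcongr
                  exact h1.trans (by gcongr)
              _ = _ := by field_simp
          · apply Continuous.intervalIntegrable; fun_prop
      _ = (C * (Cb + Ca)) * ∫ θ in (0 : ℝ)..1, Real.exp (-y * (θ * R)) := by
          rw [intervalIntegral.integral_const_mul]
      _ ≤ (C * (Cb + Ca)) * (1 / (y * R)) := by
          gcongr
          exact integral_mul_exp_neg_le hy hR
      _ = _ := by field_simp
  have := hend.const_sub (∫ θ in (0 : ℝ)..1, F (a 0 + θ * (b 0 - a 0)) * (b 0 - a 0))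
  rw [sub_zero] at this
  refine this.congr' ?_
  filter_upwards [eventually_ge_atTop 0] with R hR
  exact (integral_homotopy ha hb hF hmem hdiff hR).symm

theorem IsTameCurve.integral_eq {γ γ' : ℝ → ℂ} (h : IsTameCurve γ γ') (F : ℂ → ℂ) {R : ℝ}
    (hR : 0 ≤ R) :
    ∫ s in (0 : ℝ)..R, F (γ s) * deriv γ s = ∫ s in (0 : ℝ)..R, F (γ s) * γ' s := by
  rw [intervalIntegral.integral_of_le hR, intervalIntegral.integral_of_le hR]
  refine setIntegral_congr_fun measurableSet_Ioc fun s hs => ?_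
  simp only [(h.hasDerivAt s hs.1).deriv]

theorem IsTameCurve.intervalIntegrable {γ γ' : ℝ → ℂ} (h : IsTameCurve γ γ') {F : ℂ → ℂ}
    {S : Set ℂ} (hF : ContinuousOn F S) (hmem : ∀ s, 0 ≤ s → γ s ∈ S) {R : ℝ} (hR : 0 ≤ R) :
    IntervalIntegrable (fun s => F (γ s) * deriv γ s) volume 0 R := by
  have h1 : IntervalIntegrable (fun s => F (γ s) * γ' s) volume 0 R := by
    apply ContinuousOn.intervalIntegrable
    rw [uIcc_of_le hR]
    exact ((hF.comp h.cont fun s hs => hmem s hs).mul h.cont_deriv).mono Icc_subset_Ici_self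
  refine h1.congr ?_
  rw [uIoc_of_le hR]
  intro s hs
  simp only [(h.hasDerivAt s hs.1).deriv]

/-- A curve integral converges absolutely if the integrand decays exponentially. -/
theorem IsTameCurve.exists_hasCurveIntegral {γ γ' : ℝ → ℂ} (h : IsTameCurve γ γ') {F : ℂ → ℂ}
    {S : Set ℂ} (hF : ContinuousOn F S) (hmem : ∀ s, 0 ≤ s → γ s ∈ S) {y C : ℝ} (hy : 0 < y)
    (hbd : ∀ l ∈ S, ‖F l‖ ≤ C * Real.exp (-y * l.im) / (1 + ‖l‖))
    (him : ∀ s, 0 ≤ s → s ≤ (γ s).im) :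
    ∃ I, HasCurveIntegral γ F I := by
  obtain ⟨c, hc⟩ := h.speed
  have hcont : ContinuousOn (fun s => F (γ s) * γ' s) (Ici 0) :=
    (hF.comp h.cont fun s hs => hmem s hs).mul h.cont_deriv
  have hInt : IntegrableOn (fun s => F (γ s) * γ' s) (Ioi 0) := by
    have h0 : IntegrableOn (fun s : ℝ => (|C| * c) * Real.exp (-y * s)) (Ioi 0) :=
      (exp_neg_integrableOn_Ioi 0 hy).const_mul _
    refine h0.mono' ((hcont.mono Ioi_subset_Ici_self).aestronglyMeasurable measurableSet_Ioi) ?_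
    refine (ae_restrict_iff' measurableSet_Ioi).2 (Eventually.of_forall fun s hs => ?_)
    have hs' : 0 ≤ s := le_of_lt hs
    rw [norm_mul]
    have h2 : Real.exp (-y * (γ s).im) ≤ Real.exp (-y * s) :=
      Real.exp_le_exp.2 (by nlinarith [him s hs'])
    calc _ ≤ (|C| * Real.exp (-y * s)) * c := by
          gcongr
          · refine (hbd _ (hmem s hs')).trans ?_
            rw [div_le_iff₀ (by positivity)]
            calc C * Real.exp (-y * (γ s).im) ≤ |C| * Real.exp (-y * s) * 1 := by
                  rw [mul_one]
                  gcongr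
                  exact le_abs_self C
              _ ≤ _ := by
                  gcongr
                  linarith [norm_nonneg (γ s)]
          · exact hc s hs'
      _ = _ := by ring
  refine ⟨∫ s in Ioi 0, F (γ s) * γ' s, fun R hR => h.intervalIntegrable hF hmem hR, ?_⟩
  refine (intervalIntegral_tendsto_integral_Ioi 0 hInt tendsto_id).congr' ?_
  filter_upwards [eventually_ge_atTop 0] with R hR
  exact (h.integral_eq F hR).symm

/-- Transfer of a curve integral along a homotopy. -/
theorem HasCurveIntegral.of_homotopy {a a' b b' : ℝ → ℂ} (ha : IsTameCurve a a')
    (hb : IsTameCurve b b') {F : ℂ → ℂ} {S : Set ℂ} (hF : ContinuousOn F S)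
    {y C : ℝ} (hy : 0 < y)
    (hbd : ∀ l ∈ S, ‖F l‖ ≤ C * Real.exp (-y * l.im) / (1 + ‖l‖))
    (hmem : ∀ s, 0 ≤ s → ∀ θ : ℝ, θ ∈ Icc (0 : ℝ) 1 → a s + θ * (b s - a s) ∈ S)
    (hdiff : ∀ s, 0 < s → ∀ θ : ℝ, θ ∈ Ioo (0 : ℝ) 1 →
      DifferentiableAt ℂ F (a s + θ * (b s - a s)))
    (him : ∀ s, 0 ≤ s → ∀ θ : ℝ, θ ∈ Icc (0 : ℝ) 1 → θ * s ≤ (a s + θ * (b s - a s)).im)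
    (hnorm : ∀ s, 0 ≤ s → ∀ θ : ℝ, θ ∈ Icc (0 : ℝ) 1 → s ≤ ‖a s + θ * (b s - a s)‖)
    {I : ℂ} (hI : HasCurveIntegral b F I) :
    HasCurveIntegral a F
      (I + ∫ θ in (0 : ℝ)..1, F (a 0 + θ * (b 0 - a 0)) * (b 0 - a 0)) := by
  refine ⟨fun R hR => ha.intervalIntegrable hF
    (fun s hs => by simpa using hmem s hs 0 (by simp)) hR, ?_⟩
  refine (hI.2.add
    (tendsto_integral_sub_of_homotopy ha hb hF hy hbd hmem hdiff him hnorm)).congr' ?_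
  filter_upwards [eventually_ge_atTop 0] with R hR
  rw [ha.integral_eq F hR, hb.integral_eq F hR]
  ring

theorem HasCurveIntegral.unique {γ : ℝ → ℂ} {F : ℂ → ℂ} {I J : ℂ}
    (hI : HasCurveIntegral γ F I) (hJ : HasCurveIntegral γ F J) : I = J :=
  tendsto_nhds_unique hI.2 hJ.2

theorem HasCurveIntegral.sub {γ : ℝ → ℂ} {F₁ F₂ : ℂ → ℂ} {I J : ℂ}
    (hI : HasCurveIntegral γ F₁ I) (hJ : HasCurveIntegral γ F₂ J) :
    HasCurveIntegral γ (fun l => F₁ l - F₂ l) (I - J) := by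
  have e : (fun s => (F₁ (γ s) - F₂ (γ s)) * deriv γ s) =
      fun s => F₁ (γ s) * deriv γ s - F₂ (γ s) * deriv γ s := by
    ext s; ring
  refine ⟨fun R hR => ?_, (hI.2.sub hJ.2).congr' ?_⟩
  · simp only [e]
    exact (hI.1 R hR).sub (hJ.1 R hR)
  · filter_upwards [eventually_ge_atTop 0] with R hR
    simp only [e]
    rw [intervalIntegral.integral_sub (hI.1 R hR) (hJ.1 R hR)]

/-- A curve integral does not see the value of the integrand at one point. -/
theorem HasCurveIntegral.congr_off {γ : ℝ → ℂ} {F₁ F₂ : ℂ → ℂ} {I : ℂ}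
    (hI : HasCurveIntegral γ F₁ I) {p : ℂ} (hinj : InjOn γ (Ici 0))
    (h : ∀ s, 0 ≤ s → γ s ≠ p → F₁ (γ s) = F₂ (γ s)) : HasCurveIntegral γ F₂ I := by
  have hae : ∀ R, 0 ≤ R → (fun s => F₁ (γ s) * deriv γ s) =ᵐ[volume.restrict (uIoc 0 R)]
      fun s => F₂ (γ s) * deriv γ s := by
    intro R hR
    have hsing : ({s | 0 ≤ s ∧ γ s = p} : Set ℝ).Subsingleton := fun s hs s' hs' =>
      hinj hs.1 hs'.1 (hs.2.trans hs'.2.symm)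
    have hn : ∀ᵐ s : ℝ, s ∉ {s | 0 ≤ s ∧ γ s = p} :=
      measure_eq_zero_iff_ae_notMem.1 (hsing.measure_zero volume)
    rw [uIoc_of_le hR]
    filter_upwards [ae_restrict_of_ae hn, ae_restrict_mem measurableSet_Ioc] with s hs hs'
    rw [h s hs'.1.le fun hp => hs ⟨hs'.1.le, hp⟩]
  refine ⟨fun R hR => (hI.1 R hR).congr_ae (hae R hR), hI.2.congr' ?_⟩
  filter_upwards [eventually_ge_atTop 0] with R hR
  exact intervalIntegral.integral_congr_ae_restrict (hae R hR)

/-! ### The curves making up the contours -/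

theorem IsTameCurve.add {a a' b b' : ℝ → ℂ} (ha : IsTameCurve a a') (hb : IsTameCurve b b') :
    IsTameCurve (fun s => a s + b s) (fun s => a' s + b' s) where
  cont := ha.cont.add hb.cont
  cont_deriv := ha.cont_deriv.add hb.cont_deriv
  hasDerivAt s hs := (ha.hasDerivAt s hs).add (hb.hasDerivAt s hs)
  differentiableAt s hs := (ha.differentiableAt s hs).add (hb.differentiableAt s hs)
  growth := by
    obtain ⟨C, hC⟩ := ha.growth
    obtain ⟨D, hD⟩ := hb.growth
    exact ⟨C + D, fun s hs => (norm_add_le _ _).trans (by linarith [hC s hs, hD s hs])⟩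
  speed := by
    obtain ⟨C, hC⟩ := ha.speed
    obtain ⟨D, hD⟩ := hb.speed
    exact ⟨C + D, fun s hs => (norm_add_le _ _).trans (by linarith [hC s hs, hD s hs])⟩

theorem isTameCurve_affine (c d : ℂ) : IsTameCurve (fun s => c + s * d) (fun _ => d) where
  cont := by fun_prop
  cont_deriv := by fun_prop
  hasDerivAt s _ := by
    simpa using ((Complex.ofRealCLM.hasDerivAt (x := s)).mul_const d).const_add c
  differentiableAt s _ := differentiableAt_const d
  growth := ⟨‖c‖ + ‖d‖, fun s hs => by
    refine (norm_add_le _ _).trans ?_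
    rw [norm_mul, Complex.norm_real, Real.norm_of_nonneg hs]
    nlinarith [norm_nonneg c, norm_nonneg d, mul_nonneg hs (norm_nonneg c)]⟩
  speed := ⟨‖d‖, fun _ _ => le_rfl⟩

theorem isTameCurve_sqrt (κ : ℝ) : ∃ γ' : ℝ → ℂ,
    IsTameCurve (fun s => (Real.sqrt (κ ^ 2 + s ^ 2) : ℂ) * Complex.I) γ' := by
  have hgrowth : ∃ C, ∀ s : ℝ, 0 ≤ s →
      ‖(Real.sqrt (κ ^ 2 + s ^ 2) : ℂ) * Complex.I‖ ≤ C * (1 + s) := by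
    refine ⟨|κ| + 1, fun s hs => ?_⟩
    rw [norm_mul, Complex.norm_real, Complex.norm_I, mul_one,
      Real.norm_of_nonneg (Real.sqrt_nonneg _)]
    apply Real.sqrt_le_iff.2 ⟨by positivity, ?_⟩
    rw [← sq_abs κ]
    nlinarith [abs_nonneg κ, mul_nonneg hs (abs_nonneg κ), sq_nonneg (s * |κ|),
      mul_nonneg (mul_nonneg hs hs) (abs_nonneg κ), mul_nonneg hs (sq_nonneg |κ|)]
  -- For `κ = 0` the hyperbola degenerates to a pair of rays, and the square root is `|s|`, smooth
  -- only on one side of `0`.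
  rcases eq_or_ne κ 0 with rfl | hκ
  · have e : ∀ s : ℝ, 0 ≤ s → (Real.sqrt (0 ^ 2 + s ^ 2) : ℂ) * Complex.I = s * Complex.I := by
      intro s hs
      simp [Real.sqrt_sq hs]
    have h0 := isTameCurve_affine 0 Complex.I
    simp only [zero_add] at h0
    refine ⟨fun _ => Complex.I, h0.cont.congr fun s hs => e s hs, h0.cont_deriv, ?_,
      h0.differentiableAt, hgrowth, h0.speed⟩
    intro s hs
    refine (h0.hasDerivAt s hs).congr_of_eventuallyEq ?_
    filter_upwards [eventually_gt_nhds hs] with r hr using e r hr.le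
  · have hpos : ∀ s : ℝ, 0 < κ ^ 2 + s ^ 2 := fun s => by positivity
    have hd : ∀ s : ℝ, HasDerivAt (fun s => Real.sqrt (κ ^ 2 + s ^ 2))
        (s / Real.sqrt (κ ^ 2 + s ^ 2)) s := by
      intro s
      have h1 : HasDerivAt (fun s : ℝ => κ ^ 2 + s ^ 2) (2 * s) s := by
        simpa using (hasDerivAt_pow 2 s).const_add (κ ^ 2)
      refine (h1.sqrt (hpos s).ne').congr_deriv ?_
      have := Real.sqrt_pos.2 (hpos s)
      field_simp
    have hd' : Differentiable ℝ (fun s : ℝ => s / Real.sqrt (κ ^ 2 + s ^ 2)) := fun s =>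
      differentiableAt_id.div (hd s).differentiableAt (Real.sqrt_pos.2 (hpos s)).ne'
    have hdC : Differentiable ℝ
        (fun s : ℝ => ((s / Real.sqrt (κ ^ 2 + s ^ 2) : ℝ) : ℂ) * Complex.I) :=
      (Complex.ofRealCLM.differentiable.comp hd').mul_const _
    refine ⟨fun s => ((s / Real.sqrt (κ ^ 2 + s ^ 2) : ℝ) : ℂ) * Complex.I, ?_,
      hdC.continuous.continuousOn, fun s _ => (hd s).ofReal_comp.mul_const _,
      fun s _ => hdC s, hgrowth, ⟨1, fun s hs => ?_⟩⟩
    · fun_prop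
    · rw [norm_mul, Complex.norm_real, Complex.norm_I, mul_one, Real.norm_of_nonneg (by positivity),
        div_le_one (Real.sqrt_pos.2 (hpos s))]
      exact Real.le_sqrt_of_sq_le (by nlinarith [sq_nonneg κ])

theorem isTameCurve_negAxis : ∃ γ', IsTameCurve negAxis γ' := by
  refine ⟨fun _ => -1, ?_⟩
  convert isTameCurve_affine 0 (-1) using 2
  simp [negAxis]

theorem isTameCurve_posAxis : ∃ γ', IsTameCurve (fun s => (s : ℂ)) γ' := by
  refine ⟨fun _ => 1, ?_⟩
  convert isTameCurve_affine 0 1 using 2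
  simp

theorem isTameCurve_imAxis (κ : ℝ) : ∃ γ', IsTameCurve (imAxis κ) γ' := by
  refine ⟨fun _ => Complex.I, ?_⟩
  convert isTameCurve_affine (|κ| * Complex.I) Complex.I using 2
  simp [imAxis, add_mul]

theorem isTameCurve_leftRay (κ : ℝ) : ∃ γ', IsTameCurve (leftRay κ) γ' := by
  refine ⟨fun _ => -1 + Complex.I, ?_⟩
  convert isTameCurve_affine (|κ| * Complex.I) (-1 + Complex.I) using 2
  simp [leftRay]
  ring

theorem isTameCurve_rightRay : ∃ γ', IsTameCurve rightRay γ' := by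
  refine ⟨fun _ => 1 + Complex.I, ?_⟩
  convert isTameCurve_affine 0 (1 + Complex.I) using 2
  simp [rightRay]
  ring

theorem isTameCurve_leftHyperbola (κ : ℝ) : ∃ γ', IsTameCurve (leftHyperbola κ) γ' := by
  obtain ⟨γ', h⟩ := isTameCurve_sqrt κ
  refine ⟨fun s => -1 + γ' s, ?_⟩
  convert (isTameCurve_affine 0 (-1)).add h using 2
  simp [leftHyperbola]

theorem isTameCurve_rightHyperbola (κ : ℝ) : ∃ γ', IsTameCurve (rightHyperbola κ) γ' := by
  obtain ⟨γ', h⟩ := isTameCurve_sqrt κ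
  refine ⟨fun s => 1 + γ' s, ?_⟩
  convert (isTameCurve_affine 0 1).add h using 2
  simp [rightHyperbola]

/-! ### Deformation of the boundary contour -/

theorem injOn_of_re_or_im {γ : ℝ → ℂ} (h : ∀ s, 0 ≤ s → (γ s).re = s ∨ (γ s).re = -s) :
    InjOn γ (Ici 0) := by
  intro s hs s' hs' e
  have h1 := h s hs
  have h2 := h s' hs'
  rw [e] at h1
  simp only [mem_Ici] at hs hs'
  rcases h1 with h1 | h1 <;> rcases h2 with h2 | h2 <;> linarith

/-- The part of the closed upper half plane where `exp (i (κ² + l²)² t)` is bounded for `t ≥ 0`. -/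
def boundedRegion (κ : ℝ) : Set ℂ :=
  {l | 0 ≤ l.im ∧ 0 ≤ l.re * (κ ^ 2 + l.re ^ 2 - l.im ^ 2)}

def leftQuadrant : Set ℂ := {l | l.re ≤ 0 ∧ 0 ≤ l.im}

def rightQuadrant : Set ℂ := {l | 0 ≤ l.re ∧ 0 ≤ l.im}

/-- Integrability and decay of the integrand, and differentiability inside a region. -/
structure IsDecaying (y : ℝ) (S : Set ℂ) (F : ℂ → ℂ) : Prop where
  cont : ContinuousOn F S
  bound : ∃ C, ∀ l ∈ S, ‖F l‖ ≤ C * Real.exp (-y * l.im) / (1 + ‖l‖)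
  diff : ∀ l ∈ S, l.re ≠ 0 → 0 < l.im → DifferentiableAt ℂ F l

theorem IsDecaying.exists_hasCurveIntegral {y : ℝ} {S : Set ℂ} {F : ℂ → ℂ}
    (h : IsDecaying y S F) (hy : 0 < y) {γ : ℝ → ℂ} (hγ : ∃ γ', IsTameCurve γ γ')
    (hmem : ∀ s, 0 ≤ s → γ s ∈ S) (him : ∀ s, 0 ≤ s → s ≤ (γ s).im) :
    ∃ I, HasCurveIntegral γ F I := by
  obtain ⟨γ', hγ⟩ := hγ
  obtain ⟨C, hC⟩ := h.bound
  exact hγ.exists_hasCurveIntegral h.cont hmem hy hC him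

theorem IsDecaying.hasCurveIntegral_of_homotopy {y : ℝ} {S : Set ℂ} {F : ℂ → ℂ}
    (h : IsDecaying y S F) (hy : 0 < y) {a b : ℝ → ℂ} (ha : ∃ a', IsTameCurve a a')
    (hb : ∃ b', IsTameCurve b b')
    (hmem : ∀ s, 0 ≤ s → ∀ θ : ℝ, θ ∈ Icc (0 : ℝ) 1 → a s + θ * (b s - a s) ∈ S)
    (hre : ∀ s, 0 < s → ∀ θ : ℝ, θ ∈ Ioo (0 : ℝ) 1 → (a s + θ * (b s - a s)).re ≠ 0)
    (him : ∀ s, 0 ≤ s → ∀ θ : ℝ, θ ∈ Icc (0 : ℝ) 1 → θ * s ≤ (a s + θ * (b s - a s)).im)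
    (hnorm : ∀ s, 0 ≤ s → ∀ θ : ℝ, θ ∈ Icc (0 : ℝ) 1 →
      s ≤ |(a s + θ * (b s - a s)).re| ∨ s ≤ (a s + θ * (b s - a s)).im)
    {I : ℂ} (hI : HasCurveIntegral b F I) :
    HasCurveIntegral a F
      (I + ∫ θ in (0 : ℝ)..1, F (a 0 + θ * (b 0 - a 0)) * (b 0 - a 0)) := by
  obtain ⟨a', ha⟩ := ha
  obtain ⟨b', hb⟩ := hb
  obtain ⟨C, hC⟩ := h.bound
  refine HasCurveIntegral.of_homotopy ha hb h.cont hy hC hmem ?_ him ?_ hI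
  · intro s hs θ hθ
    have hθ' := Ioo_subset_Icc_self hθ
    refine h.diff _ (hmem s hs.le θ hθ') (hre s hs θ hθ) ?_
    exact (mul_pos hθ.1 hs).trans_le (him s hs.le θ hθ')
  · intro s hs θ hθ
    rcases hnorm s hs θ hθ with h1 | h1
    · exact h1.trans (Complex.abs_re_le_norm _)
    · exact h1.trans ((le_abs_self _).trans (Complex.abs_im_le_norm _))

theorem integral_segment_eq (κ : ℝ) (F : ℂ → ℂ) :
    ∫ θ in (0 : ℝ)..1, F (0 + θ * (|κ| * Complex.I - 0)) * (|κ| * Complex.I - 0) =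
      ∫ s in (0 : ℝ)..|κ|, F (s * Complex.I) * Complex.I := by
  have := intervalIntegral.smul_integral_comp_mul_right (a := 0) (b := 1)
    (fun s : ℝ => F (s * Complex.I) * Complex.I) |κ|
  rw [zero_mul, one_mul] at this
  rw [← this, ← intervalIntegral.integral_smul]
  congr 1
  ext θ
  simp only [zero_add, sub_zero, Complex.ofReal_mul, Complex.real_smul, mul_assoc]
  ring

/-- Prepends the segment from `0` to `i|κ|` to the half line above it. The asymptotic contour comes
down to `0`, the boundary of `D_κ⁺` on the right only to `i|κ|`. -/
theorem hasCurveIntegral_imAxis_zero {y : ℝ} {S : Set ℂ} {F : ℂ → ℂ} (h : IsDecaying y S F)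
    (hmem : ∀ s : ℝ, 0 ≤ s → s * Complex.I ∈ S) {κ : ℝ} {I : ℂ}
    (hI : HasCurveIntegral (imAxis κ) F I) :
    HasCurveIntegral (imAxis 0) F ((∫ s in (0 : ℝ)..|κ|, F (s * Complex.I) * Complex.I) + I) := by
  have hd : ∀ κ s : ℝ, deriv (imAxis κ) s = Complex.I := by
    intro κ s
    have : HasDerivAt (imAxis κ) (((1 : ℝ) : ℂ) * Complex.I) s :=
      ((hasDerivAt_id s).const_add |κ|).ofReal_comp.mul_const _
    rw [this.deriv]
    simp
  have hm0 : ∀ s, 0 ≤ s → imAxis 0 s ∈ S := fun s hs => by simpa [imAxis] using hmem s hs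
  obtain ⟨γ', hγ⟩ := isTameCurve_imAxis 0
  have hInt : ∀ R, 0 ≤ R →
      IntervalIntegrable (fun s : ℝ => F (s * Complex.I) * Complex.I) volume 0 R := fun R hR => by
    simpa [imAxis, hd] using hγ.intervalIntegrable h.cont hm0 hR
  refine ⟨fun R hR => hγ.intervalIntegrable h.cont hm0 hR, ?_⟩
  have h1 := hI.2.const_add (∫ s in (0 : ℝ)..|κ|, F (s * Complex.I) * Complex.I)
  have h2 := h1.comp (tendsto_atTop_add_const_right atTop (-|κ|) tendsto_id)
  refine h2.congr' ?_
  filter_upwards [eventually_ge_atTop |κ|] with R hR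
  simp only [Function.comp, hd, imAxis, id, abs_zero, zero_add]
  rw [intervalIntegral.integral_comp_add_left (fun s : ℝ => F (s * Complex.I) * Complex.I) |κ|]
  rw [add_zero, show |κ| + (R + -|κ|) = R by ring, intervalIntegral.integral_add_adjacent_intervals
    (hInt _ (abs_nonneg κ)) ((hInt _ (abs_nonneg κ)).symm.trans (hInt R ((abs_nonneg κ).trans hR)))]

/-- The endpoint `i|κ|` is left out of the comparison: there `ν = l`, and the quotients in `G` take
the default value of division by zero. -/
theorem HasSegmentIntegral.of_eq_off {κ : ℝ} {S : Set ℂ} {F f : ℂ → ℂ} (hF : ContinuousOn F S)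
    (hmem : ∀ s : ℝ, 0 ≤ s → s * Complex.I ∈ S)
    (hf : ∀ s : ℝ, 0 ≤ s → s < |κ| → f (s * Complex.I) = F (s * Complex.I)) :
    HasSegmentIntegral κ f (∫ s in (0 : ℝ)..|κ|, F (s * Complex.I) * Complex.I) := by
  have hInt : IntervalIntegrable (fun s : ℝ => F (s * Complex.I) * Complex.I) volume 0 |κ| := by
    apply ContinuousOn.intervalIntegrable
    rw [uIcc_of_le (abs_nonneg κ)]
    exact (hF.comp (by fun_prop) fun s hs => hmem s hs.1).mul continuousOn_const
  have hae : (fun s : ℝ => F (s * Complex.I) * Complex.I) =ᵐ[volume.restrict (uIoc 0 |κ|)]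
      fun s => f (s * Complex.I) * Complex.I := by
    rw [uIoc_of_le (abs_nonneg κ)]
    rw [← restrict_Ioo_eq_restrict_Ioc]
    filter_upwards [ae_restrict_mem measurableSet_Ioo] with s hs
    rw [hf s hs.1.le hs.2]
  exact ⟨hInt.congr_ae hae, intervalIntegral.integral_congr_ae_restrict hae⟩

theorem sqrt_bounds (κ : ℝ) {s : ℝ} (hs : 0 ≤ s) :
    |κ| ≤ Real.sqrt (κ ^ 2 + s ^ 2) ∧ s ≤ Real.sqrt (κ ^ 2 + s ^ 2) ∧
      Real.sqrt (κ ^ 2 + s ^ 2) ≤ |κ| + s ∧ Real.sqrt (κ ^ 2 + s ^ 2) ^ 2 = κ ^ 2 + s ^ 2 := by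
  refine ⟨Real.le_sqrt_of_sq_le ?_, Real.le_sqrt_of_sq_le ?_, Real.sqrt_le_iff.2 ⟨?_, ?_⟩,
    Real.sq_sqrt (by positivity)⟩
  · nlinarith [sq_abs κ]
  · nlinarith [sq_nonneg κ]
  · positivity
  · nlinarith [sq_abs κ, abs_nonneg κ, mul_nonneg (abs_nonneg κ) hs]

/-- Here `F` stands for `E W`, `FL` and `FR` for the reflected term with the left and right branch
of `ν`, and `f` for `E G`. The part of `∂D⁺` in the left quadrant carries `F - FL`, the part in the
right quadrant, including the descent along the imaginary axis, carries `F - FR`. The contributions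
of `FL` and of `FR` cancel around their components, and those of `F` add up to the real line. The
negative axis belongs to the contour itself, so the integral `J` of `F` over it has to be supplied;
the positive axis is reached by deformation. Agreement of `f` with `F - FL` is required only near
the curves, not throughout the quadrant where `FL` is deformed. -/
theorem contour_integrals {κ y : ℝ} (hy : 0 < y) {F FL FR f : ℂ → ℂ}
    (hF : IsDecaying y (boundedRegion κ) F) (hL : IsDecaying y leftQuadrant FL)
    (hR : IsDecaying y rightQuadrant FR)
    (hfL : ∀ l ∈ leftQuadrant, l.im ^ 2 - l.re ^ 2 - 2 * κ ^ 2 ≤ -2 * (l.re * l.im) →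
      l ≠ |κ| * Complex.I → f l = F l - FL l)
    (hfR : ∀ l ∈ rightQuadrant, l ≠ |κ| * Complex.I → f l = F l - FR l)
    {J : ℂ} (hJ : HasCurveIntegral negAxis F J) :
    ∃ I, HasCurveIntegral (fun s => (s : ℂ)) F I ∧ HasBoundaryIntegral κ f (-J + I) ∧
      HasAsymptoticBoundaryIntegral κ f (-J + I) := by
  have tN := isTameCurve_negAxis
  have tP := isTameCurve_posAxis
  have tI := isTameCurve_imAxis κ
  have tLH := isTameCurve_leftHyperbola κ
  have tRH := isTameCurve_rightHyperbola κ
  have tLR := isTameCurve_leftRay κ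
  have tRR := isTameCurve_rightRay
  have hκ := abs_nonneg κ
  have hκ2 := sq_abs κ
  have segF : ∀ s : ℝ, 0 ≤ s → (s * Complex.I : ℂ) ∈ boundedRegion κ := fun s hs => by
    simp [boundedRegion, hs]
  have segL : ∀ s : ℝ, 0 ≤ s → (s * Complex.I : ℂ) ∈ leftQuadrant := fun s hs => by
    simp [leftQuadrant, hs]
  have segR : ∀ s : ℝ, 0 ≤ s → (s * Complex.I : ℂ) ∈ rightQuadrant := fun s hs => by
    simp [rightQuadrant, hs]
  have zN : negAxis 0 = 0 := by simp [negAxis]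
  have zLH : leftHyperbola κ 0 = |κ| * Complex.I := by
    simp [leftHyperbola, Real.sqrt_sq_eq_abs]
  have zRH : rightHyperbola κ 0 = |κ| * Complex.I := by
    simp [rightHyperbola, Real.sqrt_sq_eq_abs]
  have zI : imAxis κ 0 = |κ| * Complex.I := by simp [imAxis]
  have zLR : leftRay κ 0 = |κ| * Complex.I := by simp [leftRay]
  have zRR : rightRay 0 = 0 := by simp [rightRay]
  -- absolutely convergent pieces
  obtain ⟨F3, hF3⟩ := hF.exists_hasCurveIntegral hy tLH
    (fun s hs => by
      obtain ⟨h1, h2, h3, h4⟩ := sqrt_bounds κ hs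
      simp [boundedRegion, leftHyperbola, h4])
    (fun s hs => by simpa [leftHyperbola] using (sqrt_bounds κ hs).2.1)
  obtain ⟨L3, hL3⟩ := hL.exists_hasCurveIntegral hy tLH
    (fun s hs => by simp [leftQuadrant, leftHyperbola, hs])
    (fun s hs => by simpa [leftHyperbola] using (sqrt_bounds κ hs).2.1)
  obtain ⟨F5, hF5⟩ := hF.exists_hasCurveIntegral hy tRH
    (fun s hs => by
      obtain ⟨h1, h2, h3, h4⟩ := sqrt_bounds κ hs
      simp [boundedRegion, rightHyperbola, h4])
    (fun s hs => by simpa [rightHyperbola] using (sqrt_bounds κ hs).2.1)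
  obtain ⟨R5, hR5⟩ := hR.exists_hasCurveIntegral hy tRH
    (fun s hs => by simp [rightQuadrant, rightHyperbola, hs])
    (fun s hs => by simpa [rightHyperbola] using (sqrt_bounds κ hs).2.1)
  obtain ⟨F6, hF6⟩ := hF.exists_hasCurveIntegral hy tLR
    (fun s hs => by
      simp only [boundedRegion, leftRay, mem_ofPred_eq]
      simp
      exact ⟨by positivity, by nlinarith [mul_nonneg hs (mul_nonneg hκ hs)]⟩)
    (fun s hs => by simp [leftRay])
  obtain ⟨L6, hL6⟩ := hL.exists_hasCurveIntegral hy tLR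
    (fun s hs => by simp [leftQuadrant, leftRay, hs]; positivity)
    (fun s hs => by simp [leftRay])
  -- the homotopies
  have hL1 := hL.hasCurveIntegral_of_homotopy hy tN tLH
    (fun s hs θ hθ => by
      simp [leftQuadrant, negAxis, leftHyperbola, hs]
      exact mul_nonneg hθ.1 (Real.sqrt_nonneg _))
    (fun s hs θ hθ => by simp [negAxis, leftHyperbola]; exact hs.ne')
    (fun s hs θ hθ => by
      simp [negAxis, leftHyperbola]
      exact mul_le_mul_of_nonneg_left (sqrt_bounds κ hs).2.1 hθ.1)
    (fun s hs θ hθ => by left; simp [negAxis, leftHyperbola, le_abs_self]) hL3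
  -- The region between the positive axis and the right hyperbola lies in `boundedRegion κ`. The
  -- curves start at `0` and at `i|κ|`, so the first rung is the segment joining these points.
  have hFP := hF.hasCurveIntegral_of_homotopy hy tP tRH
    (fun s hs θ hθ => by
      obtain ⟨h1, h2, h3, h4⟩ := sqrt_bounds κ hs
      simp [boundedRegion, rightHyperbola]
      refine ⟨mul_nonneg hθ.1 (Real.sqrt_nonneg _), mul_nonneg hs ?_⟩
      rw [mul_pow, h4]
      nlinarith [hθ.1, hθ.2, sq_nonneg κ, sq_nonneg s, mul_nonneg hθ.1 (sub_nonneg.2 hθ.2)])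
    (fun s hs θ hθ => by simp [rightHyperbola]; exact hs.ne')
    (fun s hs θ hθ => by
      simp [rightHyperbola]
      exact mul_le_mul_of_nonneg_left (sqrt_bounds κ hs).2.1 hθ.1)
    (fun s hs θ hθ => by left; simp [rightHyperbola, le_abs_self]) hF5
  -- The boundary of the right component: both curves start at `i|κ|`, so the integrals of `FR`
  -- agree.
  have hR4 := hR.hasCurveIntegral_of_homotopy hy tI tRH
    (fun s hs θ hθ => by
      obtain ⟨h1, h2, h3, h4⟩ := sqrt_bounds κ hs
      simp [rightQuadrant, imAxis, rightHyperbola]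
      exact ⟨mul_nonneg hθ.1 hs, by nlinarith [hθ.1, hθ.2]⟩)
    (fun s hs θ hθ => by simp [imAxis, rightHyperbola]; exact ⟨hθ.1.ne', hs.ne'⟩)
    (fun s hs θ hθ => by
      obtain ⟨h1, h2, h3, h4⟩ := sqrt_bounds κ hs
      simp [imAxis, rightHyperbola]
      nlinarith [hθ.1, hθ.2])
    (fun s hs θ hθ => by
      obtain ⟨h1, h2, h3, h4⟩ := sqrt_bounds κ hs
      right
      simp [imAxis, rightHyperbola]
      nlinarith [hθ.1, hθ.2]) hR5
  -- To the left of the imaginary axis and above the hyperbola one is again in `boundedRegion κ`.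
  -- Hence the outward left hyperbola and the descending imaginary axis cancel for `F`.
  have hF4 := hF.hasCurveIntegral_of_homotopy hy tI tLH
    (fun s hs θ hθ => by
      obtain ⟨h1, h2, h3, h4⟩ := sqrt_bounds κ hs
      simp [boundedRegion, imAxis, leftHyperbola]
      set h := Real.sqrt (κ ^ 2 + s ^ 2)
      refine ⟨by nlinarith [hθ.1, hθ.2], mul_nonpos_of_nonneg_of_nonpos ?_ ?_⟩
      · exact mul_nonneg hθ.1 hs
      · have h5 : h ≤ |κ| + s + θ * (h - (|κ| + s)) := by nlinarith [hθ.1, hθ.2]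
        have h6 : 0 ≤ h := Real.sqrt_nonneg _
        have h7 : θ ^ 2 * s ^ 2 ≤ s ^ 2 := by
          have : θ ^ 2 ≤ 1 := by nlinarith [hθ.1, hθ.2]
          nlinarith [sq_nonneg s]
        nlinarith [mul_self_le_mul_self h6 h5])
    (fun s hs θ hθ => by simp [imAxis, leftHyperbola]; exact ⟨hθ.1.ne', hs.ne'⟩)
    (fun s hs θ hθ => by
      obtain ⟨h1, h2, h3, h4⟩ := sqrt_bounds κ hs
      simp [imAxis, leftHyperbola]
      nlinarith [hθ.1, hθ.2])
    (fun s hs θ hθ => by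
      obtain ⟨h1, h2, h3, h4⟩ := sqrt_bounds κ hs
      right
      simp [imAxis, leftHyperbola]
      nlinarith [hθ.1, hθ.2]) hF3
  have imLR : ∀ s, 0 ≤ s → ∀ θ : ℝ, θ ∈ Icc (0 : ℝ) 1 →
      s ≤ Real.sqrt (κ ^ 2 + s ^ 2) + θ * (|κ| + s - Real.sqrt (κ ^ 2 + s ^ 2)) := by
    intro s hs θ hθ
    obtain ⟨h1, h2, h3, h4⟩ := sqrt_bounds κ hs
    nlinarith [hθ.1, hθ.2]
  -- The left ray starts at `i|κ|` and runs above the hyperbola, since `|κ| + s ≥ √(κ²+s²)`; the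
  -- strip between them stays in `boundedRegion κ`.
  have hF3' := hF.hasCurveIntegral_of_homotopy hy tLH tLR
    (fun s hs θ hθ => by
      obtain ⟨h1, h2, h3, h4⟩ := sqrt_bounds κ hs
      simp [boundedRegion, leftRay, leftHyperbola]
      refine ⟨hs.trans (imLR s hs θ hθ), ?_⟩
      set h := Real.sqrt (κ ^ 2 + s ^ 2)
      have h5 : h ≤ h + θ * (|κ| + s - h) := by nlinarith [hθ.1, hθ.2]
      have h6 : 0 ≤ h := Real.sqrt_nonneg _
      nlinarith [mul_self_le_mul_self h6 h5])
    (fun s hs θ hθ => by simp [leftRay, leftHyperbola]; exact hs.ne')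
    (fun s hs θ hθ => by
      simp [leftRay, leftHyperbola]
      exact le_trans (by nlinarith [hθ.2]) (imLR s hs θ hθ))
    (fun s hs θ hθ => by left; simp [leftRay, leftHyperbola, le_abs_self]) hF6
  have hL3' := hL.hasCurveIntegral_of_homotopy hy tLH tLR
    (fun s hs θ hθ => by
      simp [leftQuadrant, leftRay, leftHyperbola, hs]
      exact hs.trans (imLR s hs θ hθ))
    (fun s hs θ hθ => by simp [leftRay, leftHyperbola]; exact hs.ne')
    (fun s hs θ hθ => by
      simp [leftRay, leftHyperbola]
      exact le_trans (by nlinarith [hθ.2]) (imLR s hs θ hθ))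
    (fun s hs θ hθ => by left; simp [leftRay, leftHyperbola, le_abs_self]) hL6
  have imRR : ∀ s, 0 ≤ s → ∀ θ : ℝ, θ ∈ Icc (0 : ℝ) 1 →
      s ≤ s + θ * (Real.sqrt (κ ^ 2 + s ^ 2) - s) := by
    intro s hs θ hθ
    obtain ⟨h1, h2, h3, h4⟩ := sqrt_bounds κ hs
    nlinarith [hθ.1, hθ.2]
  have hF7 := hF.hasCurveIntegral_of_homotopy hy tRR tRH
    (fun s hs θ hθ => by
      obtain ⟨h1, h2, h3, h4⟩ := sqrt_bounds κ hs
      simp [boundedRegion, rightRay, rightHyperbola]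
      refine ⟨hs.trans (imRR s hs θ hθ), mul_nonneg hs ?_⟩
      have h5 : s + θ * (Real.sqrt (κ ^ 2 + s ^ 2) - s) ≤ Real.sqrt (κ ^ 2 + s ^ 2) := by
        nlinarith [hθ.1, hθ.2]
      nlinarith [mul_self_le_mul_self (hs.trans (imRR s hs θ hθ)) h5])
    (fun s hs θ hθ => by simp [rightRay, rightHyperbola]; exact hs.ne')
    (fun s hs θ hθ => by
      simp [rightRay, rightHyperbola]
      exact le_trans (by nlinarith [hθ.2]) (imRR s hs θ hθ))
    (fun s hs θ hθ => by left; simp [rightRay, rightHyperbola, le_abs_self]) hF5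
  have hR7 := hR.hasCurveIntegral_of_homotopy hy tRR tRH
    (fun s hs θ hθ => by
      simp [rightQuadrant, rightRay, rightHyperbola, hs]
      exact hs.trans (imRR s hs θ hθ))
    (fun s hs θ hθ => by simp [rightRay, rightHyperbola]; exact hs.ne')
    (fun s hs θ hθ => by
      simp [rightRay, rightHyperbola]
      exact le_trans (by nlinarith [hθ.2]) (imRR s hs θ hθ))
    (fun s hs θ hθ => by left; simp [rightRay, rightHyperbola, le_abs_self]) hR5
  -- The initial rungs are now evaluated: zero for curves with a common starting point, the integral
  -- over `[0, i|κ|]` otherwise.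
  simp only [Complex.ofReal_zero, zN, zLH, zRH, zI, zLR, zRR, integral_segment_eq, sub_self,
    mul_zero, intervalIntegral.integral_zero, add_zero] at hL1 hFP hR4 hF4 hF3' hL3' hF7 hR7
  have eF := hF3.unique hF3'
  have eL := hL3.unique hL3'
  have hF8 := hasCurveIntegral_imAxis_zero hF segF hF4
  have hR8 := hasCurveIntegral_imAxis_zero hR segR hR4
  -- the integrals of `f`
  have i1 := (hJ.sub hL1).congr_off (F₂ := f) (p := |κ| * Complex.I)
    (injOn_of_re_or_im fun s _ => by right; simp [negAxis])
    (fun s hs hp => (hfL _ (by simp [leftQuadrant, negAxis, hs])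
      (by simp [negAxis]; nlinarith [sq_nonneg s, sq_nonneg κ]) hp).symm)
  have i3 := (hF3.sub hL3).congr_off (F₂ := f) (p := |κ| * Complex.I)
    (injOn_of_re_or_im fun s _ => by right; simp [leftHyperbola])
    (fun s hs hp => (hfL _ (by simp [leftQuadrant, leftHyperbola, hs])
      (by
        obtain ⟨h1, h2, h3, h4⟩ := sqrt_bounds κ hs
        simp [leftHyperbola]
        nlinarith [sq_nonneg s, sq_nonneg κ, mul_nonneg hs (hs.trans h2)]) hp).symm)
  have i3' := (hF6.sub hL6).congr_off (F₂ := f) (p := |κ| * Complex.I)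
    (injOn_of_re_or_im fun s _ => by right; simp [leftRay])
    (fun s hs hp => (hfL _ (by simp [leftQuadrant, leftRay, hs]; positivity)
      (by
        simp [leftRay]
        nlinarith [sq_nonneg s, sq_nonneg κ]) hp).symm)
  have injI : ∀ κ, InjOn (imAxis κ) (Ici 0) := fun κ s _ s' _ e => by
    simpa [imAxis] using congrArg Complex.im e
  have i4 := (hF4.sub hR4).congr_off (F₂ := f) (p := |κ| * Complex.I) (injI κ)
    (fun s hs hp => (hfR _ (by simp [rightQuadrant, imAxis]; positivity) hp).symm)
  have i4' := (hF8.sub hR8).congr_off (F₂ := f) (p := |κ| * Complex.I) (injI 0)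
    (fun s hs hp => (hfR _ (by simp [rightQuadrant, imAxis, hs]) hp).symm)
  have i5 := (hF5.sub hR5).congr_off (F₂ := f) (p := |κ| * Complex.I)
    (injOn_of_re_or_im fun s _ => by left; simp [rightHyperbola])
    (fun s hs hp => (hfR _ (by simp [rightQuadrant, rightHyperbola, hs]) hp).symm)
  have i5' := (hF7.sub hR7).congr_off (F₂ := f) (p := |κ| * Complex.I)
    (injOn_of_re_or_im fun s _ => by left; simp [rightRay])
    (fun s hs hp => (hfR _ (by simp [rightQuadrant, rightRay, hs]) hp).symm)
  have cF : ContinuousOn F {l | l.re = 0 ∧ 0 ≤ l.im} :=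
    hF.cont.mono fun l hl => by simp [boundedRegion, hl.1, hl.2]
  have cL : ContinuousOn FL {l | l.re = 0 ∧ 0 ≤ l.im} :=
    hL.cont.mono fun l hl => by simp [leftQuadrant, hl.1, hl.2]
  have segM : ∀ s : ℝ, 0 ≤ s → (s * Complex.I : ℂ) ∈ {l : ℂ | l.re = 0 ∧ 0 ≤ l.im} :=
    fun s hs => by simp [hs]
  have i2 : HasSegmentIntegral κ f _ := HasSegmentIntegral.of_eq_off (cF.sub cL) segM
    (fun s hs hs' => hfL _ (segL s hs)
      (by simp; nlinarith [mul_self_le_mul_self hs hs'.le])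
      (fun e => by
        have := congrArg Complex.im e
        simp at this
        exact hs'.ne this))
  have hseg : ∀ {g : ℂ → ℂ}, ContinuousOn g {l : ℂ | l.re = 0 ∧ 0 ≤ l.im} →
      IntervalIntegrable (fun s : ℝ => g (s * Complex.I) * Complex.I) volume 0 |κ| := by
    intro g hg
    apply ContinuousOn.intervalIntegrable
    rw [uIcc_of_le hκ]
    exact (hg.comp (by fun_prop) fun s hs => segM s hs.1).mul continuousOn_const
  have e2 : (∫ s in (0 : ℝ)..|κ|, (F - FL) (s * Complex.I) * Complex.I) =
      (∫ s in (0 : ℝ)..|κ|, F (s * Complex.I) * Complex.I) -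
        ∫ s in (0 : ℝ)..|κ|, FL (s * Complex.I) * Complex.I := by
    rw [← intervalIntegral.integral_sub (hseg cF) (hseg cL)]
    simp only [Pi.sub_apply, sub_mul]
  -- In both sums everything cancels except `-J`, the segment integral of `F` and its integral over
  -- the right hyperbola; the last two form the positive-axis integral.
  refine ⟨_, hFP, ⟨_, _, _, _, _, i1, i2, i3, i4, i5, ?_⟩, ⟨_, _, _, _, _, i1, i2, i3', i4', i5', ?_⟩⟩
  · erw [e2]
    ring
  · erw [e2]
    rw [eF, eL]
    ring

/-! ### The branch of the square root -/

theorem toIcoMod_arg_eq {ε r θ : ℝ} (hr : 0 < r) (h1 : ε ≤ θ) (h2 : θ < 2 * Real.pi + ε) :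
    toIcoMod Real.two_pi_pos ε
      (Complex.arg (r * (Complex.cos θ + Complex.sin θ * Complex.I))) = θ := by
  rw [Complex.arg_mul_cos_add_sin_mul_I_eq_toIocMod hr]
  rw [← self_sub_toIocDiv_zsmul, toIcoMod_sub_zsmul, toIcoMod_eq_self]
  exact ⟨h1, by linarith⟩

/-- `sqrtStar` inverts squaring on the part of the upper half plane that is used below. -/
theorem sqrtStar_sq {ε : ℝ} (hε : 0 < ε) (hε' : ε < Real.pi / 4) {v : ℂ} (him : 0 ≤ v.im)
    (h : v.re ≤ 0 ∨ (v ^ 2).re ≤ (v ^ 2).im) : sqrtStar ε (v ^ 2) = v := by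
  rcases eq_or_ne v 0 with rfl | hv
  · simp [sqrtStar]
  have hr : 0 < ‖v‖ := norm_pos_iff.2 hv
  have hα0 : 0 ≤ v.arg := Complex.arg_nonneg_iff.2 him
  have hα1 : v.arg ≤ Real.pi := Complex.arg_le_pi v
  have hpi := Real.pi_pos
  have hvexp : v = ‖v‖ * Complex.exp (v.arg * Complex.I) := (Complex.norm_mul_exp_arg_mul_I v).symm
  have hsq : v ^ 2 = ((‖v‖ ^ 2 : ℝ) : ℂ) *
      (Complex.cos ((2 * v.arg : ℝ) : ℂ) + Complex.sin ((2 * v.arg : ℝ) : ℂ) * Complex.I) := by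
    rw [← Complex.exp_mul_I]
    conv_lhs => rw [hvexp]
    rw [mul_pow, ← Complex.exp_nat_mul]
    push_cast
    ring_nf
  -- The hypothesis rules out the sector `0 ≤ arg v < π/8`: there `Re v > 0`, and `2 arg v < π/4`
  -- makes `cos(2 arg v) > sin(2 arg v)`.
  have hα : Real.pi / 8 ≤ v.arg := by
    by_contra hlt
    push Not at hlt
    rcases h with h | h
    · have h1 : 0 < Real.cos v.arg := Real.cos_pos_of_mem_Ioo ⟨by linarith, by linarith⟩
      have h2 : v.re = ‖v‖ * Real.cos v.arg := (Complex.norm_mul_cos_arg v).symm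
      nlinarith [mul_pos hr h1]
    · rw [hsq, ← Complex.ofReal_cos, ← Complex.ofReal_sin] at h
      rw [Complex.re_ofReal_mul, Complex.im_ofReal_mul] at h
      have h0 : (0 : ℝ) < ‖v‖ ^ 2 := by positivity
      have h1 := le_of_mul_le_mul_left h h0
      simp only [Complex.add_re, Complex.add_im, Complex.re_ofReal_mul, Complex.im_ofReal_mul,
        Complex.ofReal_re, Complex.ofReal_im, Complex.I_re, Complex.I_im, mul_zero, mul_one,
        add_zero, zero_add] at h1
      have h2 : Real.sin (2 * v.arg) < Real.sin (Real.pi / 4) :=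
        Real.sin_lt_sin_of_lt_of_le_pi_div_two (by linarith) (by linarith) (by linarith)
      have h3 : Real.cos (Real.pi / 4) < Real.cos (2 * v.arg) :=
        Real.cos_lt_cos_of_nonneg_of_le_pi (by linarith) (by linarith) (by linarith)
      rw [Real.sin_pi_div_four] at h2
      rw [Real.cos_pi_div_four] at h3
      linarith
  -- Now `2 arg v` lies in `[π/4, 2π]`, which is contained in `[ε, 2π + ε)` because `0 < ε < π/4`.
  have harg : argStar ε (v ^ 2) = 2 * v.arg := by
    rw [argStar, hsq]
    exact toIcoMod_arg_eq (by positivity) (by linarith) (by linarith)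
  rw [sqrtStar, harg, norm_pow, Real.sqrt_sq hr.le]
  conv_rhs => rw [hvexp]
  push_cast
  ring_nf

/-- A branch of `√(-l² - 2κ²)` with values in the closed upper half plane. -/
structure IsRootBranch (κ : ℝ) (S : Set ℂ) (ν : ℂ → ℂ) : Prop where
  sq : ∀ l ∈ S, ν l ^ 2 = -l ^ 2 - 2 * (κ : ℂ) ^ 2
  im_nonneg : ∀ l ∈ S, 0 ≤ (ν l).im
  cont : ContinuousOn ν S
  diff : ∀ l ∈ S, l.re ≠ 0 → 0 < l.im → DifferentiableAt ℂ ν l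

/-- The constant is `e^{iπ/4}`. In the left quadrant `i(l²+2κ²)` has nonnegative real part, so its
principal root has argument in `[-π/4, π/4]` and the rotated root lands in the closed first
quadrant. -/
def leftRoot (κ : ℝ) (l : ℂ) : ℂ :=
  ((Real.sqrt 2)⁻¹ : ℝ) * (1 + Complex.I) *
    (Complex.I * (l ^ 2 + 2 * (κ : ℂ) ^ 2)) ^ (2⁻¹ : ℂ)

/-- The mirror image: the constant is `e^{3πi/4}`, and in the right quadrant the values lie in the
closed second quadrant. -/
def rightRoot (κ : ℝ) (l : ℂ) : ℂ :=
  ((Real.sqrt 2)⁻¹ : ℝ) * (-1 + Complex.I) *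
    (-Complex.I * (l ^ 2 + 2 * (κ : ℂ) ^ 2)) ^ (2⁻¹ : ℂ)

theorem cpow_half_sq (z : ℂ) : (z ^ (2⁻¹ : ℂ)) ^ 2 = z := by
  exact_mod_cast Complex.cpow_nat_inv_pow z two_ne_zero

/-- With `w` the principal root, `Re z = (Re w)² - (Im w)²` and `Re w ≥ 0`. -/
theorem abs_im_cpow_half_le {z : ℂ} (hz : 0 ≤ z.re) :
    |(z ^ (2⁻¹ : ℂ)).im| ≤ (z ^ (2⁻¹ : ℂ)).re := by
  have h1 : 0 ≤ (z ^ (2⁻¹ : ℂ)).re := by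
    rw [Complex.cpow_inv_two_re]
    positivity
  have h2 := congrArg Complex.re (cpow_half_sq z)
  rw [sq, Complex.mul_re] at h2
  exact abs_le_of_sq_le_sq (by nlinarith) h1

theorem inv_sqrt_two_sq : (((Real.sqrt 2)⁻¹ : ℝ) : ℂ) ^ 2 = 2⁻¹ := by
  rw [← Complex.ofReal_pow, inv_pow, Real.sq_sqrt (by norm_num)]
  simp

theorem re_I_mul_nonneg {κ : ℝ} {l : ℂ} (hl : l ∈ leftQuadrant) :
    0 ≤ (Complex.I * (l ^ 2 + 2 * (κ : ℂ) ^ 2)).re := by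
  simp only [leftQuadrant, mem_ofPred_eq] at hl
  simp [pow_two]
  nlinarith [mul_nonneg (neg_nonneg.2 hl.1) hl.2]

theorem re_neg_I_mul_nonneg {κ : ℝ} {l : ℂ} (hl : l ∈ rightQuadrant) :
    0 ≤ (-Complex.I * (l ^ 2 + 2 * (κ : ℂ) ^ 2)).re := by
  simp only [rightQuadrant, mem_ofPred_eq] at hl
  simp [pow_two]
  nlinarith [mul_nonneg hl.1 hl.2]

theorem isRootBranch_leftRoot (κ : ℝ) : IsRootBranch κ leftQuadrant (leftRoot κ) where
  sq l _ := by
    rw [leftRoot, mul_pow, mul_pow, inv_sqrt_two_sq, cpow_half_sq]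
    linear_combination (l ^ 2 + 2 * (κ : ℂ) ^ 2) * (1 + 2⁻¹ * Complex.I) * Complex.I_sq
  im_nonneg l hl := by
    have h := abs_le.1 (abs_im_cpow_half_le (re_I_mul_nonneg (κ := κ) hl))
    rw [leftRoot, mul_assoc, Complex.im_ofReal_mul]
    refine mul_nonneg (by positivity) ?_
    rw [Complex.mul_im, Complex.add_re, Complex.add_im]
    simp only [Complex.one_re, Complex.I_re, Complex.one_im, Complex.I_im]
    linarith
  cont := by
    intro l hl
    -- The closed quadrant contains the branch point `i√2|κ|`, where the base of the power is `0`;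
    -- continuity survives there because the exponent has positive real part.
    have h1 : ContinuousAt (fun z : ℂ => z ^ (2⁻¹ : ℂ)) (Complex.I * (l ^ 2 + 2 * (κ : ℂ) ^ 2)) :=
      Complex.continuousAt_cpow_const_of_re_pos (Or.inl (re_I_mul_nonneg hl)) (by norm_num)
    have h2 : ContinuousAt (fun l : ℂ => Complex.I * (l ^ 2 + 2 * (κ : ℂ) ^ 2)) l := by fun_prop
    exact ((ContinuousAt.comp (x := l) (f := fun l : ℂ => Complex.I * (l ^ 2 + 2 * (κ : ℂ) ^ 2))
      (g := fun z : ℂ => z ^ (2⁻¹ : ℂ)) h1 h2).const_mul _).continuousWithinAt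
  diff l hl h1 h2 := by
    unfold leftRoot
    refine DifferentiableAt.const_mul ?_ _
    refine DifferentiableAt.cpow_const (by fun_prop) (Or.inl ?_)
    have h3 : l.re < 0 := lt_of_le_of_ne hl.1 h1
    simp [pow_two]
    nlinarith [mul_pos (neg_pos.2 h3) h2]

theorem isRootBranch_rightRoot (κ : ℝ) : IsRootBranch κ rightQuadrant (rightRoot κ) where
  sq l _ := by
    rw [rightRoot, mul_pow, mul_pow, inv_sqrt_two_sq, cpow_half_sq]
    linear_combination (l ^ 2 + 2 * (κ : ℂ) ^ 2) * (1 - 2⁻¹ * Complex.I) * Complex.I_sq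
  im_nonneg l hl := by
    have h := abs_le.1 (abs_im_cpow_half_le (re_neg_I_mul_nonneg (κ := κ) hl))
    rw [rightRoot, mul_assoc, Complex.im_ofReal_mul]
    refine mul_nonneg (by positivity) ?_
    rw [Complex.mul_im, Complex.add_re, Complex.add_im]
    simp only [Complex.neg_re, Complex.neg_im, Complex.one_re, Complex.I_re, Complex.one_im,
      Complex.I_im]
    linarith
  cont := by
    intro l hl
    have h1 : ContinuousAt (fun z : ℂ => z ^ (2⁻¹ : ℂ)) (-Complex.I * (l ^ 2 + 2 * (κ : ℂ) ^ 2)) :=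
      Complex.continuousAt_cpow_const_of_re_pos (Or.inl (re_neg_I_mul_nonneg hl)) (by norm_num)
    have h2 : ContinuousAt (fun l : ℂ => -Complex.I * (l ^ 2 + 2 * (κ : ℂ) ^ 2)) l := by fun_prop
    exact ((ContinuousAt.comp (x := l) (f := fun l : ℂ => -Complex.I * (l ^ 2 + 2 * (κ : ℂ) ^ 2))
      (g := fun z : ℂ => z ^ (2⁻¹ : ℂ)) h1 h2).const_mul _).continuousWithinAt
  diff l hl h1 h2 := by
    unfold rightRoot
    refine DifferentiableAt.const_mul ?_ _
    refine DifferentiableAt.cpow_const (by fun_prop) (Or.inl ?_)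
    have h3 : 0 < l.re := lt_of_le_of_ne hl.1 (Ne.symm h1)
    simp [pow_two]
    nlinarith [mul_pos h3 h2]

/-- The inequality says `Re ν² ≤ Im ν²`, as `sqrtStar_sq` requires. It cannot be dropped: on the
imaginary axis above `i√2|κ|` one has `ν² > 0`, and the rotated branch gives the negative root while
`leftRoot` gives the positive one. It holds on all the left-hand pieces of both contours. -/
theorem nu_eq_leftRoot {ε κ : ℝ} (hε : 0 < ε) (hε' : ε < Real.pi / 4) {l : ℂ}
    (hl : l ∈ leftQuadrant) (h : l.im ^ 2 - l.re ^ 2 - 2 * κ ^ 2 ≤ -2 * (l.re * l.im)) :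
    nu ε κ l = leftRoot κ l := by
  have hb := isRootBranch_leftRoot κ
  rw [nu, ← hb.sq l hl]
  refine sqrtStar_sq hε hε' (hb.im_nonneg l hl) (Or.inr ?_)
  rw [hb.sq l hl]
  simp [pow_two]
  nlinarith

/-- No restriction is needed here, since `rightRoot` has nonpositive real part on the whole
quadrant. -/
theorem nu_eq_rightRoot {ε κ : ℝ} (hε : 0 < ε) (hε' : ε < Real.pi / 4) {l : ℂ}
    (hl : l ∈ rightQuadrant) : nu ε κ l = rightRoot κ l := by
  have hb := isRootBranch_rightRoot κ
  rw [nu, ← hb.sq l hl]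
  refine sqrtStar_sq hε hε' (hb.im_nonneg l hl) (Or.inl ?_)
  have h := abs_le.1 (abs_im_cpow_half_le (re_neg_I_mul_nonneg (κ := κ) hl))
  rw [rightRoot, mul_assoc, Complex.re_ofReal_mul]
  refine mul_nonpos_of_nonneg_of_nonpos (by positivity) ?_
  rw [Complex.mul_re, Complex.add_re, Complex.add_im]
  simp only [Complex.neg_re, Complex.neg_im, Complex.one_re, Complex.I_re, Complex.one_im,
    Complex.I_im]
  linarith

/-! ### The half line Fourier transform -/

def halfLineFT (f : ℝ → ℂ) (l : ℂ) : ℂ :=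
  ∫ y in Ioi (0 : ℝ), Complex.exp (-Complex.I * y * l) * f y

/-- The function whose transform is the derivative of the transform of `f`. -/
def momentFun (f : ℝ → ℂ) (y : ℝ) : ℂ := -Complex.I * y * f y

theorem norm_exp_neg_I_mul {y : ℝ} {l : ℂ} :
    ‖Complex.exp (-Complex.I * y * l)‖ = Real.exp (y * l.im) := by
  rw [Complex.norm_exp]
  congr 1
  simp

theorem norm_exp_neg_I_mul_le_one {y : ℝ} (hy : 0 ≤ y) {l : ℂ} (hl : l.im ≤ 0) :
    ‖Complex.exp (-Complex.I * y * l)‖ ≤ 1 := by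
  rw [norm_exp_neg_I_mul]
  exact Real.exp_le_one_iff.2 (mul_nonpos_of_nonneg_of_nonpos hy hl)

theorem aestronglyMeasurable_exp_mul {f : ℝ → ℂ} {μ : Measure ℝ} (h : AEStronglyMeasurable f μ)
    (l : ℂ) : AEStronglyMeasurable (fun y : ℝ => Complex.exp (-Complex.I * y * l) * f y) μ :=
  Continuous.aestronglyMeasurable (by fun_prop) |>.mul h

theorem norm_exp_mul_le {f : ℝ → ℂ} {y : ℝ} (hy : 0 ≤ y) {l : ℂ} (hl : l.im ≤ 0) :
    ‖Complex.exp (-Complex.I * y * l) * f y‖ ≤ ‖f y‖ := by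
  rw [norm_mul]
  exact mul_le_of_le_one_left (norm_nonneg _) (norm_exp_neg_I_mul_le_one hy hl)

theorem integrableOn_exp_mul {f : ℝ → ℂ} (h : IntegrableOn f (Ioi 0)) {l : ℂ} (hl : l.im ≤ 0) :
    IntegrableOn (fun y : ℝ => Complex.exp (-Complex.I * y * l) * f y) (Ioi 0) :=
  h.norm.mono' (aestronglyMeasurable_exp_mul h.aestronglyMeasurable l)
    ((ae_restrict_iff' measurableSet_Ioi).2 (Eventually.of_forall fun _ hy =>
      norm_exp_mul_le (le_of_lt hy) hl))

theorem norm_halfLineFT_le {f : ℝ → ℂ} (h : IntegrableOn f (Ioi 0)) {l : ℂ} (hl : l.im ≤ 0) :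
    ‖halfLineFT f l‖ ≤ ∫ y in Ioi (0 : ℝ), ‖f y‖ :=
  norm_integral_le_of_norm_le h.norm ((ae_restrict_iff' measurableSet_Ioi).2
    (Eventually.of_forall fun _ hy => norm_exp_mul_le (le_of_lt hy) hl))

theorem continuousOn_halfLineFT {f : ℝ → ℂ} (h : IntegrableOn f (Ioi 0)) :
    ContinuousOn (halfLineFT f) {l | l.im ≤ 0} := by
  refine continuousOn_of_dominated (bound := fun y => ‖f y‖)
    (fun l _ => aestronglyMeasurable_exp_mul h.aestronglyMeasurable l) (fun l hl => ?_) h.norm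
    (Eventually.of_forall fun y => by fun_prop)
  exact (ae_restrict_iff' measurableSet_Ioi).2 (Eventually.of_forall fun y hy =>
    norm_exp_mul_le (le_of_lt hy) hl)

theorem IntegrableOn.momentFun {f : ℝ → ℂ} (h : IntegrableOn (fun y : ℝ => (y : ℂ) * f y) (Ioi 0)) :
    IntegrableOn (momentFun f) (Ioi 0) := by
  refine (h.const_mul (-Complex.I)).congr (Eventually.of_forall fun y => ?_)
  simp only [BiharmonicSchrodinger.momentFun]
  ring

theorem differentiableAt_halfLineFT {f : ℝ → ℂ} (h0 : IntegrableOn f (Ioi 0))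
    (h1 : IntegrableOn (fun y : ℝ => (y : ℂ) * f y) (Ioi 0)) {l : ℂ} (hl : l.im < 0) :
    DifferentiableAt ℂ (halfLineFT f) l := by
  have hm := IntegrableOn.momentFun h1
  refine (hasDerivAt_integral_of_dominated_loc_of_deriv_le (𝕜 := ℂ)
    (F := fun l (y : ℝ) => Complex.exp (-Complex.I * y * l) * f y)
    (F' := fun l (y : ℝ) => Complex.exp (-Complex.I * y * l) * momentFun f y)
    (bound := fun y => ‖momentFun f y‖) (s := {l | l.im < 0})
    ((isOpen_lt Complex.continuous_im continuous_const).mem_nhds hl)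
    (Eventually.of_forall fun l => aestronglyMeasurable_exp_mul h0.aestronglyMeasurable l)
    (integrableOn_exp_mul h0 hl.le) (aestronglyMeasurable_exp_mul hm.aestronglyMeasurable l)
    ?_ hm.norm ?_).2.differentiableAt
  · exact (ae_restrict_iff' measurableSet_Ioi).2 (Eventually.of_forall fun y hy l hl =>
      norm_exp_mul_le (le_of_lt hy) (le_of_lt hl))
  · refine Eventually.of_forall fun y l _ => ?_
    have : HasDerivAt (fun l : ℂ => -Complex.I * y * l) (-Complex.I * y) l := by
      simpa using (hasDerivAt_id l).const_mul (-Complex.I * y)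
    refine (this.cexp.mul_const (f y)).congr_deriv ?_
    simp only [momentFun]
    ring

/-- A real derivative along a line which may lie in the boundary `Im l = 0`, where complex
differentiability of the transform is not available. -/
theorem hasDerivAt_halfLineFT_line {f : ℝ → ℂ} (h0 : IntegrableOn f (Ioi 0))
    (h1 : IntegrableOn (fun y : ℝ => (y : ℂ) * f y) (Ioi 0)) {a d : ℂ} {U : Set ℝ} {s : ℝ}
    (hU : U ∈ 𝓝 s) (him : ∀ r ∈ U, (a + r * d).im ≤ 0) :
    HasDerivAt (fun r : ℝ => halfLineFT f (a + r * d))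
      (d * halfLineFT (momentFun f) (a + s * d)) s := by
  have hm := IntegrableOn.momentFun h1
  have key := (hasDerivAt_integral_of_dominated_loc_of_deriv_le (𝕜 := ℝ)
    (F := fun (r : ℝ) (y : ℝ) => Complex.exp (-Complex.I * y * (a + r * d)) * f y)
    (F' := fun (r : ℝ) (y : ℝ) => d * (Complex.exp (-Complex.I * y * (a + r * d)) * momentFun f y))
    (bound := fun y => ‖d‖ * ‖momentFun f y‖) (s := U) hU
    (Eventually.of_forall fun r =>
      aestronglyMeasurable_exp_mul h0.aestronglyMeasurable (a + r * d))
    (integrableOn_exp_mul h0 (him s (mem_of_mem_nhds hU)))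
    ((aestronglyMeasurable_exp_mul hm.aestronglyMeasurable (a + s * d)).const_mul d)
    ?_ (hm.norm.const_mul _) ?_).2
  · refine key.congr_deriv ?_
    rw [integral_const_mul, halfLineFT]
  · refine (ae_restrict_iff' measurableSet_Ioi).2 (Eventually.of_forall fun y hy r hr => ?_)
    rw [norm_mul]
    exact mul_le_mul_of_nonneg_left (norm_exp_mul_le (le_of_lt hy) (him r hr)) (norm_nonneg _)
  · refine Eventually.of_forall fun y r _ => ?_
    have : HasDerivAt (fun r : ℝ => -Complex.I * y * (a + r * d)) (-Complex.I * y * d) r := by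
      simpa using (((Complex.ofRealCLM.hasDerivAt (x := r)).mul_const d).const_add a).const_mul
        (-Complex.I * y)
    refine (this.cexp.mul_const (f y)).congr_deriv ?_
    simp only [momentFun]
    ring

/-- Integration by parts in the half line transform. -/
theorem halfLineFT_deriv {f f' : ℝ → ℂ} (hc : ContinuousOn f (Ici 0))
    (hd : ∀ y, 0 < y → HasDerivAt f (f' y) y) (h0 : IntegrableOn f (Ioi 0))
    (h1 : IntegrableOn f' (Ioi 0)) {l : ℂ} (hl : l.im ≤ 0) :
    halfLineFT f' l = -f 0 + Complex.I * l * halfLineFT f l := by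
  have hlim : Tendsto f atTop (𝓝 0) :=
    tendsto_zero_of_hasDerivAt_of_integrableOn_Ioi (a := 0) (fun y hy => hd y hy) h1 h0
  have hexp : ∀ y : ℝ, HasDerivAt (fun y : ℝ => Complex.exp (-Complex.I * y * l))
      (-Complex.I * l * Complex.exp (-Complex.I * y * l)) y := by
    intro y
    have : HasDerivAt (fun y : ℝ => -Complex.I * y * l) (-Complex.I * l) y := by
      simpa using ((Complex.ofRealCLM.hasDerivAt (x := y)).const_mul (-Complex.I)).mul_const l
    refine this.cexp.congr_deriv (by ring)
  have key := integral_Ioi_mul_deriv_eq_deriv_mul (a := 0) (a' := f 0) (b' := 0)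
    (u := fun y : ℝ => Complex.exp (-Complex.I * y * l)) (v := f)
    (u' := fun y : ℝ => -Complex.I * l * Complex.exp (-Complex.I * y * l)) (v' := f')
    (fun y _ => hexp y) (fun y hy => hd y hy) (integrableOn_exp_mul h1 hl) ?_ ?_ ?_
  · rw [halfLineFT, key, halfLineFT, ← integral_const_mul]
    rw [zero_sub, sub_eq_add_neg, ← integral_neg]
    congr 2
    ext y
    ring
  · refine ((integrableOn_exp_mul h0 hl).const_mul (-Complex.I * l)).congr
      (Eventually.of_forall fun y => ?_)
    simp only [Pi.mul_apply]
    ring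
  · have h2 : ContinuousWithinAt (fun y : ℝ => Complex.exp (-Complex.I * y * l) * f y) (Ioi 0) 0 :=
      (Continuous.continuousWithinAt (by fun_prop)).mul
        ((hc 0 self_mem_Ici).mono Ioi_subset_Ici_self)
    have h3 := h2.tendsto
    simp only [Complex.ofReal_zero, mul_zero, zero_mul, Complex.exp_zero, one_mul] at h3
    exact h3
  · apply squeeze_zero_norm' _ (tendsto_zero_iff_norm_tendsto_zero.1 hlim)
    filter_upwards [eventually_ge_atTop 0] with y hy
    exact norm_exp_mul_le hy hl

theorem norm_mul_halfLineFT_le {f f' : ℝ → ℂ} (hc : ContinuousOn f (Ici 0))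
    (hd : ∀ y, 0 < y → HasDerivAt f (f' y) y) (h0 : IntegrableOn f (Ioi 0))
    (h1 : IntegrableOn f' (Ioi 0)) {l : ℂ} (hl : l.im ≤ 0) :
    ‖l‖ * ‖halfLineFT f l‖ ≤ ‖f 0‖ + ∫ y in Ioi (0 : ℝ), ‖f' y‖ := by
  have h := halfLineFT_deriv hc hd h0 h1 hl
  have h2 : Complex.I * l * halfLineFT f l = f 0 + halfLineFT f' l := by rw [h]; ring
  have h3 := congrArg norm h2
  rw [norm_mul, norm_mul, Complex.norm_I, one_mul] at h3
  rw [h3]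
  exact (norm_add_le _ _).trans (by gcongr; exact norm_halfLineFT_le h1 hl)

theorem exists_norm_halfLineFT_le {f f' : ℝ → ℂ} (hc : ContinuousOn f (Ici 0))
    (hd : ∀ y, 0 < y → HasDerivAt f (f' y) y) (h0 : IntegrableOn f (Ioi 0))
    (h1 : IntegrableOn f' (Ioi 0)) :
    ∃ C, 0 ≤ C ∧ ∀ l : ℂ, l.im ≤ 0 → ‖halfLineFT f l‖ ≤ C / (1 + ‖l‖) := by
  refine ⟨(∫ y in Ioi (0 : ℝ), ‖f y‖) + (‖f 0‖ + ∫ y in Ioi (0 : ℝ), ‖f' y‖), ?_, fun l hl => ?_⟩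
  · positivity
  · rw [le_div_iff₀ (by positivity)]
    have := norm_halfLineFT_le h0 hl
    have := norm_mul_halfLineFT_le hc hd h0 h1 hl
    linarith

/-! ### Divided differences of the half line transform -/

/-- The divided difference of `halfLineFT f`. -/
def ftSlope (f : ℝ → ℂ) (p : ℂ × ℂ) : ℂ :=
  ∫ s in (0 : ℝ)..1, halfLineFT (momentFun f) (p.1 + s * (p.2 - p.1))

theorem im_segment_nonpos {a b : ℂ} (ha : a.im ≤ 0) (hb : b.im ≤ 0) {s : ℝ}
    (hs : s ∈ Icc (0 : ℝ) 1) : (a + s * (b - a)).im ≤ 0 := by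
  rw [Complex.add_im, Complex.im_ofReal_mul, Complex.sub_im]
  nlinarith [hs.1, hs.2]

/-- The fundamental theorem of calculus along the segment from `a` to `b`, which stays in the closed
lower half plane by convexity. The integral form of the slope also makes sense for `a = b`, and this
is what removes the pole at `ν = l`. -/
theorem mul_ftSlope {f : ℝ → ℂ} (h0 : IntegrableOn f (Ioi 0))
    (h1 : IntegrableOn (fun y : ℝ => (y : ℂ) * f y) (Ioi 0)) {a b : ℂ} (ha : a.im ≤ 0)
    (hb : b.im ≤ 0) : (b - a) * ftSlope f (a, b) = halfLineFT f b - halfLineFT f a := by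
  have hm := IntegrableOn.momentFun h1
  have hc : ∀ {g : ℝ → ℂ}, IntegrableOn g (Ioi 0) →
      ContinuousOn (fun s : ℝ => halfLineFT g (a + s * (b - a))) (Icc 0 1) := fun hg =>
    (continuousOn_halfLineFT hg).comp (by fun_prop) fun s hs => im_segment_nonpos ha hb hs
  have := intervalIntegral.integral_eq_sub_of_hasDerivAt_of_le zero_le_one (hc h0)
    (f' := fun s : ℝ => (b - a) * halfLineFT (momentFun f) (a + s * (b - a)))
    (fun s hs => hasDerivAt_halfLineFT_line h0 h1 (Icc_mem_nhds hs.1 hs.2)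
      fun r hr => im_segment_nonpos ha hb hr)
    (by
      apply ContinuousOn.intervalIntegrable
      rw [uIcc_of_le zero_le_one]
      exact continuousOn_const.mul (hc hm))
  rw [intervalIntegral.integral_const_mul] at this
  rw [ftSlope, this]
  simp

theorem continuousOn_ftSlope {f : ℝ → ℂ}
    (h1 : IntegrableOn (fun y : ℝ => (y : ℂ) * f y) (Ioi 0)) :
    ContinuousOn (ftSlope f) {p | p.1.im ≤ 0 ∧ p.2.im ≤ 0} := by
  have hm := IntegrableOn.momentFun h1
  have hcm := continuousOn_halfLineFT hm
  unfold ftSlope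
  simp only [intervalIntegral.integral_of_le zero_le_one]
  refine continuousOn_of_dominated (bound := fun _ => ∫ y in Ioi (0 : ℝ), ‖momentFun f y‖)
    (fun p hp => ?_) (fun p hp => ?_) (integrable_const _) ?_
  · exact ContinuousOn.aestronglyMeasurable (hcm.comp (by fun_prop) fun s hs =>
      im_segment_nonpos hp.1 hp.2 (Ioc_subset_Icc_self hs)) measurableSet_Ioc
  · exact (ae_restrict_iff' measurableSet_Ioc).2 (Eventually.of_forall fun s hs =>
      norm_halfLineFT_le hm (im_segment_nonpos hp.1 hp.2 (Ioc_subset_Icc_self hs)))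
  · exact (ae_restrict_iff' measurableSet_Ioc).2 (Eventually.of_forall fun s hs =>
      hcm.comp (by fun_prop) fun p hp =>
        im_segment_nonpos hp.1 hp.2 (Ioc_subset_Icc_self hs))

theorem norm_ftSlope_le {f : ℝ → ℂ}
    (h1 : IntegrableOn (fun y : ℝ => (y : ℂ) * f y) (Ioi 0)) {a b : ℂ} (ha : a.im ≤ 0)
    (hb : b.im ≤ 0) : ‖ftSlope f (a, b)‖ ≤ ∫ y in Ioi (0 : ℝ), ‖momentFun f y‖ := by
  have hm := IntegrableOn.momentFun h1
  have := intervalIntegral.norm_integral_le_of_norm_le_const (a := 0) (b := 1)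
    (f := fun s : ℝ => halfLineFT (momentFun f) (a + s * (b - a)))
    (C := ∫ y in Ioi (0 : ℝ), ‖momentFun f y‖) fun s hs => by
      rw [uIoc_of_le zero_le_one] at hs
      exact norm_halfLineFT_le hm (im_segment_nonpos ha hb (Ioc_subset_Icc_self hs))
  simpa [ftSlope] using this

theorem norm_exp_I_mul (l : ℂ) (y : ℝ) :
    ‖Complex.exp (Complex.I * l * y)‖ = Real.exp (-y * l.im) := by
  rw [Complex.norm_exp]
  congr 1
  simp
  ring

/-- The reflected transforms at `-l` and `-ν l` contribute a term that is holomorphic and decays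
in each quadrant; the apparent pole at `ν l = l` is removed by the divided difference. -/
theorem isDecaying_reflected {κ : ℝ} (y : ℝ) {S : Set ℂ} (hS : S ⊆ {l | 0 ≤ l.im}) {ν : ℂ → ℂ}
    (hν : IsRootBranch κ S ν) {f f' : ℝ → ℂ} (hc : ContinuousOn f (Ici 0))
    (hd : ∀ y, 0 < y → HasDerivAt f (f' y) y) (h0 : IntegrableOn f (Ioi 0))
    (h0' : IntegrableOn f' (Ioi 0)) (h1 : IntegrableOn (fun y : ℝ => (y : ℂ) * f y) (Ioi 0))
    (c : ℂ) :
    IsDecaying y S (fun l => c * Complex.exp (Complex.I * l * y) *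
      (halfLineFT f (-l) + 2 * l * ftSlope f (-l, -ν l))) where
  cont := by
    have e1 : ContinuousOn (fun l => halfLineFT f (-l)) S :=
      (continuousOn_halfLineFT h0).comp continuousOn_neg fun l hl => by
        simpa using hS hl
    have e2 : ContinuousOn (fun l => ftSlope f (-l, -ν l)) S :=
      (continuousOn_ftSlope h1).comp (continuousOn_neg.prodMk hν.cont.neg) fun l hl => by
        simpa using ⟨hS hl, hν.im_nonneg l hl⟩
    exact (Continuous.continuousOn (by fun_prop)).mul
      (e1.add ((Continuous.continuousOn (by fun_prop)).mul e2))
  bound := by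
    obtain ⟨C, hC0, hC⟩ := exists_norm_halfLineFT_le hc hd h0 h0'
    set M := ∫ y in Ioi (0 : ℝ), ‖momentFun f y‖ with hM
    have hM0 : 0 ≤ M := by positivity
    -- The threshold makes `|ν|` and `|l|` comparable up to a factor `2` and gives `2|l²+κ²| ≥ |l|²`
    -- when `|l|² ≥ ρ`. For smaller `|l|` the uniform bound `M` on the slope suffices.
    set ρ : ℝ := 4 * κ ^ 2 + 1 with hρ
    have hρ1 : 1 ≤ ρ := by nlinarith [sq_nonneg κ]
    refine ⟨‖c‖ * (19 * C + 2 * ρ * M * (1 + ρ)), fun l hl => ?_⟩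
    have him : (-l).im ≤ 0 := by simpa using hS hl
    have hiν : (-ν l).im ≤ 0 := by simpa using hν.im_nonneg l hl
    have hr0 := norm_nonneg l
    have hA := hC (-l) him
    rw [norm_neg] at hA
    have hsl : ‖l‖ * ‖ftSlope f (-l, -ν l)‖ ≤ (9 * C + ρ * M * (1 + ρ)) / (1 + ‖l‖) := by
      rw [le_div_iff₀ (by positivity)]
      rcases le_or_gt ρ (‖l‖ ^ 2) with hbig | hsmall
      · have hN := hC (-ν l) hiν
        rw [norm_neg] at hN
        have hsq : ‖ν l‖ ^ 2 = ‖l ^ 2 + 2 * (κ : ℂ) ^ 2‖ := by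
          rw [← norm_pow, hν.sq l hl, ← norm_neg]
          congr 1
          ring
        have hκn : ‖(κ : ℂ) ^ 2‖ = κ ^ 2 := by
          rw [norm_pow, Complex.norm_real, Real.norm_eq_abs, sq_abs]
        have hκn2 : ‖2 * (κ : ℂ) ^ 2‖ = 2 * κ ^ 2 := by rw [norm_mul, hκn]; simp
        have hup : ‖ν l‖ ^ 2 ≤ ‖l‖ ^ 2 + 2 * κ ^ 2 := by
          rw [hsq, ← hκn2, ← norm_pow]
          exact norm_add_le _ _
        have hlo : ‖l‖ ^ 2 - 2 * κ ^ 2 ≤ ‖ν l‖ ^ 2 := by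
          rw [hsq, ← hκn2, ← norm_pow]
          have := norm_sub_norm_le (l ^ 2) (-(2 * (κ : ℂ) ^ 2))
          rwa [norm_neg, sub_neg_eq_add] at this
        have hq : ‖l‖ ^ 2 - κ ^ 2 ≤ ‖l ^ 2 + (κ : ℂ) ^ 2‖ := by
          rw [← hκn, ← norm_pow]
          have := norm_sub_norm_le (l ^ 2) (-((κ : ℂ) ^ 2))
          rwa [norm_neg, sub_neg_eq_add] at this
        have hν2 : ‖ν l‖ ≤ 2 * ‖l‖ := abs_le_of_sq_le_sq' (by nlinarith) (by positivity) |>.2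
        have hν3 : ‖l‖ ≤ 2 * ‖ν l‖ := abs_le_of_sq_le_sq' (by nlinarith) (by positivity) |>.2
        have hrpos : 0 < ‖l‖ := by
          by_contra h
          have : ‖l‖ = 0 := le_antisymm (not_lt.1 h) hr0
          rw [this] at hbig
          nlinarith
        have hN2 : ‖halfLineFT f (-ν l)‖ ≤ 2 * C / (1 + ‖l‖) := by
          refine hN.trans ?_
          rw [div_le_div_iff₀ (by positivity) (by positivity)]
          nlinarith
        -- Since `(l-ν)(l+ν) = 2(l²+κ²)`, multiplying the slope identity by `l+ν` produces a factor
        -- of size `|l|²` without any lower bound for `|l-ν|`.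
        have hid : 2 * (l ^ 2 + (κ : ℂ) ^ 2) * ftSlope f (-l, -ν l) =
            (l + ν l) * (halfLineFT f (-ν l) - halfLineFT f (-l)) := by
          rw [← mul_ftSlope h0 h1 him hiν]
          linear_combination ftSlope f (-l, -ν l) * hν.sq l hl
        have hid2 := congrArg norm hid
        rw [norm_mul, norm_mul, norm_mul] at hid2
        have hR : ‖l + ν l‖ * ‖halfLineFT f (-ν l) - halfLineFT f (-l)‖ ≤
            (3 * ‖l‖) * (3 * C / (1 + ‖l‖)) := by
          gcongr
          · exact (norm_add_le _ _).trans (by linarith)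
          · refine (norm_sub_le _ _).trans ?_
            rw [show 3 * C / (1 + ‖l‖) = 2 * C / (1 + ‖l‖) + C / (1 + ‖l‖) by ring]
            exact add_le_add hN2 hA
        have hlow : ‖l‖ ^ 2 ≤ ‖(2 : ℂ)‖ * ‖l ^ 2 + (κ : ℂ) ^ 2‖ := by
          rw [Complex.norm_ofNat]
          nlinarith
        have hfin : ‖l‖ ^ 2 * ‖ftSlope f (-l, -ν l)‖ ≤ (3 * ‖l‖) * (3 * C / (1 + ‖l‖)) :=
          (mul_le_mul_of_nonneg_right hlow (norm_nonneg _)).trans (hid2.le.trans hR)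
        have h5 : ‖l‖ * (‖l‖ * ‖ftSlope f (-l, -ν l)‖ * (1 + ‖l‖)) ≤ ‖l‖ * (9 * C) := by
          have := mul_le_mul_of_nonneg_right hfin (by positivity : 0 ≤ 1 + ‖l‖)
          calc _ = ‖l‖ ^ 2 * ‖ftSlope f (-l, -ν l)‖ * (1 + ‖l‖) := by ring
            _ ≤ _ := this
            _ = _ := by field_simp; ring
        have h6 := le_of_mul_le_mul_left h5 hrpos
        have : 0 ≤ ρ * M * (1 + ρ) := by positivity
        linarith
      · have hrρ : ‖l‖ ≤ ρ := by nlinarith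
        have := norm_ftSlope_le h1 him hiν
        calc ‖l‖ * ‖ftSlope f (-l, -ν l)‖ * (1 + ‖l‖) ≤ ρ * M * (1 + ρ) := by gcongr
          _ ≤ _ := by linarith
    rw [norm_mul, norm_mul, norm_exp_I_mul]
    calc ‖c‖ * Real.exp (-y * l.im) * ‖halfLineFT f (-l) + 2 * l * ftSlope f (-l, -ν l)‖
        ≤ ‖c‖ * Real.exp (-y * l.im) *
          (C / (1 + ‖l‖) + 2 * ((9 * C + ρ * M * (1 + ρ)) / (1 + ‖l‖))) := by
          gcongr
          refine (norm_add_le _ _).trans (add_le_add hA ?_)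
          rw [norm_mul, norm_mul, Complex.norm_ofNat, mul_assoc]
          gcongr
      _ = _ := by field_simp; ring
  diff l hl hre him := by
    have hsq := hν.sq l hl
    have hνd := hν.diff l hl hre him
    have hsqim := congrArg Complex.im hsq
    simp [pow_two] at hsqim
    have hne : l.re * l.im ≠ 0 := mul_ne_zero hre him.ne'
    -- Off the axes `Im ν² = -Im l² ≠ 0`. Thus `ν` is not real, and `ν = l` would give `Im l² = -Im
    -- l²`, hence `Re l · Im l = 0`.
    have hνim : 0 < (ν l).im := by
      refine lt_of_le_of_ne (hν.im_nonneg l hl) fun h => ?_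
      rw [← h] at hsqim
      apply hne
      linarith
    have hνl : ν l ≠ l := by
      intro h
      rw [h] at hsqim
      apply hne
      linarith
    -- Near such a point the slope is an ordinary difference quotient of transforms that are
    -- holomorphic at `-l` and `-ν`.
    have hev : (fun l => ftSlope f (-l, -ν l)) =ᶠ[𝓝 l]
        fun l => (halfLineFT f (-ν l) - halfLineFT f (-l)) / (-ν l - -l) := by
      have c1 := hνd.continuousAt
      filter_upwards [Complex.continuous_im.continuousAt.eventually (lt_mem_nhds him),
        (Complex.continuous_im.continuousAt.comp c1).eventually (lt_mem_nhds hνim),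
        (c1.ne_iff_eventually_ne continuousAt_id).1 hνl] with z hz1 hz2 hz3
      rw [← mul_ftSlope h0 h1 (by simpa using hz1.le) (by simpa using le_of_lt hz2),
        mul_div_cancel_left₀]
      intro h
      apply hz3
      simp only [id]
      linear_combination -h
    have d1 : DifferentiableAt ℂ (fun l => halfLineFT f (-l)) l :=
      DifferentiableAt.fun_comp' l (g := halfLineFT f)
        (differentiableAt_halfLineFT h0 h1 (by simpa using him)) differentiableAt_id.neg
    have d2 : DifferentiableAt ℂ (fun l => halfLineFT f (-ν l)) l :=
      DifferentiableAt.fun_comp' l (g := halfLineFT f)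
        (differentiableAt_halfLineFT h0 h1 (by simpa using hνim)) hνd.neg
    have d3 : DifferentiableAt ℂ (fun l => ftSlope f (-l, -ν l)) l := by
      refine DifferentiableAt.congr_of_eventuallyEq ?_ hev
      refine (d2.sub d1).div (hνd.neg.sub differentiableAt_id.neg) fun h => hνl ?_
      have h' : -ν l - -l = 0 := h
      linear_combination -h'
    exact DifferentiableAt.mul (by fun_prop)
      (d1.add (DifferentiableAt.mul (by fun_prop) d3))

/-! ### The time transform of boundary data -/

def timeFT (b : ℝ → ℂ) (η : ℂ) (t : ℝ) : ℂ :=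
  ∫ τ in (0 : ℝ)..t, Complex.exp (η * τ) * b τ

/-- Continuously differentiable data on `[0, t]`. -/
structure IsC1Data (t : ℝ) (b b' : ℝ → ℂ) : Prop where
  cont : ContinuousOn b (Icc 0 t)
  cont_deriv : ContinuousOn b' (Icc 0 t)
  hasDerivAt : ∀ τ ∈ Ioo 0 t, HasDerivAt b (b' τ) τ

theorem exists_bound_of_continuousOn_Icc {t : ℝ} {b : ℝ → ℂ} (h : ContinuousOn b (Icc 0 t)) :
    ∃ B, 0 ≤ B ∧ ∀ τ ∈ Icc 0 t, ‖b τ‖ ≤ B := by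
  obtain ⟨B, hB⟩ := isCompact_Icc.exists_bound_of_continuousOn h
  exact ⟨max B 0, le_max_right _ _, fun τ hτ => (hB τ hτ).trans (le_max_left _ _)⟩

theorem norm_exp_neg_mul_timeFT_le {t : ℝ} (ht : 0 ≤ t) {b : ℝ → ℂ} {B : ℝ}
    (hB : ∀ τ ∈ Icc 0 t, ‖b τ‖ ≤ B) {η : ℂ} (hη : 0 ≤ η.re) :
    ‖Complex.exp (-η * t) * timeFT b η t‖ ≤ B * t := by
  rw [timeFT, ← intervalIntegral.integral_const_mul]
  have := intervalIntegral.norm_integral_le_of_norm_le_const (a := 0) (b := t)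
    (f := fun τ : ℝ => Complex.exp (-η * t) * (Complex.exp (η * τ) * b τ)) (C := B) fun τ hτ => by
      rw [uIoc_of_le ht] at hτ
      rw [← mul_assoc, ← Complex.exp_add, norm_mul, Complex.norm_exp]
      have h1 : (-η * t + η * τ).re ≤ 0 := by
        simp
        nlinarith [hτ.2]
      have h2 := hB τ (Ioc_subset_Icc_self hτ)
      calc _ ≤ 1 * ‖b τ‖ := by
            gcongr
            exact Real.exp_le_one_iff.2 h1
        _ ≤ B := by linarith
  simpa [abs_of_nonneg ht] using this

theorem mul_timeFT {t : ℝ} (ht : 0 ≤ t) {b b' : ℝ → ℂ} (h : IsC1Data t b b') (η : ℂ) :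
    η * timeFT b η t = Complex.exp (η * t) * b t - b 0 - timeFT b' η t := by
  have hexp : ∀ τ : ℝ, HasDerivAt (fun τ : ℝ => Complex.exp (η * τ))
      (η * Complex.exp (η * τ)) τ := by
    intro τ
    have : HasDerivAt (fun τ : ℝ => η * (τ : ℂ)) η τ := by
      simpa using (Complex.ofRealCLM.hasDerivAt (x := τ)).const_mul η
    exact this.cexp.congr_deriv (by ring)
  have ce : Continuous fun τ : ℝ => Complex.exp (η * τ) := by fun_prop
  have i1 : IntervalIntegrable (fun τ : ℝ => Complex.exp (η * τ) * b τ) volume 0 t := by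
    apply ContinuousOn.intervalIntegrable
    rw [uIcc_of_le ht]
    exact ce.continuousOn.mul h.cont
  have i2 : IntervalIntegrable (fun τ : ℝ => Complex.exp (η * τ) * b' τ) volume 0 t := by
    apply ContinuousOn.intervalIntegrable
    rw [uIcc_of_le ht]
    exact ce.continuousOn.mul h.cont_deriv
  have key := intervalIntegral.integral_eq_sub_of_hasDerivAt_of_le ht
    (f := fun τ : ℝ => Complex.exp (η * τ) * b τ)
    (f' := fun τ : ℝ => η * (Complex.exp (η * τ) * b τ) + Complex.exp (η * τ) * b' τ)
    (ce.continuousOn.mul h.cont)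
    (fun τ hτ => ((hexp τ).mul (h.hasDerivAt τ hτ)).congr_deriv (by ring))
    ((i1.const_mul η).add i2)
  rw [intervalIntegral.integral_add (i1.const_mul η) i2, intervalIntegral.integral_const_mul] at key
  simp only [Complex.ofReal_zero, mul_zero, Complex.exp_zero, one_mul] at key
  rw [timeFT, timeFT]
  linear_combination key

/-- Integration by parts in `τ` gains the factor `1/|η|`; the prefactor `e^{-ηt}` turns every
exponential into `e^{-η(t-τ)}`, bounded for `Re η ≥ 0`. -/
theorem exists_norm_timeFT_le {t : ℝ} (ht : 0 ≤ t) {b b' : ℝ → ℂ} (h : IsC1Data t b b') :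
    ∃ C, 0 ≤ C ∧ ∀ η : ℂ, 0 ≤ η.re →
      ‖Complex.exp (-η * t) * timeFT b η t‖ ≤ C / (1 + ‖η‖) := by
  obtain ⟨B, hB0, hB⟩ := exists_bound_of_continuousOn_Icc h.cont
  obtain ⟨B', hB0', hB'⟩ := exists_bound_of_continuousOn_Icc h.cont_deriv
  refine ⟨B * t + (2 * B + B' * t), by positivity, fun η hη => ?_⟩
  rw [le_div_iff₀ (by positivity), mul_add, mul_one]
  refine add_le_add (norm_exp_neg_mul_timeFT_le ht hB hη) ?_
  rw [← norm_mul]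
  have e : Complex.exp (-η * t) * timeFT b η t * η =
      b t - Complex.exp (-η * t) * b 0 - Complex.exp (-η * t) * timeFT b' η t := by
    rw [mul_assoc, mul_comm (timeFT b η t), mul_timeFT ht h, mul_sub, mul_sub, ← mul_assoc,
      ← Complex.exp_add]
    simp
  rw [e]
  have h1 : ‖Complex.exp (-η * t) * b 0‖ ≤ B := by
    rw [norm_mul, Complex.norm_exp]
    have : (-η * t).re ≤ 0 := by
      simp
      exact mul_nonneg hη ht
    calc _ ≤ 1 * ‖b 0‖ := by
          gcongr
          exact Real.exp_le_one_iff.2 this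
      _ ≤ B := by linarith [hB 0 ⟨le_rfl, ht⟩]
  have h2 := hB t ⟨ht, le_rfl⟩
  have h3 := norm_exp_neg_mul_timeFT_le ht hB' hη
  linarith [norm_sub_le (b t - Complex.exp (-η * t) * b 0) (Complex.exp (-η * t) * timeFT b' η t),
    norm_sub_le (b t) (Complex.exp (-η * t) * b 0)]

theorem differentiable_timeFT {t : ℝ} (ht : 0 ≤ t) {b : ℝ → ℂ} (h : ContinuousOn b (Icc 0 t)) :
    Differentiable ℂ (fun η => timeFT b η t) := by
  intro η
  obtain ⟨B, hB0, hB⟩ := exists_bound_of_continuousOn_Icc h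
  have hm : ∀ g : ℝ → ℂ, Continuous g →
      AEStronglyMeasurable (fun τ => g τ * b τ) (volume.restrict (uIoc 0 t)) := by
    intro g hg
    rw [uIoc_of_le ht]
    exact ((hg.continuousOn.mul h).mono Ioc_subset_Icc_self).aestronglyMeasurable measurableSet_Ioc
  refine (intervalIntegral.hasDerivAt_integral_of_dominated_loc_of_deriv_le (𝕜 := ℂ)
    (F := fun η (τ : ℝ) => Complex.exp (η * τ) * b τ)
    (F' := fun η (τ : ℝ) => (Complex.exp (η * τ) * τ) * b τ)
    (bound := fun _ => Real.exp ((‖η‖ + 1) * t) * t * B) (Metric.ball_mem_nhds η one_pos)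
    (Eventually.of_forall fun η => hm _ (by fun_prop)) ?_ (hm _ (by fun_prop)) ?_ ?_
    ?_).2.differentiableAt
  · apply ContinuousOn.intervalIntegrable
    rw [uIcc_of_le ht]
    exact (Continuous.continuousOn (by fun_prop)).mul h
  · refine Eventually.of_forall fun τ hτ z hz => ?_
    rw [uIoc_of_le ht] at hτ
    rw [norm_mul, norm_mul, Complex.norm_exp, Complex.norm_real, Real.norm_of_nonneg hτ.1.le]
    have hzn : ‖z‖ ≤ ‖η‖ + 1 := by
      have := norm_sub_norm_le z η
      rw [Metric.mem_ball, dist_eq_norm] at hz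
      linarith
    have h1 : (z * τ).re ≤ (‖η‖ + 1) * t := by
      rw [Complex.re_mul_ofReal]
      calc z.re * τ ≤ ‖z‖ * τ := by
            gcongr
            · exact hτ.1.le
            · exact Complex.re_le_norm z
        _ ≤ (‖η‖ + 1) * t := by
            gcongr
            · exact hτ.1.le
            · exact hτ.2
    have := hB τ (Ioc_subset_Icc_self hτ)
    gcongr
    · exact hτ.1.le
    · exact hτ.2
  · exact intervalIntegrable_const
  · refine Eventually.of_forall fun τ _ z _ => ?_
    have : HasDerivAt (fun z : ℂ => z * (τ : ℂ)) τ z := by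
      simpa using (hasDerivAt_id z).mul_const (τ : ℂ)
    exact this.cexp.mul_const (b τ)

/-- The exponent of the time transforms. -/
def timeExponent (κ : ℝ) (l : ℂ) : ℂ := -Complex.I * ((κ : ℂ) ^ 2 + l ^ 2) ^ 2

theorem re_timeExponent_nonneg {κ : ℝ} {l : ℂ} (hl : l ∈ boundedRegion κ) :
    0 ≤ (timeExponent κ l).re := by
  have h : (timeExponent κ l).re = 4 * l.im * (l.re * (κ ^ 2 + l.re ^ 2 - l.im ^ 2)) := by
    simp [timeExponent, pow_two]
    ring
  rw [h]
  exact mul_nonneg (mul_nonneg (by norm_num) hl.1) hl.2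

/-- The combination of boundary data that appears in the global relation. -/
def boundaryTerm (b₀ b₁ b₂ b₃ : ℝ → ℂ) (κ : ℝ) (l : ℂ) (t : ℝ) : ℂ :=
  -Complex.I * timeFT b₃ (timeExponent κ l) t + l * timeFT b₂ (timeExponent κ l) t
    + Complex.I * (l ^ 2 + 2 * (κ : ℂ) ^ 2) * timeFT b₁ (timeExponent κ l) t
    - l * (l ^ 2 + 2 * (κ : ℂ) ^ 2) * timeFT b₀ (timeExponent κ l) t

theorem E_eq (κ : ℝ) (l : ℂ) (x y t : ℝ) :
    E κ l x y t = Complex.exp (Complex.I * κ * x) * Complex.exp (Complex.I * l * y) *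
      Complex.exp (-timeExponent κ l * t) := by
  rw [E, ← Complex.exp_add, ← Complex.exp_add, timeExponent]
  congr 1
  ring

/-- Quartic growth of the exponent: `|η| = |κ²+l²|²` and `|l|² ≤ |κ²+l²| + κ²`. -/
theorem one_add_norm_pow_le (κ : ℝ) (l : ℂ) :
    (1 + ‖l‖) ^ 4 ≤ 2 * (2 + 2 * κ ^ 2) ^ 2 * (1 + ‖timeExponent κ l‖) := by
  set q := ‖(κ : ℂ) ^ 2 + l ^ 2‖ with hq
  have hq0 : 0 ≤ q := norm_nonneg _
  have hη : ‖timeExponent κ l‖ = q ^ 2 := by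
    rw [timeExponent, norm_mul, norm_neg, Complex.norm_I, one_mul, norm_pow]
  have h1 : ‖l‖ ^ 2 ≤ q + κ ^ 2 := by
    have : l ^ 2 = ((κ : ℂ) ^ 2 + l ^ 2) - (κ : ℂ) ^ 2 := by ring
    rw [← norm_pow, this]
    refine (norm_sub_le _ _).trans ?_
    rw [norm_pow (κ : ℂ), Complex.norm_real, Real.norm_eq_abs, sq_abs]
  have h2 : (1 + ‖l‖) ^ 2 ≤ (2 + 2 * κ ^ 2) * (1 + q) := by
    nlinarith [sq_nonneg (1 - ‖l‖), mul_nonneg (sq_nonneg κ) hq0]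
  have h3 : (1 + q) ^ 2 ≤ 2 * (1 + q ^ 2) := by nlinarith [sq_nonneg (1 - q)]
  rw [hη]
  calc (1 + ‖l‖) ^ 4 = ((1 + ‖l‖) ^ 2) ^ 2 := by ring
    _ ≤ ((2 + 2 * κ ^ 2) * (1 + q)) ^ 2 := by gcongr
    _ = (2 + 2 * κ ^ 2) ^ 2 * (1 + q) ^ 2 := by ring
    _ ≤ (2 + 2 * κ ^ 2) ^ 2 * (2 * (1 + q ^ 2)) := by gcongr
    _ = _ := by ring

/-- A count of powers: the coefficients are `O((1+|l|)³)`, while `e^{-ηt}` times a time transform is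
`O(1/(1+|η|)) = O((1+|l|)^{-4})`, leaving `1/(1+|l|)`. -/
theorem isDecaying_boundaryTerm {t : ℝ} (ht : 0 ≤ t) {b₀ b₀' b₁ b₁' b₂ b₂' b₃ b₃' : ℝ → ℂ}
    (h₀ : IsC1Data t b₀ b₀') (h₁ : IsC1Data t b₁ b₁') (h₂ : IsC1Data t b₂ b₂')
    (h₃ : IsC1Data t b₃ b₃') (κ x y : ℝ) :
    IsDecaying y (boundedRegion κ) (fun l => E κ l x y t * boundaryTerm b₀ b₁ b₂ b₃ κ l t) := by
  have dη : Differentiable ℂ (timeExponent κ) := by unfold timeExponent; fun_prop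
  have dT : ∀ {b b' : ℝ → ℂ}, IsC1Data t b b' →
      Differentiable ℂ (fun l => timeFT b (timeExponent κ l) t) := fun hb =>
    (differentiable_timeFT ht hb.cont).comp dη
  have hdiff : Differentiable ℂ
      (fun l => E κ l x y t * boundaryTerm b₀ b₁ b₂ b₃ κ l t) := by
    have := dT h₀
    have := dT h₁
    have := dT h₂
    have := dT h₃
    unfold boundaryTerm E
    fun_prop
  refine ⟨hdiff.continuous.continuousOn, ?_, fun l _ _ _ => hdiff l⟩
  obtain ⟨C₀, hp₀, hC₀⟩ := exists_norm_timeFT_le ht h₀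
  obtain ⟨C₁, hp₁, hC₁⟩ := exists_norm_timeFT_le ht h₁
  obtain ⟨C₂, hp₂, hC₂⟩ := exists_norm_timeFT_le ht h₂
  obtain ⟨C₃, hp₃, hC₃⟩ := exists_norm_timeFT_le ht h₃
  refine ⟨(1 + 2 * κ ^ 2) * (C₃ + C₂ + C₁ + C₀) * (2 * (2 + 2 * κ ^ 2) ^ 2), fun l hl => ?_⟩
  have hη := re_timeExponent_nonneg hl
  set η := timeExponent κ l with hηdef
  set r := ‖l‖ with hr
  have hr0 : 0 ≤ r := norm_nonneg l
  set K := 1 + 2 * κ ^ 2 with hK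
  have hK1 : 1 ≤ K := by nlinarith [sq_nonneg κ]
  have hw : ‖l ^ 2 + 2 * (κ : ℂ) ^ 2‖ ≤ K * (1 + r) ^ 2 := by
    refine (norm_add_le _ _).trans ?_
    rw [norm_mul, norm_pow, norm_pow, Complex.norm_real, Real.norm_eq_abs, sq_abs,
      Complex.norm_ofNat]
    nlinarith [sq_nonneg κ, mul_nonneg (sq_nonneg κ) hr0, mul_nonneg (sq_nonneg κ) (sq_nonneg r)]
  have hP : 1 ≤ (1 + r) ^ 2 := by nlinarith
  have c3 : ‖-Complex.I‖ ≤ K * (1 + r) ^ 3 := by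
    rw [norm_neg, Complex.norm_I]
    calc (1 : ℝ) = 1 * 1 := by ring
      _ ≤ K * (1 + r) ^ 3 := by
        gcongr
        exact one_le_pow₀ (by linarith)
  have c2 : ‖l‖ ≤ K * (1 + r) ^ 3 := by
    calc r ≤ 1 * ((1 + r) * 1) := by linarith
      _ ≤ K * ((1 + r) * (1 + r) ^ 2) := by gcongr
      _ = _ := by ring
  have c1 : ‖Complex.I * (l ^ 2 + 2 * (κ : ℂ) ^ 2)‖ ≤ K * (1 + r) ^ 3 := by
    rw [norm_mul, Complex.norm_I, one_mul]
    refine hw.trans ?_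
    gcongr 1
    exact pow_le_pow_right₀ (by linarith) (by norm_num)
  have c0 : ‖l * (l ^ 2 + 2 * (κ : ℂ) ^ 2)‖ ≤ K * (1 + r) ^ 3 := by
    rw [norm_mul]
    calc r * _ ≤ (1 + r) * (K * (1 + r) ^ 2) := by
          gcongr
          linarith
      _ = _ := by ring
  have hsplit : E κ l x y t * boundaryTerm b₀ b₁ b₂ b₃ κ l t =
      Complex.exp (Complex.I * κ * x) * Complex.exp (Complex.I * l * y) *
        (-Complex.I * (Complex.exp (-η * t) * timeFT b₃ η t)
          + l * (Complex.exp (-η * t) * timeFT b₂ η t)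
          + Complex.I * (l ^ 2 + 2 * (κ : ℂ) ^ 2) * (Complex.exp (-η * t) * timeFT b₁ η t)
          - l * (l ^ 2 + 2 * (κ : ℂ) ^ 2) * (Complex.exp (-η * t) * timeFT b₀ η t)) := by
    rw [E_eq, boundaryTerm, ← hηdef]
    ring
  have hx : ‖Complex.exp (Complex.I * κ * x)‖ = 1 := by
    rw [Complex.norm_exp]
    simp
  have term : ∀ {a T : ℂ} {C : ℝ}, 0 ≤ C → ‖a‖ ≤ K * (1 + r) ^ 3 → ‖T‖ ≤ C / (1 + ‖η‖) →
      ‖a * T‖ ≤ K * (1 + r) ^ 3 * (C / (1 + ‖η‖)) := by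
    intro a T C hC ha hT
    rw [norm_mul]
    gcongr
  have t3 := term hp₃ c3 (hC₃ η hη)
  have t2 := term hp₂ c2 (hC₂ η hη)
  have t1 := term hp₁ c1 (hC₁ η hη)
  have t0 := term hp₀ c0 (hC₀ η hη)
  have hsum := (norm_sub_le _ _).trans (add_le_add ((norm_add_le _ _).trans
    (add_le_add ((norm_add_le _ _).trans (add_le_add t3 t2)) t1)) t0)
  have hfrac : (1 + r) ^ 3 / (1 + ‖η‖) ≤ 2 * (2 + 2 * κ ^ 2) ^ 2 / (1 + r) := by
    rw [div_le_div_iff₀ (by positivity) (by positivity), ← pow_succ]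
    exact one_add_norm_pow_le κ l
  rw [hsplit, norm_mul, norm_mul, hx, one_mul, norm_exp_I_mul]
  refine (mul_le_mul_of_nonneg_left hsum (Real.exp_pos _).le).trans ?_
  calc _ = Real.exp (-y * l.im) * (K * (C₃ + C₂ + C₁ + C₀) * ((1 + r) ^ 3 / (1 + ‖η‖))) := by
        ring
    _ ≤ Real.exp (-y * l.im) * (K * (C₃ + C₂ + C₁ + C₀) * (2 * (2 + 2 * κ ^ 2) ^ 2 / (1 + r))) := by
        gcongr
    _ = _ := by ring

/-! ### Oscillatory integrals on the real line -/

/-- Nonstationary phase: beyond `s₀` the phase satisfies `φ' ≥ 2ts²`, and one integration by parts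
leaves an absolutely convergent integral. No decay of `h` is used, and the bound is linear in `M`
and free of `κ`; this is what later gives integrability in `κ`. -/
theorem exists_oscillatory_limit {t : ℝ} (ht : 0 < t) (κ y : ℝ) {h h' : ℝ → ℂ}
    (hd : ∀ s, HasDerivAt h (h' s) s) (hc : Continuous h') {M : ℝ} (hM : ∀ s, ‖h s‖ ≤ M)
    (hM' : ∀ s, ‖h' s‖ ≤ M) :
    ∃ I, Tendsto (fun R : ℝ => ∫ s in (0 : ℝ)..R,
        Complex.exp (Complex.I * (((κ ^ 2 + s ^ 2) ^ 2 * t + s * y : ℝ) : ℂ)) * h s)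
        atTop (𝓝 I) ∧ ‖I‖ ≤ M * (1 + |y| / (2 * t) + 4 / t) := by
  have hM0 : 0 ≤ M := (norm_nonneg _).trans (hM 0)
  -- Chosen so that `s₀ ≥ 1` and `|y| ≤ 2 s₀ t`; for `s ≥ s₀` the term `y` in `φ'` then costs at
  -- most half of `4s(κ²+s²)t`.
  set s₀ : ℝ := 1 + |y| / (2 * t) with hs₀
  have hs₀1 : 1 ≤ s₀ := by
    have : 0 ≤ |y| / (2 * t) := by positivity
    linarith
  have hy : |y| ≤ 2 * s₀ * t := by
    rw [hs₀]
    have : |y| / (2 * t) * (2 * t) = |y| := by field_simp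
    nlinarith
  set φ : ℝ → ℝ := fun s => (κ ^ 2 + s ^ 2) ^ 2 * t + s * y with hφ
  set φ' : ℝ → ℝ := fun s => 4 * s * (κ ^ 2 + s ^ 2) * t + y with hφ'
  set φ'' : ℝ → ℝ := fun s => (12 * s ^ 2 + 4 * κ ^ 2) * t with hφ''
  have dφ : ∀ s, HasDerivAt φ (φ' s) s := by
    intro s
    have h1 : HasDerivAt (fun s : ℝ => κ ^ 2 + s ^ 2) (2 * s) s := by
      simpa using (hasDerivAt_pow 2 s).const_add (κ ^ 2)
    refine (((h1.fun_pow 2).mul_const t).add ((hasDerivAt_id s).mul_const y)).congr_deriv ?_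
    simp only [hφ', Nat.cast_ofNat, Nat.reduceSub, pow_one]
    ring
  have dφ' : ∀ s, HasDerivAt φ' (φ'' s) s := by
    intro s
    have h1 : HasDerivAt (fun s : ℝ => κ ^ 2 + s ^ 2) (2 * s) s := by
      simpa using (hasDerivAt_pow 2 s).const_add (κ ^ 2)
    have h2 : HasDerivAt (fun s : ℝ => 4 * s) 4 s := by
      simpa using (hasDerivAt_id s).const_mul 4
    refine (((h2.mul h1).mul_const t).add_const y).congr_deriv ?_
    simp only [hφ'']
    ring
  have hlow : ∀ s, s₀ ≤ s → 2 * s * (κ ^ 2 + s ^ 2) * t ≤ φ' s := by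
    intro s hs
    have hs1 : 1 ≤ s := hs₀1.trans hs
    have h1 : |y| ≤ 2 * s * t := hy.trans (by gcongr)
    have h2 : 2 * s * t ≤ 2 * s * (κ ^ 2 + s ^ 2) * t := by
      have : 1 ≤ κ ^ 2 + s ^ 2 := by nlinarith [sq_nonneg κ]
      have h3 : 0 ≤ 2 * s * t := by positivity
      nlinarith
    have := neg_abs_le y
    simp only [hφ']
    linarith
  have hlow2 : ∀ s, s₀ ≤ s → 2 * t * s ^ 2 ≤ φ' s := by
    intro s hs
    have hs1 : 1 ≤ s := hs₀1.trans hs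
    refine le_trans ?_ (hlow s hs)
    have h1 : 0 ≤ κ ^ 2 := sq_nonneg κ
    have h2 : s ^ 2 ≤ s * (κ ^ 2 + s ^ 2) := by nlinarith [mul_nonneg (by linarith : 0 ≤ s) h1]
    nlinarith
  have hpos : ∀ s, s₀ ≤ s → 0 < φ' s := fun s hs => by
    have hs1 : 1 ≤ s := hs₀1.trans hs
    exact lt_of_lt_of_le (by positivity) (hlow2 s hs)
  have hne : ∀ s, s₀ ≤ s → Complex.I * (φ' s : ℂ) ≠ 0 := fun s hs =>
    mul_ne_zero Complex.I_ne_zero (Complex.ofReal_ne_zero.2 (hpos s hs).ne')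
  set e : ℝ → ℂ := fun s => Complex.exp (Complex.I * (φ s : ℂ)) with he
  have hen : ∀ s, ‖e s‖ = 1 := fun s => by
    simp only [he]
    rw [mul_comm, Complex.norm_exp_ofReal_mul_I]
  have de : ∀ s, HasDerivAt e (e s * (Complex.I * (φ' s : ℂ))) s := fun s =>
    ((dφ s).ofReal_comp.const_mul Complex.I).cexp
  -- `P' = e h + r` is the integration by parts; the remainder `r` collects the terms with `h'` and
  -- `φ''`.
  set P : ℝ → ℂ := fun s => e s * h s / (Complex.I * (φ' s : ℂ)) with hP
  set r : ℝ → ℂ := fun s => e s * h' s / (Complex.I * (φ' s : ℂ)) -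
    e s * h s * (Complex.I * (φ'' s : ℂ)) / (Complex.I * (φ' s : ℂ)) ^ 2 with hr
  have dP : ∀ s, s₀ ≤ s → HasDerivAt P (e s * h s + r s) s := by
    intro s hs
    refine (((de s).mul (hd s)).div ((dφ' s).ofReal_comp.const_mul Complex.I)
      (hne s hs)).congr_deriv ?_
    have := hne s hs
    simp only [hr, Pi.mul_apply]
    rw [div_sub_div _ _ this (pow_ne_zero 2 this), eq_comm, add_div' _ _ _
      (mul_ne_zero this (pow_ne_zero 2 this)),
      div_eq_div_iff (mul_ne_zero this (pow_ne_zero 2 this)) (pow_ne_zero 2 this)]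
    ring
  have cφ : Continuous φ := continuous_iff_continuousAt.2 fun s => (dφ s).continuousAt
  have cφ' : Continuous φ' := continuous_iff_continuousAt.2 fun s => (dφ' s).continuousAt
  have cφ'' : Continuous φ'' := by simp only [hφ'']; fun_prop
  have ch : Continuous h := continuous_iff_continuousAt.2 fun s => (hd s).continuousAt
  have ce : Continuous e := continuous_iff_continuousAt.2 fun s => (de s).continuousAt
  have cr : ContinuousOn r (Ici s₀) := by
    have c1 : ContinuousOn (fun s => Complex.I * (φ' s : ℂ)) (Ici s₀) := by fun_prop
    exact ((ce.mul hc).continuousOn.div c1 hne).sub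
      (((ce.mul ch).mul (continuous_const.mul (Complex.continuous_ofReal.comp cφ''))).continuousOn.div
        (c1.pow 2) fun s hs => pow_ne_zero 2 (hne s hs))
  -- The two terms of `r` contribute `M/(2ts²)` and `3M/(ts²)`. In the second, `φ'' ≤ 12(κ²+s²)t` is
  -- absorbed by `φ'² ≥ 4s²(κ²+s²)²t²`, so `κ` disappears.
  have hrb : ∀ s, s₀ ≤ s → ‖r s‖ ≤ 7 * M / (2 * t) * s ^ (-2 : ℝ) := by
    intro s hs
    have hs1 : 1 ≤ s := hs₀1.trans hs
    have hp := hpos s hs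
    have n1 : ‖Complex.I * (φ' s : ℂ)‖ = φ' s := by
      rw [norm_mul, Complex.norm_I, one_mul, Complex.norm_real, Real.norm_of_nonneg hp.le]
    have hφ0 : 0 ≤ φ'' s := by simp only [hφ'']; positivity
    have n2 : ‖Complex.I * (φ'' s : ℂ)‖ = φ'' s := by
      rw [norm_mul, Complex.norm_I, one_mul, Complex.norm_real, Real.norm_of_nonneg hφ0]
    have b1 : ‖e s * h' s / (Complex.I * (φ' s : ℂ))‖ ≤ M / (2 * t * s ^ 2) := by
      rw [norm_div, norm_mul, hen, one_mul, n1]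
      exact div_le_div₀ hM0 (hM' s) (by positivity) (hlow2 s hs)
    have b2 : ‖e s * h s * (Complex.I * (φ'' s : ℂ)) / (Complex.I * (φ' s : ℂ)) ^ 2‖ ≤
        3 * M / (t * s ^ 2) := by
      rw [norm_div, norm_mul, norm_mul, hen, one_mul, norm_pow, n1, n2,
        div_le_div_iff₀ (by positivity) (by positivity)]
      have h1 : φ'' s ≤ 12 * (κ ^ 2 + s ^ 2) * t := by
        simp only [hφ'']
        nlinarith [mul_nonneg (sq_nonneg κ) ht.le]
      have h2 : (2 * s * (κ ^ 2 + s ^ 2) * t) ^ 2 ≤ φ' s ^ 2 := by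
        gcongr
        exact hlow s hs
      have h4 : 1 ≤ κ ^ 2 + s ^ 2 := by nlinarith [sq_nonneg κ]
      calc ‖h s‖ * φ'' s * (t * s ^ 2) ≤ M * (12 * (κ ^ 2 + s ^ 2) * t) * (t * s ^ 2) := by
            gcongr
            exact hM s
        _ = 3 * M * (4 * s ^ 2 * t ^ 2 * (κ ^ 2 + s ^ 2)) := by ring
        _ ≤ 3 * M * (4 * s ^ 2 * t ^ 2 * ((κ ^ 2 + s ^ 2) * (κ ^ 2 + s ^ 2))) := by
            gcongr
            nlinarith
        _ = 3 * M * (2 * s * (κ ^ 2 + s ^ 2) * t) ^ 2 := by ring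
        _ ≤ _ := by gcongr
    refine (norm_sub_le _ _).trans ((add_le_add b1 b2).trans_eq ?_)
    rw [Real.rpow_neg (by linarith), Real.rpow_ofNat]
    field_simp
    ring
  have hs₀p : 0 < s₀ := by linarith
  have hir : IntegrableOn r (Ioi s₀) := by
    refine ((integrableOn_Ioi_rpow_of_lt (by norm_num : (-2 : ℝ) < -1) hs₀p).const_mul
      (7 * M / (2 * t))).mono' ((cr.mono Ioi_subset_Ici_self).aestronglyMeasurable
        measurableSet_Ioi) ?_
    exact (ae_restrict_iff' measurableSet_Ioi).2
      (Eventually.of_forall fun s hs => hrb s (le_of_lt hs))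
  have hPb : ∀ s, s₀ ≤ s → ‖P s‖ ≤ M / (2 * t * s ^ 2) := by
    intro s hs
    have hs1 : 1 ≤ s := hs₀1.trans hs
    simp only [hP]
    rw [norm_div, norm_mul, hen, one_mul, norm_mul, Complex.norm_I, one_mul, Complex.norm_real,
      Real.norm_of_nonneg (hpos s hs).le]
    exact div_le_div₀ hM0 (hM s) (by positivity) (hlow2 s hs)
  have hPlim : Tendsto P atTop (𝓝 0) := by
    have h1 : Tendsto (fun s : ℝ => M / (2 * t * s ^ 2)) atTop (𝓝 0) :=
      tendsto_const_nhds.div_atTop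
        ((tendsto_pow_atTop two_ne_zero).const_mul_atTop (by positivity))
    refine squeeze_zero_norm' ?_ h1
    filter_upwards [eventually_ge_atTop s₀] with s hs using hPb s hs
  have ceh : Continuous fun s => e s * h s := ce.mul ch
  refine ⟨(∫ s in (0 : ℝ)..s₀, e s * h s) + (0 - P s₀ - ∫ s in Ioi s₀, r s), ?_, ?_⟩
  · have h1 := intervalIntegral_tendsto_integral_Ioi s₀ hir tendsto_id
    have h2 := ((hPlim.sub_const (P s₀)).sub h1).const_add (∫ s in (0 : ℝ)..s₀, e s * h s)
    refine h2.congr' ?_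
    filter_upwards [eventually_ge_atTop s₀] with R hR
    have ir : IntervalIntegrable r volume s₀ R := by
      apply ContinuousOn.intervalIntegrable
      rw [uIcc_of_le hR]
      exact cr.mono Icc_subset_Ici_self
    have h3 := intervalIntegral.integral_eq_sub_of_hasDerivAt
      (fun s hs => dP s (by rw [uIcc_of_le hR] at hs; exact hs.1))
      ((ceh.intervalIntegrable s₀ R).add ir)
    rw [intervalIntegral.integral_add (ceh.intervalIntegrable s₀ R) ir] at h3
    rw [← intervalIntegral.integral_add_adjacent_intervals (ceh.intervalIntegrable 0 s₀)
      (ceh.intervalIntegrable s₀ R), id, ← h3]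
    ring
  · have n1 : ‖∫ s in (0 : ℝ)..s₀, e s * h s‖ ≤ M * s₀ := by
      have := intervalIntegral.norm_integral_le_of_norm_le_const (a := 0) (b := s₀)
        (f := fun s => e s * h s) (C := M) fun s _ => by
          rw [norm_mul, hen, one_mul]
          exact hM s
      simpa [abs_of_pos hs₀p] using this
    have n2 : ‖P s₀‖ ≤ M / (2 * t) := by
      refine (hPb s₀ le_rfl).trans (div_le_div_of_nonneg_left hM0 (by positivity) ?_)
      nlinarith [mul_le_mul hs₀1 hs₀1 zero_le_one (by linarith)]
    have n3 : ‖∫ s in Ioi s₀, r s‖ ≤ 7 * M / (2 * t) := by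
      have h1 : ‖∫ s in Ioi s₀, r s‖ ≤ ∫ s in Ioi s₀, 7 * M / (2 * t) * s ^ (-2 : ℝ) := by
        refine norm_integral_le_of_norm_le
          ((integrableOn_Ioi_rpow_of_lt (by norm_num : (-2 : ℝ) < -1) hs₀p).const_mul _) ?_
        exact (ae_restrict_iff' measurableSet_Ioi).2
          (Eventually.of_forall fun s hs => hrb s (le_of_lt hs))
      refine h1.trans ?_
      rw [integral_const_mul, integral_Ioi_rpow_of_lt (by norm_num) hs₀p]
      have h2 : -s₀ ^ (-2 + 1 : ℝ) / (-2 + 1) = s₀⁻¹ := by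
        norm_num
        exact Real.rpow_neg_one s₀
      rw [h2]
      exact mul_le_of_le_one_right (by positivity) (inv_le_one_of_one_le₀ hs₀1)
    calc _ ≤ M * s₀ + (M / (2 * t) + 7 * M / (2 * t)) := by
          refine (norm_add_le _ _).trans (add_le_add n1 ?_)
          refine (norm_sub_le _ _).trans (add_le_add ?_ n3)
          rw [zero_sub, norm_neg]
          exact n2
      _ = _ := by field_simp; ring

theorem deriv_negAxis (s : ℝ) : deriv negAxis s = -1 := by
  have : HasDerivAt negAxis (-1) s :=
    (hasDerivAt_id s).ofReal_comp.neg.congr_deriv (by simp)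
  exact this.deriv

theorem deriv_ofReal (s : ℝ) : deriv (fun s : ℝ => (s : ℂ)) s = 1 := by
  have : HasDerivAt (fun s : ℝ => (s : ℂ)) 1 s :=
    (hasDerivAt_id s).ofReal_comp.congr_deriv (by simp)
  exact this.deriv

theorem hasCurveIntegral_negAxis {F : ℂ → ℂ} {I : ℂ} (hF : Continuous fun s : ℝ => F (-s))
    (h : Tendsto (fun R : ℝ => ∫ s in (0 : ℝ)..R, F (-s)) atTop (𝓝 I)) :
    HasCurveIntegral negAxis F (-I) := by
  have e : (fun s => F (negAxis s) * deriv negAxis s) = fun s : ℝ => -F (-s) := by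
    ext s
    rw [deriv_negAxis, negAxis]
    ring
  refine ⟨fun R _ => ?_, ?_⟩
  · rw [e]
    exact hF.neg.intervalIntegrable _ _
  · simp only [e, intervalIntegral.integral_neg]
    exact h.neg

theorem hasCurveIntegral_posAxis {F : ℂ → ℂ} {I : ℂ} (hF : Continuous fun s : ℝ => F s)
    (h : Tendsto (fun R : ℝ => ∫ s in (0 : ℝ)..R, F s) atTop (𝓝 I)) :
    HasCurveIntegral (fun s => (s : ℂ)) F I := by
  have e : (fun s : ℝ => F s * deriv (fun s : ℝ => (s : ℂ)) s) = fun s : ℝ => F s := by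
    ext s
    rw [deriv_ofReal, mul_one]
  refine ⟨fun R _ => ?_, ?_⟩
  · rw [e]
    exact hF.intervalIntegrable _ _
  · rw [e]
    exact h

theorem continuous_halfLineFT_ofReal {f : ℝ → ℂ} (h : IntegrableOn f (Ioi 0)) :
    Continuous fun s : ℝ => halfLineFT f s := by
  rw [← continuousOn_univ]
  exact (continuousOn_halfLineFT h).comp (by fun_prop) fun s _ => by simp

theorem hasDerivAt_halfLineFT_ofReal {f : ℝ → ℂ} (h0 : IntegrableOn f (Ioi 0))
    (h1 : IntegrableOn (fun y : ℝ => (y : ℂ) * f y) (Ioi 0)) (s : ℝ) :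
    HasDerivAt (fun s : ℝ => halfLineFT f s) (halfLineFT (momentFun f) s) s := by
  simpa using hasDerivAt_halfLineFT_line h0 h1 (a := 0) (d := 1) (s := s) univ_mem (by simp)

/-- The two half lines are treated separately; the reflection `s ↦ -s` keeps the even phase and
changes the sign of `y`, whence the factor `2` in the bound. -/
theorem exists_hasRealLineIntegral {t : ℝ} (ht : 0 < t) (κ x y : ℝ) {f : ℝ → ℂ}
    (h0 : IntegrableOn f (Ioi 0)) (h1 : IntegrableOn (fun y : ℝ => (y : ℂ) * f y) (Ioi 0))
    {M : ℝ} (hM0 : ∫ y in Ioi (0 : ℝ), ‖f y‖ ≤ M)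
    (hM1 : ∫ y in Ioi (0 : ℝ), ‖momentFun f y‖ ≤ M) :
    ∃ A, HasRealLineIntegral (fun l => E κ l x y t * halfLineFT f l) A ∧
      ‖A‖ ≤ M * (2 * (1 + |y| / (2 * t) + 4 / t)) := by
  have hm := IntegrableOn.momentFun h1
  have hb : ∀ s : ℝ, ‖halfLineFT f s‖ ≤ M := fun s =>
    (norm_halfLineFT_le h0 (by simp)).trans hM0
  have hb' : ∀ s : ℝ, ‖halfLineFT (momentFun f) s‖ ≤ M := fun s =>
    (norm_halfLineFT_le hm (by simp)).trans hM1
  have hd := hasDerivAt_halfLineFT_ofReal h0 h1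
  have hc := continuous_halfLineFT_ofReal hm
  have hc0 := continuous_halfLineFT_ofReal h0
  obtain ⟨I₂, hI₂, hI₂b⟩ := exists_oscillatory_limit ht κ y hd hc hb hb'
  obtain ⟨I₁, hI₁, hI₁b⟩ := exists_oscillatory_limit ht κ (-y)
    (h := fun s : ℝ => halfLineFT f ((-s : ℝ) : ℂ))
    (h' := fun s : ℝ => -halfLineFT (momentFun f) ((-s : ℝ) : ℂ))
    (fun s => by
      have := (hd (-s)).scomp s (hasDerivAt_neg s)
      simpa [Function.comp_def] using this)
    (hc.comp continuous_neg).neg (fun s => hb (-s)) (fun s => by rw [norm_neg]; exact hb' (-s))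
  set c := Complex.exp (Complex.I * κ * x) with hcdef
  have hcn : ‖c‖ = 1 := by
    rw [hcdef, Complex.norm_exp]
    simp
  have hE : ∀ s : ℝ, E κ s x y t = c *
      Complex.exp (Complex.I * (((κ ^ 2 + s ^ 2) ^ 2 * t + s * y : ℝ) : ℂ)) := by
    intro s
    rw [E, hcdef, ← Complex.exp_add]
    congr 1
    push_cast
    ring
  have hE' : ∀ s : ℝ, E κ (-s : ℂ) x y t = c *
      Complex.exp (Complex.I * (((κ ^ 2 + s ^ 2) ^ 2 * t + s * (-y) : ℝ) : ℂ)) := by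
    intro s
    rw [E, hcdef, ← Complex.exp_add]
    congr 1
    push_cast
    ring
  have p1 : HasCurveIntegral negAxis (fun l => E κ l x y t * halfLineFT f l) (-(c * I₁)) := by
    refine hasCurveIntegral_negAxis ?_ ?_
    · have : Continuous fun s : ℝ => halfLineFT f (-(s : ℂ)) := by
        simpa [Function.comp_def] using hc0.comp continuous_neg
      unfold E
      fun_prop
    · refine (hI₁.const_mul c).congr fun R => ?_
      rw [← intervalIntegral.integral_const_mul]
      congr 1
      ext s
      rw [hE']
      push_cast
      ring
  have p2 : HasCurveIntegral (fun s => (s : ℂ)) (fun l => E κ l x y t * halfLineFT f l)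
      (c * I₂) := by
    refine hasCurveIntegral_posAxis ?_ ?_
    · unfold E
      fun_prop
    · refine (hI₂.const_mul c).congr fun R => ?_
      rw [← intervalIntegral.integral_const_mul]
      congr 1
      ext s
      rw [hE]
      ring
  refine ⟨_, ⟨_, _, p1, p2, rfl⟩, ?_⟩
  rw [abs_neg] at hI₁b
  rw [neg_neg]
  refine (norm_add_le _ _).trans ?_
  rw [norm_mul, norm_mul, hcn, one_mul, one_mul]
  linarith

/-! ### Fourier inversion -/

open FourierTransform in
-- Inversion with angular frequency, obtained from the `e^{-2πi}` convention by rescaling the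
-- frequency by `2π`.
theorem fourier_inversion_angular {g : ℝ → ℂ} (hg : Integrable g)
    (hG : Integrable fun s : ℝ => ∫ v : ℝ, Complex.exp (-Complex.I * v * s) * g v) {v : ℝ}
    (hv : ContinuousAt g v) :
    ∫ s : ℝ, Complex.exp (Complex.I * s * v) * ∫ w : ℝ, Complex.exp (-Complex.I * w * s) * g w =
      2 * Real.pi * g v := by
  set Φ : ℝ → ℂ := fun s : ℝ => ∫ v : ℝ, Complex.exp (-Complex.I * v * s) * g v with hΦ
  have hpi := Real.pi_pos
  have e1 : 𝓕 g = fun w => Φ (2 * Real.pi * w) := by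
    ext w
    rw [Real.fourier_real_eq_integral_exp_smul]
    simp only [hΦ, smul_eq_mul]
    congr 1
    ext x
    congr 2
    push_cast
    ring
  have h1 : Integrable (𝓕 g) := by
    rw [e1]
    exact hG.comp_mul_left' (by positivity)
  have h2 := hg.fourierInv_fourier_eq h1 hv
  rw [Real.fourierInv_eq', e1] at h2
  have h3 := Measure.integral_comp_mul_left (fun s : ℝ => Complex.exp (Complex.I * s * v) * Φ s)
    (2 * Real.pi)
  have h4 : (∫ w : ℝ, Complex.exp ((2 * Real.pi * inner ℝ w v : ℝ) * Complex.I) •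
      Φ (2 * Real.pi * w)) =
      ∫ w : ℝ, Complex.exp (Complex.I * ((2 * Real.pi * w : ℝ) : ℂ) * v) *
        Φ (2 * Real.pi * w) := by
    congr 1
    ext w
    rw [smul_eq_mul]
    congr 2
    simp
    ring
  rw [h4, h3, abs_of_pos (by positivity), Complex.real_smul] at h2
  have h5 : ∀ J : ℂ, (((2 * Real.pi)⁻¹ : ℝ) : ℂ) * J = g v → J = 2 * Real.pi * g v := by
    intro J hJ
    rw [← hJ]
    push_cast
    field_simp
  exact h5 _ h2

/-- `C²` data on the half line with cubic decay. -/
structure IsC2Decaying (f f' f'' : ℝ → ℂ) : Prop where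
  cont : ContinuousOn f (Ici 0)
  cont' : ContinuousOn f' (Ici 0)
  cont'' : ContinuousOn f'' (Ici 0)
  hasDerivAt : ∀ y, 0 < y → HasDerivAt f (f' y) y
  hasDerivAt' : ∀ y, 0 < y → HasDerivAt f' (f'' y) y
  bound : ∃ C, ∀ y, 0 ≤ y → ‖f y‖ ≤ C * ((1 + y) ^ 3)⁻¹
  bound' : ∃ C, ∀ y, 0 ≤ y → ‖f' y‖ ≤ C * ((1 + y) ^ 3)⁻¹
  bound'' : ∃ C, ∀ y, 0 ≤ y → ‖f'' y‖ ≤ C * ((1 + y) ^ 3)⁻¹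

theorem integrable_inv_one_add_abs_sq : Integrable fun x : ℝ => ((1 + |x|) ^ 2)⁻¹ := by
  have := integrable_one_add_norm (E := ℝ) (μ := volume) (r := 2) (by simp)
  refine this.congr (Eventually.of_forall fun x => ?_)
  simp only [Real.norm_eq_abs]
  rw [Real.rpow_neg (by positivity), Real.rpow_ofNat]

theorem integrableOn_of_sq_decay {f : ℝ → ℂ} (hc : ContinuousOn f (Ici 0)) {C : ℝ}
    (hb : ∀ y, 0 ≤ y → ‖f y‖ ≤ C * ((1 + y) ^ 2)⁻¹) : IntegrableOn f (Ioi 0) := by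
  refine (integrable_inv_one_add_abs_sq.integrableOn.const_mul C).mono'
    ((hc.mono Ioi_subset_Ici_self).aestronglyMeasurable measurableSet_Ioi) ?_
  refine (ae_restrict_iff' measurableSet_Ioi).2 (Eventually.of_forall fun y hy => ?_)
  rw [abs_of_pos hy]
  exact hb y (le_of_lt hy)

theorem integrableOn_of_cube_decay {f : ℝ → ℂ} (hc : ContinuousOn f (Ici 0))
    (hb : ∃ C, ∀ y, 0 ≤ y → ‖f y‖ ≤ C * ((1 + y) ^ 3)⁻¹) :
    IntegrableOn f (Ioi 0) ∧ IntegrableOn (fun y : ℝ => (y : ℂ) * f y) (Ioi 0) := by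
  obtain ⟨C, hC⟩ := hb
  have hC0 : 0 ≤ C := by simpa using (norm_nonneg _).trans (hC 0 le_rfl)
  constructor
  · refine integrableOn_of_sq_decay hc (C := C) fun y hy => (hC y hy).trans ?_
    gcongr
    · linarith
    · norm_num
  · refine integrableOn_of_sq_decay (by fun_prop) (C := C) fun y hy => ?_
    rw [norm_mul, Complex.norm_real, Real.norm_of_nonneg hy]
    calc y * ‖f y‖ ≤ (1 + y) * (C * ((1 + y) ^ 3)⁻¹) := by
          gcongr
          · linarith
          · exact hC y hy
      _ = _ := by field_simp

/-- The moment `-iy f(y)` vanishes at `y = 0`, so the first integration by parts has no boundary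
term and a second one is possible, giving quadratic decay. The transform of `f` itself decays only
to first order. -/
theorem IsC2Decaying.exists_norm_halfLineFT_momentFun_le {f f' f'' : ℝ → ℂ}
    (h : IsC2Decaying f f' f'') :
    ∃ C, ∀ s : ℝ, ‖halfLineFT (momentFun f) s‖ ≤ C * (1 + s ^ 2)⁻¹ := by
  obtain ⟨i0, i1⟩ := integrableOn_of_cube_decay h.cont h.bound
  obtain ⟨i0', i1'⟩ := integrableOn_of_cube_decay h.cont' h.bound'
  obtain ⟨i0'', i1''⟩ := integrableOn_of_cube_decay h.cont'' h.bound''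
  set m' : ℝ → ℂ := fun y => -Complex.I * f y + -Complex.I * (y * f' y) with hm'
  set m'' : ℝ → ℂ := fun y => -2 * Complex.I * f' y + -Complex.I * (y * f'' y) with hm''
  have jm := IntegrableOn.momentFun i1
  have jm' : IntegrableOn m' (Ioi 0) := (i0.const_mul _).add (i1'.const_mul _)
  have jm'' : IntegrableOn m'' (Ioi 0) := (i0'.const_mul _).add (i1''.const_mul _)
  have hf := h.cont
  have hf' := h.cont'
  have cm : ContinuousOn (momentFun f) (Ici 0) := by unfold momentFun; fun_prop
  have cm' : ContinuousOn m' (Ici 0) := by simp only [hm']; fun_prop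
  have hid : ∀ y : ℝ, HasDerivAt (fun y : ℝ => (y : ℂ)) 1 y := fun y =>
    (hasDerivAt_id y).ofReal_comp.congr_deriv (by simp)
  have dm : ∀ y, 0 < y → HasDerivAt (momentFun f) (m' y) y := by
    intro y hy
    refine (((hid y).const_mul (-Complex.I)).mul (h.hasDerivAt y hy)).congr_deriv ?_
    simp only [hm']
    ring
  have dm' : ∀ y, 0 < y → HasDerivAt m' (m'' y) y := by
    intro y hy
    refine (((h.hasDerivAt y hy).const_mul (-Complex.I)).add
      (((hid y).mul (h.hasDerivAt' y hy)).const_mul (-Complex.I))).congr_deriv ?_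
    simp only [hm'']
    ring
  refine ⟨(∫ y in Ioi (0 : ℝ), ‖momentFun f y‖) + (‖m' 0‖ + ∫ y in Ioi (0 : ℝ), ‖m'' y‖),
    fun s => ?_⟩
  have him : ((s : ℝ) : ℂ).im ≤ 0 := by simp
  have b0 := norm_halfLineFT_le jm him
  have b1 := norm_mul_halfLineFT_le cm' dm' jm' jm'' him
  have e1 := halfLineFT_deriv cm dm jm jm' him
  have hz : momentFun f 0 = 0 := by simp [momentFun]
  rw [hz, neg_zero, zero_add] at e1
  rw [e1, norm_mul, norm_mul, Complex.norm_I, one_mul, Complex.norm_real, Real.norm_eq_abs,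
    ← mul_assoc, abs_mul_abs_self] at b1
  rw [← div_eq_mul_inv, le_div_iff₀ (by positivity)]
  linarith

/-- Absolutely convergent inversion for the moment, extended by zero to the line; it is continuous
at the interior point `y > 0`. -/
theorem IsC2Decaying.integral_exp_mul_halfLineFT {f f' f'' : ℝ → ℂ}
    (h : IsC2Decaying f f' f'') {y : ℝ} (hy : 0 < y) :
    Integrable (fun s : ℝ => halfLineFT (momentFun f) s) ∧
    ∫ s : ℝ, Complex.exp (Complex.I * s * y) * halfLineFT (momentFun f) s =
      2 * Real.pi * (-Complex.I * y * f y) := by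
  obtain ⟨i0, i1⟩ := integrableOn_of_cube_decay h.cont h.bound
  have jm := IntegrableOn.momentFun i1
  obtain ⟨C, hC⟩ := h.exists_norm_halfLineFT_momentFun_le
  have hInt : Integrable (fun s : ℝ => halfLineFT (momentFun f) s) :=
    (integrable_inv_one_add_sq.const_mul C).mono'
      (continuous_halfLineFT_ofReal jm).aestronglyMeasurable (Eventually.of_forall hC)
  set g : ℝ → ℂ := indicator (Ioi 0) (momentFun f) with hg
  have e : ∀ s : ℝ, ∫ v : ℝ, Complex.exp (-Complex.I * v * s) * g v =
      halfLineFT (momentFun f) s := by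
    intro s
    rw [halfLineFT, ← integral_indicator measurableSet_Ioi]
    congr 1
    ext v
    by_cases hv : v ∈ Ioi (0 : ℝ) <;> simp [hg, hv]
  have gc : ContinuousAt g y := by
    have : momentFun f =ᶠ[𝓝 y] g := by
      filter_upwards [Ioi_mem_nhds hy] with v hv
      rw [hg, indicator_of_mem hv]
    refine ContinuousAt.congr ?_ this
    exact (by fun_prop : ContinuousAt (fun y : ℝ => -Complex.I * (y : ℂ)) y).mul
      (h.hasDerivAt y hy).continuousAt
  have key := fourier_inversion_angular (g := g) ((integrable_indicator_iff measurableSet_Ioi).2 jm)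
    (by simpa only [e] using hInt) gc
  simp only [e] at key
  refine ⟨hInt, key.trans ?_⟩
  rw [hg, indicator_of_mem (show y ∈ Ioi 0 from hy), momentFun]

/-- Inversion of the half line transform, as an improper integral. -/
theorem IsC2Decaying.hasRealLineIntegral {f f' f'' : ℝ → ℂ}
    (h : IsC2Decaying f f' f'') (c : ℂ) {y : ℝ} (hy : 0 < y) :
    HasRealLineIntegral (fun l => c * Complex.exp (Complex.I * l * y) * halfLineFT f l)
      (c * (2 * Real.pi * f y)) := by
  obtain ⟨i0, i1⟩ := integrableOn_of_cube_decay h.cont h.bound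
  obtain ⟨i0', -⟩ := integrableOn_of_cube_decay h.cont' h.bound'
  have jm := IntegrableOn.momentFun i1
  obtain ⟨C, hC0, hC⟩ := exists_norm_halfLineFT_le h.cont h.hasDerivAt i0 i0'
  obtain ⟨hInt, hval⟩ := h.integral_exp_mul_halfLineFT hy
  have hyI : Complex.I * (y : ℂ) ≠ 0 :=
    mul_ne_zero Complex.I_ne_zero (Complex.ofReal_ne_zero.2 hy.ne')
  set e : ℝ → ℂ := fun s => Complex.exp (Complex.I * s * y) with he
  have hen : ∀ s, ‖e s‖ = 1 := fun s => by
    simp only [he]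
    rw [norm_exp_I_mul]
    simp
  have de : ∀ s, HasDerivAt e (e s * (Complex.I * y)) s := by
    intro s
    have : HasDerivAt (fun s : ℝ => Complex.I * (s : ℂ) * y) (Complex.I * y) s :=
      (((hasDerivAt_id s).ofReal_comp.const_mul Complex.I).mul_const (y : ℂ)).congr_deriv (by simp)
    exact this.cexp
  set H : ℝ → ℂ := fun s => halfLineFT f s with hH
  set H' : ℝ → ℂ := fun s => halfLineFT (momentFun f) s with hH'
  have dH : ∀ s, HasDerivAt H (H' s) s := hasDerivAt_halfLineFT_ofReal i0 i1
  have cH : Continuous H := continuous_halfLineFT_ofReal i0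
  have cH' : Continuous H' := continuous_halfLineFT_ofReal jm
  have ce : Continuous e := continuous_iff_continuousAt.2 fun s => (de s).continuousAt
  have hInt' : Integrable (fun s => e s * H' s) := by
    refine hInt.norm.mono' (ce.mul cH').aestronglyMeasurable (Eventually.of_forall fun s => ?_)
    rw [norm_mul, hen, one_mul]
  -- Integration by parts in `s` against `e^{isy}`, possible since `y ≠ 0`, trades `H = O(1/|s|)`
  -- for the integrable `H'`.
  set P : ℝ → ℂ := fun s => e s * H s / (Complex.I * y) with hP
  have dP : ∀ s, HasDerivAt P (e s * H s + e s * H' s / (Complex.I * y)) s := by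
    intro s
    refine (((de s).mul (dH s)).div_const (Complex.I * y)).congr_deriv ?_
    rw [add_div, mul_right_comm, mul_div_cancel_right₀ _ hyI]
  have hPb : ∀ s, ‖P s‖ ≤ C / y * (1 + |s|)⁻¹ := by
    intro s
    have h1 := hC s (by simp)
    simp only [hP]
    rw [norm_div, norm_mul, hen, one_mul, norm_mul, Complex.norm_I, one_mul, Complex.norm_real,
      Real.norm_of_nonneg hy.le]
    rw [Complex.norm_real, Real.norm_eq_abs] at h1
    calc _ ≤ C / (1 + |s|) / y := by gcongr
      _ = _ := by field_simp
  have hlim : Tendsto (fun s : ℝ => C / y * (1 + |s|)⁻¹) atTop (𝓝 0) := by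
    have : Tendsto (fun s : ℝ => (1 + |s|)) atTop atTop :=
      tendsto_atTop_add_const_left _ _ tendsto_abs_atTop_atTop
    simpa using this.inv_tendsto_atTop.const_mul (C / y)
  have lP : Tendsto P atTop (𝓝 0) := squeeze_zero_norm hPb hlim
  have lP' : Tendsto (fun R => P (-R)) atTop (𝓝 0) :=
    squeeze_zero_norm (fun s => (hPb (-s)).trans_eq (by rw [abs_neg])) hlim
  have fund : ∀ a b : ℝ, ∫ s in a..b, e s * H s =
      P b - P a - (Complex.I * y)⁻¹ * ∫ s in a..b, e s * H' s := by
    intro a b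
    have j1 : IntervalIntegrable (fun s => e s * H s) volume a b :=
      (ce.mul cH).intervalIntegrable a b
    have j2 : IntervalIntegrable (fun s => e s * H' s / (Complex.I * y)) volume a b :=
      ((ce.mul cH').div_const _).intervalIntegrable a b
    have := intervalIntegral.integral_eq_sub_of_hasDerivAt (fun s _ => dP s) (j1.add j2)
    rw [intervalIntegral.integral_add j1 j2, intervalIntegral.integral_div] at this
    rw [← this]
    field_simp
    ring
  have p2 : HasCurveIntegral (fun s => (s : ℂ))
      (fun l => c * Complex.exp (Complex.I * l * y) * halfLineFT f l)
      (c * (0 - P 0 - (Complex.I * y)⁻¹ * ∫ s in Ioi 0, e s * H' s)) := by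
    refine hasCurveIntegral_posAxis (Continuous.mul (by fun_prop) cH) ?_
    have := ((lP.sub_const (P 0)).sub ((intervalIntegral_tendsto_integral_Ioi 0
      hInt'.integrableOn tendsto_id).const_mul (Complex.I * y)⁻¹)).const_mul c
    refine this.congr fun R => ?_
    rw [id, ← fund, ← intervalIntegral.integral_const_mul]
    simp only [he, hH, mul_assoc]
  have p1 : HasCurveIntegral negAxis
      (fun l => c * Complex.exp (Complex.I * l * y) * halfLineFT f l)
      (-(c * (P 0 - 0 - (Complex.I * y)⁻¹ * ∫ s in Iic 0, e s * H' s))) := by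
    refine hasCurveIntegral_negAxis ?_ ?_
    · have : Continuous fun s : ℝ => halfLineFT f (-(s : ℂ)) := by
        simpa [Function.comp_def] using (continuous_halfLineFT_ofReal i0).comp continuous_neg
      fun_prop
    · have := ((lP'.const_sub (P 0)).sub ((intervalIntegral_tendsto_integral_Iic 0
        hInt'.integrableOn tendsto_neg_atTop_atBot).const_mul (Complex.I * y)⁻¹)).const_mul c
      refine this.congr fun R => ?_
      rw [← fund, ← intervalIntegral.integral_const_mul]
      have h2 := intervalIntegral.integral_comp_neg (a := 0) (b := R)
        (fun s : ℝ => c * Complex.exp (Complex.I * s * y) * halfLineFT f s)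
      simp only [Complex.ofReal_neg, neg_zero] at h2
      rw [h2]
      simp only [he, hH, mul_assoc]
  refine ⟨_, _, p1, p2, ?_⟩
  have hsplit : (∫ s in Iic 0, e s * H' s) + ∫ s in Ioi 0, e s * H' s = ∫ s, e s * H' s :=
    intervalIntegral.integral_Iic_add_Ioi hInt'.integrableOn hInt'.integrableOn
  have hv : (∫ s, e s * H' s) = 2 * Real.pi * (-Complex.I * y * f y) := hval
  rw [← hsplit] at hv
  have hinv := inv_mul_cancel₀ hyI
  -- The values `P 0` of the two half lines cancel, and `-(iy)⁻¹ · 2π(-iy f(y)) = 2π f(y)`.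
  linear_combination c * (Complex.I * (y : ℂ))⁻¹ * hv - c * (2 * Real.pi * f y) * hinv

/-! ### Directional derivatives of decaying functions -/

/-- `C^n` up to the boundary, with all derivatives of order `≤ n` decaying to fifth order. -/
def SmoothDecay (n : ℕ) (T : ℝ) (v : ℝ × ℝ × ℝ → ℂ) : Prop :=
  ContDiffOn ℝ n v (closedDomain T) ∧
    ∀ k ≤ n, ∃ C : ℝ, ∀ p ∈ closedDomain T,
      (1 + |p.1| + |p.2.1|) ^ 5 * ‖iteratedFDerivWithin ℝ k v (closedDomain T) p‖ ≤ C

/-- The directional derivative on the closed domain. -/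
def dirDeriv (T : ℝ) (e : ℝ × ℝ × ℝ) (v : ℝ × ℝ × ℝ → ℂ) (p : ℝ × ℝ × ℝ) : ℂ :=
  fderivWithin ℝ v (closedDomain T) p e

abbrev Dx (T : ℝ) := dirDeriv T (1, 0, 0)

abbrev Dy (T : ℝ) := dirDeriv T (0, 1, 0)

abbrev Dt (T : ℝ) := dirDeriv T (0, 0, 1)

theorem mem_closedDomain {T x y t : ℝ} :
    (x, y, t) ∈ closedDomain T ↔ 0 ≤ y ∧ t ∈ Icc 0 T := by
  simp [closedDomain]

theorem uniqueDiffOn_closedDomain {T : ℝ} (hT : 0 < T) : UniqueDiffOn ℝ (closedDomain T) :=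
  uniqueDiffOn_univ.prod ((uniqueDiffOn_Ici 0).prod (uniqueDiffOn_Icc hT))

theorem SmoothDecaying.smoothDecay {T : ℝ} {u : ℝ × ℝ × ℝ → ℂ} (h : SmoothDecaying 5 T u) :
    SmoothDecay 5 T u := by
  refine ⟨h.1, fun k hk => ?_⟩
  obtain ⟨C, hC⟩ := h.2 k hk
  exact ⟨C, fun ⟨x, y, t⟩ hp =>
    hC x y t (mem_closedDomain.1 hp).1 (mem_closedDomain.1 hp).2.1 (mem_closedDomain.1 hp).2.2⟩

theorem SmoothDecay.dirDeriv {n : ℕ} {T : ℝ} (hT : 0 < T) {v : ℝ × ℝ × ℝ → ℂ}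
    (h : SmoothDecay (n + 1) T v) (e : ℝ × ℝ × ℝ) : SmoothDecay n T (dirDeriv T e v) := by
  have hu := uniqueDiffOn_closedDomain hT
  have hc : ContDiffOn ℝ n (fderivWithin ℝ v (closedDomain T)) (closedDomain T) :=
    h.1.fderivWithin hu (by norm_cast)
  refine ⟨hc.clm_apply contDiffOn_const, fun k hk => ?_⟩
  obtain ⟨C, hC⟩ := h.2 (k + 1) (by omega)
  refine ⟨‖e‖ * C, fun p hp => ?_⟩
  have h1 := norm_iteratedFDerivWithin_clm_apply_const (c := e) (hc p hp) hu hp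
    (by exact_mod_cast hk : (k : WithTop ℕ∞) ≤ n)
  rw [norm_iteratedFDerivWithin_fderivWithin hu hp] at h1
  calc _ ≤ (1 + |p.1| + |p.2.1|) ^ 5 *
        (‖e‖ * ‖iteratedFDerivWithin ℝ (k + 1) v (closedDomain T) p‖) :=
        mul_le_mul_of_nonneg_left h1 (by positivity)
    _ = ‖e‖ * ((1 + |p.1| + |p.2.1|) ^ 5 *
        ‖iteratedFDerivWithin ℝ (k + 1) v (closedDomain T) p‖) := by ring
    _ ≤ ‖e‖ * C := mul_le_mul_of_nonneg_left (hC p hp) (norm_nonneg _)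

/-- Continuity up to the boundary and integrable decay. -/
structure HasDecay (T : ℝ) (v : ℝ × ℝ × ℝ → ℂ) : Prop where
  cont : ContinuousOn v (closedDomain T)
  bound : ∃ C, 0 ≤ C ∧ ∀ x y t : ℝ, 0 ≤ y → t ∈ Icc 0 T →
    ‖v (x, y, t)‖ ≤ C * ((1 + |x|) ^ 2)⁻¹ * ((1 + y) ^ 3)⁻¹

/-- The fifth-order decay is shared out: two powers make the `x`-integrals converge, and three leave
the first moment in `y` integrable. -/
theorem SmoothDecay.hasDecay {n : ℕ} {T : ℝ} {v : ℝ × ℝ × ℝ → ℂ} (h : SmoothDecay n T v) :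
    HasDecay T v := by
  refine ⟨h.1.continuousOn, ?_⟩
  obtain ⟨C, hC⟩ := h.2 0 (Nat.zero_le _)
  refine ⟨max C 0, le_max_right _ _, fun x y t hy ht => ?_⟩
  have h1 := hC (x, y, t) (mem_closedDomain.2 ⟨hy, ht⟩)
  rw [norm_iteratedFDerivWithin_zero] at h1
  simp only [abs_of_nonneg hy] at h1
  have hx := abs_nonneg x
  have h2 : (1 + |x|) ^ 2 * (1 + y) ^ 3 ≤ (1 + |x| + y) ^ 5 := by
    calc (1 + |x|) ^ 2 * (1 + y) ^ 3 ≤ (1 + |x| + y) ^ 2 * (1 + |x| + y) ^ 3 := by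
          exact mul_le_mul (pow_le_pow_left₀ (by positivity) (by linarith) 2)
            (pow_le_pow_left₀ (by positivity) (by linarith) 3) (by positivity) (by positivity)
      _ = _ := by ring
  rw [mul_assoc, ← mul_inv, ← div_eq_mul_inv, le_div_iff₀ (by positivity), mul_comm]
  exact (mul_le_mul_of_nonneg_right h2 (norm_nonneg _)).trans (h1.trans (le_max_left _ _))

theorem SmoothDecay.hasFDerivWithinAt {n : ℕ} {T : ℝ} {v : ℝ × ℝ × ℝ → ℂ}
    (h : SmoothDecay (n + 1) T v) {p : ℝ × ℝ × ℝ} (hp : p ∈ closedDomain T) :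
    HasFDerivWithinAt v (fderivWithin ℝ v (closedDomain T) p) (closedDomain T) p :=
  ((h.1.differentiableOn (by simp)) p hp).hasFDerivWithinAt

theorem SmoothDecay.hasDerivAt_x {n : ℕ} {T : ℝ} {v : ℝ × ℝ × ℝ → ℂ}
    (h : SmoothDecay (n + 1) T v) {x y t : ℝ} (hy : 0 ≤ y) (ht : t ∈ Icc 0 T) :
    HasDerivAt (fun ξ => v (ξ, y, t)) (Dx T v (x, y, t)) x := by
  have h1 : HasDerivWithinAt (fun ξ : ℝ => (ξ, y, t)) (1, 0, 0) univ x :=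
    ((hasDerivAt_id x).prodMk (hasDerivAt_const x (y, t))).hasDerivWithinAt
  have := (h.hasFDerivWithinAt (mem_closedDomain.2 ⟨hy, ht⟩)).comp_hasDerivWithinAt x h1
    fun ξ _ => mem_closedDomain.2 ⟨hy, ht⟩
  exact hasDerivWithinAt_univ.1 this

theorem SmoothDecay.hasDerivWithinAt_y {n : ℕ} {T : ℝ} {v : ℝ × ℝ × ℝ → ℂ}
    (h : SmoothDecay (n + 1) T v) {x y t : ℝ} (hy : 0 ≤ y) (ht : t ∈ Icc 0 T) :
    HasDerivWithinAt (fun η => v (x, η, t)) (Dy T v (x, y, t)) (Ici 0) y := by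
  have h1 : HasDerivWithinAt (fun η : ℝ => (x, η, t)) (0, 1, 0) (Ici 0) y :=
    ((hasDerivAt_const y x).prodMk ((hasDerivAt_id y).prodMk
      (hasDerivAt_const y t))).hasDerivWithinAt
  exact (h.hasFDerivWithinAt (mem_closedDomain.2 ⟨hy, ht⟩)).comp_hasDerivWithinAt y h1
    fun η hη => mem_closedDomain.2 ⟨hη, ht⟩

theorem SmoothDecay.hasDerivAt_y {n : ℕ} {T : ℝ} {v : ℝ × ℝ × ℝ → ℂ}
    (h : SmoothDecay (n + 1) T v) {x y t : ℝ} (hy : 0 < y) (ht : t ∈ Icc 0 T) :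
    HasDerivAt (fun η => v (x, η, t)) (Dy T v (x, y, t)) y :=
  (h.hasDerivWithinAt_y hy.le ht).hasDerivAt (Ici_mem_nhds hy)

theorem SmoothDecay.hasDerivAt_t {n : ℕ} {T : ℝ} {v : ℝ × ℝ × ℝ → ℂ}
    (h : SmoothDecay (n + 1) T v) {x y t : ℝ} (hy : 0 ≤ y) (ht : t ∈ Ioo 0 T) :
    HasDerivAt (fun τ => v (x, y, τ)) (Dt T v (x, y, t)) t := by
  have h1 : HasDerivWithinAt (fun τ : ℝ => (x, y, τ)) (0, 0, 1) (Icc 0 T) t :=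
    ((hasDerivAt_const t x).prodMk ((hasDerivAt_const t y).prodMk
      (hasDerivAt_id t))).hasDerivWithinAt
  exact ((h.hasFDerivWithinAt
    (mem_closedDomain.2 ⟨hy, Ioo_subset_Icc_self ht⟩)).comp_hasDerivWithinAt t h1
    fun τ hτ => mem_closedDomain.2 ⟨hy, hτ⟩).hasDerivAt (Icc_mem_nhds ht.1 ht.2)

/-! ### The bi-Laplacian in terms of directional derivatives -/

/-- The induction step that identifies iterated one-variable derivatives with iterated directional
derivatives. Working on an open set allows the equality of order `n` to be differentiated. -/
theorem iteratedDeriv_succ_eqOn {g h h' : ℝ → ℂ} {U : Set ℝ} (hU : IsOpen U) {n : ℕ}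
    (h1 : ∀ ξ ∈ U, iteratedDeriv n g ξ = h ξ) (h2 : ∀ ξ ∈ U, HasDerivAt h (h' ξ) ξ) :
    ∀ ξ ∈ U, iteratedDeriv (n + 1) g ξ = h' ξ := by
  intro ξ hξ
  rw [iteratedDeriv_succ]
  have : iteratedDeriv n g =ᶠ[𝓝 ξ] h := by
    filter_upwards [hU.mem_nhds hξ] with z hz using h1 z hz
  rw [this.deriv_eq, (h2 ξ hξ).deriv]

theorem biLaplacian_eq {T : ℝ} (hT : 0 < T) {u : ℝ × ℝ × ℝ → ℂ} (h : SmoothDecay 5 T u)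
    {x y t : ℝ} (hy : 0 < y) (ht : t ∈ Icc 0 T) :
    biLaplacian u x y t = Dx T (Dx T (Dx T (Dx T u))) (x, y, t)
      + 2 * Dx T (Dx T (Dy T (Dy T u))) (x, y, t) + Dy T (Dy T (Dy T (Dy T u))) (x, y, t) := by
  have hx := fun e => h.dirDeriv hT e
  have hxx := fun a b => (hx a).dirDeriv hT b
  have hxxx := fun a b c => (hxx a b).dirDeriv hT c
  have x1 : ∀ ξ ∈ univ, iteratedDeriv 4 (fun ξ => u (ξ, y, t)) ξ =
      Dx T (Dx T (Dx T (Dx T u))) (ξ, y, t) :=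
    iteratedDeriv_succ_eqOn isOpen_univ (iteratedDeriv_succ_eqOn isOpen_univ
      (iteratedDeriv_succ_eqOn isOpen_univ (iteratedDeriv_succ_eqOn isOpen_univ
        (h := fun ξ => u (ξ, y, t)) (fun ξ _ => by simp)
        (fun ξ _ => h.hasDerivAt_x hy.le ht)) (fun ξ _ => (hx _).hasDerivAt_x hy.le ht))
        (fun ξ _ => (hxx _ _).hasDerivAt_x hy.le ht)) (fun ξ _ => (hxxx _ _ _).hasDerivAt_x hy.le ht)
  have y2 : ∀ ξ, ∀ η ∈ Ioi (0 : ℝ), iteratedDeriv 2 (fun η => u (ξ, η, t)) η =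
      Dy T (Dy T u) (ξ, η, t) := fun ξ =>
    iteratedDeriv_succ_eqOn isOpen_Ioi (iteratedDeriv_succ_eqOn isOpen_Ioi
      (h := fun η => u (ξ, η, t)) (fun η _ => by simp) (fun η hη => h.hasDerivAt_y hη ht))
      (fun η hη => (hx _).hasDerivAt_y hη ht)
  have y4 : ∀ η ∈ Ioi (0 : ℝ), iteratedDeriv 4 (fun η => u (x, η, t)) η =
      Dy T (Dy T (Dy T (Dy T u))) (x, η, t) :=
    iteratedDeriv_succ_eqOn isOpen_Ioi (iteratedDeriv_succ_eqOn isOpen_Ioi (y2 x)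
      (fun η hη => (hxx _ _).hasDerivAt_y hη ht)) (fun η hη => (hxxx _ _ _).hasDerivAt_y hη ht)
  have xy : ∀ ξ ∈ univ, iteratedDeriv 2 (fun ξ => Dy T (Dy T u) (ξ, y, t)) ξ =
      Dx T (Dx T (Dy T (Dy T u))) (ξ, y, t) :=
    iteratedDeriv_succ_eqOn isOpen_univ (iteratedDeriv_succ_eqOn isOpen_univ
      (h := fun ξ => Dy T (Dy T u) (ξ, y, t)) (fun ξ _ => by simp)
      (fun ξ _ => (hxx _ _).hasDerivAt_x hy.le ht)) (fun ξ _ => (hxxx _ _ _).hasDerivAt_x hy.le ht)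
  have e2 : (fun ξ => iteratedDeriv 2 (fun η => u (ξ, η, t)) y) =
      fun ξ => Dy T (Dy T u) (ξ, y, t) := funext fun ξ => y2 ξ y hy
  rw [biLaplacian, x1 x (mem_univ _), e2, xy x (mem_univ _), y4 y hy]

/-! ### The Fourier transform in `x` -/

def xTransform (v : ℝ × ℝ × ℝ → ℂ) (κ y t : ℝ) : ℂ :=
  ∫ x : ℝ, Complex.exp (-Complex.I * x * κ) * v (x, y, t)

theorem norm_exp_neg_I_mul_real (x κ : ℝ) : ‖Complex.exp (-Complex.I * x * κ)‖ = 1 := by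
  rw [norm_exp_neg_I_mul]
  simp

theorem HasDecay.continuous_x {T : ℝ} {v : ℝ × ℝ × ℝ → ℂ} (h : HasDecay T v) {y t : ℝ}
    (hy : 0 ≤ y) (ht : t ∈ Icc 0 T) : Continuous fun x => v (x, y, t) := by
  rw [← continuousOn_univ]
  exact h.cont.comp (by fun_prop) fun x _ => mem_closedDomain.2 ⟨hy, ht⟩

theorem HasDecay.continuous_exp_mul {T : ℝ} {v : ℝ × ℝ × ℝ → ℂ} (h : HasDecay T v) (κ : ℝ)
    {y t : ℝ} (hy : 0 ≤ y) (ht : t ∈ Icc 0 T) :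
    Continuous fun x : ℝ => Complex.exp (-Complex.I * x * κ) * v (x, y, t) :=
  Continuous.mul (by fun_prop) (h.continuous_x hy ht)

theorem HasDecay.exists_bound {T : ℝ} {v : ℝ × ℝ × ℝ → ℂ} (h : HasDecay T v) :
    ∃ C, 0 ≤ C ∧ ∀ x κ y t : ℝ, 0 ≤ y → t ∈ Icc 0 T →
      ‖Complex.exp (-Complex.I * x * κ) * v (x, y, t)‖ ≤ C * ((1 + |x|) ^ 2)⁻¹ := by
  obtain ⟨C, hC0, hC⟩ := h.bound
  refine ⟨C, hC0, fun x κ y t hy ht => ?_⟩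
  rw [norm_mul, norm_exp_neg_I_mul_real, one_mul]
  refine (hC x y t hy ht).trans (mul_le_of_le_one_right (by positivity) ?_)
  exact inv_le_one_of_one_le₀ (one_le_pow₀ (by linarith))

theorem HasDecay.integrable {T : ℝ} {v : ℝ × ℝ × ℝ → ℂ} (h : HasDecay T v) (κ : ℝ)
    {y t : ℝ} (hy : 0 ≤ y) (ht : t ∈ Icc 0 T) :
    Integrable fun x : ℝ => Complex.exp (-Complex.I * x * κ) * v (x, y, t) := by
  obtain ⟨C, hC0, hC⟩ := h.exists_bound
  exact (integrable_inv_one_add_abs_sq.const_mul C).mono'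
    (h.continuous_exp_mul κ hy ht).aestronglyMeasurable
    (Eventually.of_forall fun x => hC x κ y t hy ht)

theorem HasDecay.continuousOn_xTransform {T : ℝ} {v : ℝ × ℝ × ℝ → ℂ} (h : HasDecay T v) (κ : ℝ) :
    ContinuousOn (fun p : ℝ × ℝ => xTransform v κ p.1 p.2) (Ici 0 ×ˢ Icc 0 T) := by
  obtain ⟨C, hC0, hC⟩ := h.exists_bound
  refine continuousOn_of_dominated (bound := fun x => C * ((1 + |x|) ^ 2)⁻¹)
    (fun p hp => (h.continuous_exp_mul κ hp.1 hp.2).aestronglyMeasurable)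
    (fun p hp => Eventually.of_forall fun x => hC x κ p.1 p.2 hp.1 hp.2)
    (integrable_inv_one_add_abs_sq.const_mul C) (Eventually.of_forall fun x => ?_)
  exact continuousOn_const.mul (h.cont.comp (by fun_prop) fun p hp =>
    mem_closedDomain.2 ⟨hp.1, hp.2⟩)

theorem HasDecay.continuousOn_xTransform_y {T : ℝ} {v : ℝ × ℝ × ℝ → ℂ} (h : HasDecay T v)
    (κ : ℝ) {t : ℝ} (ht : t ∈ Icc 0 T) :
    ContinuousOn (fun y => xTransform v κ y t) (Ici 0) :=
  ContinuousOn.comp (f := fun y : ℝ => (y, t)) (g := fun p : ℝ × ℝ => xTransform v κ p.1 p.2)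
    (h.continuousOn_xTransform κ) (by fun_prop) fun _ hy => ⟨hy, ht⟩

theorem HasDecay.continuousOn_xTransform_t {T : ℝ} {v : ℝ × ℝ × ℝ → ℂ} (h : HasDecay T v)
    (κ : ℝ) {y : ℝ} (hy : 0 ≤ y) :
    ContinuousOn (fun t => xTransform v κ y t) (Icc 0 T) :=
  ContinuousOn.comp (f := fun t : ℝ => (y, t)) (g := fun p : ℝ × ℝ => xTransform v κ p.1 p.2)
    (h.continuousOn_xTransform κ) (by fun_prop) fun _ ht => ⟨hy, ht⟩

theorem HasDecay.exists_norm_xTransform_le {T : ℝ} {v : ℝ × ℝ × ℝ → ℂ} (h : HasDecay T v) :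
    ∃ C, 0 ≤ C ∧ ∀ κ y t : ℝ, 0 ≤ y → t ∈ Icc 0 T →
      ‖xTransform v κ y t‖ ≤ C * ((1 + y) ^ 3)⁻¹ := by
  obtain ⟨C, hC0, hC⟩ := h.bound
  refine ⟨C * ∫ x : ℝ, ((1 + |x|) ^ 2)⁻¹, by positivity, fun κ y t hy ht => ?_⟩
  have h1 : ‖xTransform v κ y t‖ ≤ ∫ x : ℝ, C * ((1 + |x|) ^ 2)⁻¹ * ((1 + y) ^ 3)⁻¹ := by
    refine norm_integral_le_of_norm_le
      ((integrable_inv_one_add_abs_sq.const_mul C).mul_const _) (Eventually.of_forall fun x => ?_)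
    rw [norm_mul, norm_exp_neg_I_mul_real, one_mul]
    exact hC x y t hy ht
  rwa [integral_mul_const, integral_const_mul] at h1

theorem hasDerivAt_xTransform_y {T : ℝ} {v w : ℝ × ℝ × ℝ → ℂ} (hv : HasDecay T v)
    (hw : HasDecay T w) (κ : ℝ) {y t : ℝ} (hy : 0 < y) (ht : t ∈ Icc 0 T)
    (hd : ∀ x η, 0 < η → HasDerivAt (fun η => v (x, η, t)) (w (x, η, t)) η) :
    HasDerivAt (fun y => xTransform v κ y t) (xTransform w κ y t) y := by
  obtain ⟨C, hC0, hC⟩ := hw.exists_bound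
  exact (hasDerivAt_integral_of_dominated_loc_of_deriv_le (𝕜 := ℝ)
    (F := fun y (x : ℝ) => Complex.exp (-Complex.I * x * κ) * v (x, y, t))
    (F' := fun y (x : ℝ) => Complex.exp (-Complex.I * x * κ) * w (x, y, t))
    (bound := fun x => C * ((1 + |x|) ^ 2)⁻¹) (Ioi_mem_nhds hy)
    (by
      filter_upwards [Ioi_mem_nhds hy] with η hη
      exact (hv.continuous_exp_mul κ (le_of_lt hη) ht).aestronglyMeasurable)
    (hv.integrable κ hy.le ht) (hw.continuous_exp_mul κ hy.le ht).aestronglyMeasurable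
    (Eventually.of_forall fun x η hη => hC x κ η t (le_of_lt hη) ht)
    (integrable_inv_one_add_abs_sq.const_mul C)
    (Eventually.of_forall fun x η hη => (hd x η hη).const_mul _)).2

theorem hasDerivAt_xTransform_t {T : ℝ} {v w : ℝ × ℝ × ℝ → ℂ} (hv : HasDecay T v)
    (hw : HasDecay T w) (κ : ℝ) {y t : ℝ} (hy : 0 ≤ y) (ht : t ∈ Ioo 0 T)
    (hd : ∀ x, ∀ τ ∈ Ioo 0 T, HasDerivAt (fun τ => v (x, y, τ)) (w (x, y, τ)) τ) :
    HasDerivAt (fun t => xTransform v κ y t) (xTransform w κ y t) t := by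
  obtain ⟨C, hC0, hC⟩ := hw.exists_bound
  have hI := fun τ (hτ : τ ∈ Ioo 0 T) => Ioo_subset_Icc_self hτ
  exact (hasDerivAt_integral_of_dominated_loc_of_deriv_le (𝕜 := ℝ)
    (F := fun t (x : ℝ) => Complex.exp (-Complex.I * x * κ) * v (x, y, t))
    (F' := fun t (x : ℝ) => Complex.exp (-Complex.I * x * κ) * w (x, y, t))
    (bound := fun x => C * ((1 + |x|) ^ 2)⁻¹) (Ioo_mem_nhds ht.1 ht.2)
    (by
      filter_upwards [Ioo_mem_nhds ht.1 ht.2] with τ hτ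
      exact (hv.continuous_exp_mul κ hy (hI τ hτ)).aestronglyMeasurable)
    (hv.integrable κ hy (hI t ht)) (hw.continuous_exp_mul κ hy (hI t ht)).aestronglyMeasurable
    (Eventually.of_forall fun x τ hτ => hC x κ y τ hy (hI τ hτ))
    (integrable_inv_one_add_abs_sq.const_mul C)
    (Eventually.of_forall fun x τ hτ => (hd x τ hτ).const_mul _)).2

theorem xTransform_deriv_x {T : ℝ} {v w : ℝ × ℝ × ℝ → ℂ} (hv : HasDecay T v)
    (hw : HasDecay T w) (κ : ℝ) {y t : ℝ} (hy : 0 ≤ y) (ht : t ∈ Icc 0 T)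
    (hd : ∀ x, HasDerivAt (fun ξ => v (ξ, y, t)) (w (x, y, t)) x) :
    xTransform w κ y t = Complex.I * κ * xTransform v κ y t := by
  have hexp : ∀ x : ℝ, HasDerivAt (fun x : ℝ => Complex.exp (-Complex.I * x * κ))
      (-Complex.I * κ * Complex.exp (-Complex.I * x * κ)) x := by
    intro x
    have : HasDerivAt (fun x : ℝ => -Complex.I * (x : ℂ) * κ) (-Complex.I * κ) x :=
      (((hasDerivAt_id x).ofReal_comp.const_mul (-Complex.I)).mul_const (κ : ℂ)).congr_deriv
        (by simp)
    exact this.cexp.congr_deriv (by ring)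
  have i2 : Integrable fun x : ℝ =>
      (-Complex.I * κ * Complex.exp (-Complex.I * x * κ)) * v (x, y, t) := by
    simpa only [mul_assoc] using ((hv.integrable κ hy ht).const_mul (-Complex.I * κ))
  have := integral_mul_deriv_eq_deriv_mul_of_integrable
    (u := fun x : ℝ => Complex.exp (-Complex.I * x * κ)) (v := fun x => v (x, y, t))
    (fun x _ => hexp x) (fun x _ => hd x) (hw.integrable κ hy ht) i2 (hv.integrable κ hy ht)
  rw [xTransform, this, xTransform, ← integral_const_mul, ← integral_neg]
  congr 1
  ext x
  ring

/-! ### The global relation -/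

theorem HasDecay.integrableOn_xTransform {T : ℝ} {v : ℝ × ℝ × ℝ → ℂ} (h : HasDecay T v) (κ : ℝ)
    {t : ℝ} (ht : t ∈ Icc 0 T) :
    IntegrableOn (fun y => xTransform v κ y t) (Ioi 0) ∧
      IntegrableOn (fun y : ℝ => (y : ℂ) * xTransform v κ y t) (Ioi 0) := by
  obtain ⟨C, -, hC⟩ := h.exists_norm_xTransform_le
  exact integrableOn_of_cube_decay (h.continuousOn_xTransform_y κ ht)
    ⟨C, fun y hy => hC κ y t hy ht⟩

theorem integrableOn_inv_one_add_cube (C : ℝ) :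
    IntegrableOn (fun y : ℝ => C * ((1 + y) ^ 3)⁻¹) (Ioi 0) := by
  refine Integrable.mono' (integrable_inv_one_add_abs_sq.const_mul |C|).integrableOn
    (ContinuousOn.aestronglyMeasurable ?_ measurableSet_Ioi) ?_
  · refine continuousOn_const.mul (ContinuousOn.inv₀ (by fun_prop) fun y hy => ?_)
    have : 0 < y := hy
    positivity
  · refine (ae_restrict_iff' measurableSet_Ioi).2 (Eventually.of_forall fun y hy => ?_)
    have hy : 0 < y := hy
    rw [norm_mul, Real.norm_eq_abs, Real.norm_of_nonneg (by positivity), abs_of_pos hy]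
    gcongr
    · linarith
    · norm_num

theorem HasDecay.continuousOn_halfLineFT_xTransform {T : ℝ} {v : ℝ × ℝ × ℝ → ℂ}
    (h : HasDecay T v) (κ : ℝ) {l : ℂ} (hl : l.im ≤ 0) :
    ContinuousOn (fun t => halfLineFT (fun y => xTransform v κ y t) l) (Icc 0 T) := by
  obtain ⟨C, -, hC⟩ := h.exists_norm_xTransform_le
  refine continuousOn_of_dominated (bound := fun y => C * ((1 + y) ^ 3)⁻¹)
    (fun t ht => (integrableOn_exp_mul (h.integrableOn_xTransform κ ht).1 hl).aestronglyMeasurable)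
    (fun t ht => ?_) (integrableOn_inv_one_add_cube C) ?_
  · refine (ae_restrict_iff' measurableSet_Ioi).2 (Eventually.of_forall fun y hy => ?_)
    exact (norm_exp_mul_le (f := fun y => xTransform v κ y t) (le_of_lt hy) hl).trans
      (hC κ y t (le_of_lt hy) ht)
  · refine (ae_restrict_iff' measurableSet_Ioi).2 (Eventually.of_forall fun y hy => ?_)
    exact continuousOn_const.mul (h.continuousOn_xTransform_t κ (le_of_lt hy))

theorem hasDerivAt_halfLineFT_xTransform {T : ℝ} {v w : ℝ × ℝ × ℝ → ℂ} (hv : HasDecay T v)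
    (hw : HasDecay T w) (κ : ℝ) {t : ℝ} (ht : t ∈ Ioo 0 T) {l : ℂ} (hl : l.im ≤ 0)
    (hd : ∀ x y, 0 ≤ y → ∀ τ ∈ Ioo 0 T, HasDerivAt (fun τ => v (x, y, τ)) (w (x, y, τ)) τ) :
    HasDerivAt (fun t => halfLineFT (fun y => xTransform v κ y t) l)
      (halfLineFT (fun y => xTransform w κ y t) l) t := by
  obtain ⟨C, -, hC⟩ := hw.exists_norm_xTransform_le
  have hI := fun τ (hτ : τ ∈ Ioo 0 T) => Ioo_subset_Icc_self hτ
  refine (hasDerivAt_integral_of_dominated_loc_of_deriv_le (𝕜 := ℝ)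
    (F := fun t (y : ℝ) => Complex.exp (-Complex.I * y * l) * xTransform v κ y t)
    (F' := fun t (y : ℝ) => Complex.exp (-Complex.I * y * l) * xTransform w κ y t)
    (bound := fun y => C * ((1 + y) ^ 3)⁻¹) (Ioo_mem_nhds ht.1 ht.2) ?_
    (integrableOn_exp_mul (hv.integrableOn_xTransform κ (hI t ht)).1 hl)
    (integrableOn_exp_mul (hw.integrableOn_xTransform κ (hI t ht)).1 hl).aestronglyMeasurable
    ?_ (integrableOn_inv_one_add_cube C) ?_).2
  · filter_upwards [Ioo_mem_nhds ht.1 ht.2] with τ hτ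
    exact (integrableOn_exp_mul (hv.integrableOn_xTransform κ (hI τ hτ)).1 hl).aestronglyMeasurable
  · refine (ae_restrict_iff' measurableSet_Ioi).2 (Eventually.of_forall fun y hy τ hτ => ?_)
    exact (norm_exp_mul_le (f := fun y => xTransform w κ y τ) (le_of_lt hy) hl).trans
      (hC κ y τ (le_of_lt hy) (hI τ hτ))
  · refine (ae_restrict_iff' measurableSet_Ioi).2 (Eventually.of_forall fun y hy τ hτ => ?_)
    exact (hasDerivAt_xTransform_t hv hw κ (le_of_lt hy) hτ
      fun x σ hσ => hd x y (le_of_lt hy) σ hσ).const_mul _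

theorem integral_linear_combination {α : Type*} [MeasurableSpace α] {μ : Measure α} {f g h : α → ℂ}
    (hf : Integrable f μ) (hg : Integrable g μ) (hh : Integrable h μ) (a b c : ℂ) :
    ∫ z, (a * f z + b * g z + c * h z) ∂μ =
      a * (∫ z, f z ∂μ) + b * (∫ z, g z ∂μ) + c * ∫ z, h z ∂μ := by
  have hfg : Integrable (fun z => a * f z + b * g z) μ := (hf.const_mul a).add (hg.const_mul b)
  rw [integral_add hfg (hh.const_mul c), integral_add (hf.const_mul a) (hg.const_mul b),
    integral_const_mul, integral_const_mul, integral_const_mul]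

theorem SmoothDecay.xTransform_Dx {n : ℕ} {T : ℝ} (hT : 0 < T) {v : ℝ × ℝ × ℝ → ℂ}
    (h : SmoothDecay (n + 1) T v) (κ : ℝ) {y t : ℝ} (hy : 0 ≤ y) (ht : t ∈ Icc 0 T) :
    xTransform (Dx T v) κ y t = Complex.I * κ * xTransform v κ y t :=
  xTransform_deriv_x h.hasDecay (h.dirDeriv hT _).hasDecay κ hy ht fun _ => h.hasDerivAt_x hy ht

/-- The equation `i uₜ + Δ²u = 0` after Fourier transformation in `x`. -/
theorem xTransform_Dt_eq {T : ℝ} (hT : 0 < T) {u : ℝ × ℝ × ℝ → ℂ} (h : SmoothDecay 5 T u)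
    (hpde : ∀ x y t : ℝ, 0 < y → 0 < t → t < T →
      Complex.I * deriv (fun τ => u (x, y, τ)) t + biLaplacian u x y t = 0)
    (κ : ℝ) {y t : ℝ} (hy : 0 < y) (ht : t ∈ Ioo 0 T) :
    xTransform (Dt T u) κ y t = Complex.I * ((κ : ℂ) ^ 4 * xTransform u κ y t
      - 2 * (κ : ℂ) ^ 2 * xTransform (Dy T (Dy T u)) κ y t
      + xTransform (Dy T (Dy T (Dy T (Dy T u)))) κ y t) := by
  have ht' := Ioo_subset_Icc_self ht
  have h1 := fun e => h.dirDeriv hT e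
  have h2 := fun a b => (h1 a).dirDeriv hT b
  have h3 := fun a b c => (h2 a b).dirDeriv hT c
  have h4 := fun a b c d => (h3 a b c).dirDeriv hT d
  have hpt : ∀ x, Dt T u (x, y, t) = Complex.I * (Dx T (Dx T (Dx T (Dx T u))) (x, y, t)
      + 2 * Dx T (Dx T (Dy T (Dy T u))) (x, y, t) + Dy T (Dy T (Dy T (Dy T u))) (x, y, t)) := by
    intro x
    have := hpde x y t hy ht.1 ht.2
    rw [(h.hasDerivAt_t hy.le ht).deriv, biLaplacian_eq hT h hy ht'] at this
    linear_combination (-Complex.I) * this + Dt T u (x, y, t) * Complex.I_sq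
  have e1 : xTransform (Dx T (Dx T (Dx T (Dx T u)))) κ y t = (κ : ℂ) ^ 4 * xTransform u κ y t := by
    rw [(h3 _ _ _).xTransform_Dx hT κ hy.le ht', (h2 _ _).xTransform_Dx hT κ hy.le ht',
      (h1 _).xTransform_Dx hT κ hy.le ht', h.xTransform_Dx hT κ hy.le ht']
    linear_combination (κ : ℂ) ^ 4 * xTransform u κ y t * Complex.I_pow_four
  have e2 : xTransform (Dx T (Dx T (Dy T (Dy T u)))) κ y t =
      -(κ : ℂ) ^ 2 * xTransform (Dy T (Dy T u)) κ y t := by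
    rw [(h3 _ _ _).xTransform_Dx hT κ hy.le ht', (h2 _ _).xTransform_Dx hT κ hy.le ht']
    linear_combination (κ : ℂ) ^ 2 * xTransform (Dy T (Dy T u)) κ y t * Complex.I_sq
  have i1 := (h4 (1, 0, 0) (1, 0, 0) (1, 0, 0) (1, 0, 0)).hasDecay.integrable κ hy.le ht'
  have i2 := (h4 (0, 1, 0) (0, 1, 0) (1, 0, 0) (1, 0, 0)).hasDecay.integrable κ hy.le ht'
  have i3 := (h4 (0, 1, 0) (0, 1, 0) (0, 1, 0) (0, 1, 0)).hasDecay.integrable κ hy.le ht'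
  have e3 : xTransform (Dt T u) κ y t = Complex.I * (xTransform (Dx T (Dx T (Dx T (Dx T u)))) κ y t
      + 2 * xTransform (Dx T (Dx T (Dy T (Dy T u)))) κ y t
      + xTransform (Dy T (Dy T (Dy T (Dy T u)))) κ y t) := by
    simp only [xTransform]
    rw [mul_add, mul_add, ← mul_assoc _ 2, ← integral_linear_combination i1 i2 i3]
    congr 1
    ext x
    rw [hpt]
    ring
  rw [e3, e1, e2]
  ring

theorem SmoothDecay.halfLineFT_Dy {n : ℕ} {T : ℝ} (hT : 0 < T) {v : ℝ × ℝ × ℝ → ℂ}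
    (h : SmoothDecay (n + 1) T v) (κ : ℝ) {t : ℝ} (ht : t ∈ Icc 0 T) {l : ℂ} (hl : l.im ≤ 0) :
    halfLineFT (fun y => xTransform (Dy T v) κ y t) l = -xTransform v κ 0 t
      + Complex.I * l * halfLineFT (fun y => xTransform v κ y t) l :=
  halfLineFT_deriv (h.hasDecay.continuousOn_xTransform_y κ ht)
    (fun _ hy => hasDerivAt_xTransform_y h.hasDecay (h.dirDeriv hT _).hasDecay κ hy ht
      fun _ _ hη => h.hasDerivAt_y hη ht)
    (h.hasDecay.integrableOn_xTransform κ ht).1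
    ((h.dirDeriv hT _).hasDecay.integrableOn_xTransform κ ht).1 hl

/-- Four integrations by parts in `y`, each leaving a trace at `y = 0`. The interior terms add up to
the symbol `i(κ⁴ + 2κ²l² + l⁴) = i(κ²+l²)² = -η`. -/
theorem halfLineFT_xTransform_Dt {T : ℝ} (hT : 0 < T) {u : ℝ × ℝ × ℝ → ℂ} (h : SmoothDecay 5 T u)
    (hpde : ∀ x y t : ℝ, 0 < y → 0 < t → t < T →
      Complex.I * deriv (fun τ => u (x, y, τ)) t + biLaplacian u x y t = 0)
    (κ : ℝ) {t : ℝ} (ht : t ∈ Ioo 0 T) {l : ℂ} (hl : l.im ≤ 0) :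
    halfLineFT (fun y => xTransform (Dt T u) κ y t) l =
      -timeExponent κ l * halfLineFT (fun y => xTransform u κ y t) l
        + (-Complex.I * xTransform (Dy T (Dy T (Dy T u))) κ 0 t
          + l * xTransform (Dy T (Dy T u)) κ 0 t
          + Complex.I * (l ^ 2 + 2 * (κ : ℂ) ^ 2) * xTransform (Dy T u) κ 0 t
          - l * (l ^ 2 + 2 * (κ : ℂ) ^ 2) * xTransform u κ 0 t) := by
  have ht' := Ioo_subset_Icc_self ht
  have h1 := h.dirDeriv hT (0, 1, 0)
  have h2 := h1.dirDeriv hT (0, 1, 0)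
  have h3 := h2.dirDeriv hT (0, 1, 0)
  have h4 := h3.dirDeriv hT (0, 1, 0)
  have i0 := integrableOn_exp_mul (h.hasDecay.integrableOn_xTransform κ ht').1 hl
  have i2 := integrableOn_exp_mul (h2.hasDecay.integrableOn_xTransform κ ht').1 hl
  have i4 := integrableOn_exp_mul (h4.hasDecay.integrableOn_xTransform κ ht').1 hl
  have e : halfLineFT (fun y => xTransform (Dt T u) κ y t) l =
      Complex.I * ((κ : ℂ) ^ 4 * halfLineFT (fun y => xTransform u κ y t) l
      - 2 * (κ : ℂ) ^ 2 * halfLineFT (fun y => xTransform (Dy T (Dy T u)) κ y t) l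
      + halfLineFT (fun y => xTransform (Dy T (Dy T (Dy T (Dy T u)))) κ y t) l) := by
    simp only [halfLineFT]
    rw [mul_add, mul_sub, sub_eq_add_neg, ← mul_assoc, ← mul_assoc, ← neg_mul,
      ← integral_linear_combination i0 i2 i4]
    refine setIntegral_congr_fun measurableSet_Ioi fun y hy => ?_
    simp only [xTransform_Dt_eq hT h hpde κ hy ht]
    ring
  rw [e, h3.halfLineFT_Dy hT κ ht' hl, h2.halfLineFT_Dy hT κ ht' hl, h1.halfLineFT_Dy hT κ ht' hl,
    h.halfLineFT_Dy hT κ ht' hl, timeExponent]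
  have hI3 : Complex.I ^ 3 = -Complex.I := by rw [pow_succ, Complex.I_sq]; ring
  have hI4 := Complex.I_pow_four
  have hI5 : Complex.I ^ 5 = Complex.I := by rw [pow_succ, hI4]; ring
  ring_nf
  simp only [hI3, hI4, hI5, Complex.I_sq]
  ring

/-- The data of the global relation at the boundary. -/
def boundaryData (T : ℝ) (u : ℝ × ℝ × ℝ → ℂ) (κ : ℝ) (l : ℂ) (t : ℝ) : ℂ :=
  boundaryTerm (xTransform u κ 0) (xTransform (Dy T u) κ 0) (xTransform (Dy T (Dy T u)) κ 0)
    (xTransform (Dy T (Dy T (Dy T u))) κ 0) κ l t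

/-- The previous identity is a linear first-order equation in time with integrating factor `e^{ητ}`.
It holds for `0 < τ < T`; continuity of the transform up to `τ = 0` suffices for integrating over
`[0,t]`. -/
theorem global_relation {T : ℝ} (hT : 0 < T) {u : ℝ × ℝ × ℝ → ℂ} (h : SmoothDecay 5 T u)
    (hpde : ∀ x y t : ℝ, 0 < y → 0 < t → t < T →
      Complex.I * deriv (fun τ => u (x, y, τ)) t + biLaplacian u x y t = 0)
    (κ : ℝ) {t : ℝ} (ht : t ∈ Ioo 0 T) {l : ℂ} (hl : l.im ≤ 0) :
    Complex.exp (timeExponent κ l * t) * halfLineFT (fun y => xTransform u κ y t) l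
      - halfLineFT (fun y => xTransform u κ y 0) l = boundaryData T u κ l t := by
  have h1 := h.dirDeriv hT (0, 1, 0)
  have h2 := h1.dirDeriv hT (0, 1, 0)
  have h3 := h2.dirDeriv hT (0, 1, 0)
  have hsub : Icc 0 t ⊆ Icc 0 T := Icc_subset_Icc_right ht.2.le
  set η := timeExponent κ l with hη
  have ce : Continuous fun τ : ℝ => Complex.exp (η * τ) := by fun_prop
  have hexp : ∀ τ : ℝ, HasDerivAt (fun τ : ℝ => Complex.exp (η * τ))
      (η * Complex.exp (η * τ)) τ := by
    intro τ
    have : HasDerivAt (fun τ : ℝ => η * (τ : ℂ)) η τ := by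
      simpa using (Complex.ofRealCLM.hasDerivAt (x := τ)).const_mul η
    exact this.cexp.congr_deriv (by ring)
  have hi : ∀ v, HasDecay T v → IntervalIntegrable
      (fun τ : ℝ => Complex.exp (η * τ) * xTransform v κ 0 τ) volume 0 t := by
    intro v hv
    apply ContinuousOn.intervalIntegrable
    rw [uIcc_of_le ht.1.le]
    exact ce.continuousOn.mul ((hv.continuousOn_xTransform_t κ le_rfl).mono hsub)
  have i0 := (hi _ h.hasDecay).const_mul (l * (l ^ 2 + 2 * (κ : ℂ) ^ 2))
  have i1 := (hi _ h1.hasDecay).const_mul (Complex.I * (l ^ 2 + 2 * (κ : ℂ) ^ 2))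
  have i2 := (hi _ h2.hasDecay).const_mul l
  have i3 := (hi _ h3.hasDecay).const_mul (-Complex.I)
  have key := intervalIntegral.integral_eq_sub_of_hasDerivAt_of_le ht.1.le
    (f := fun τ : ℝ => Complex.exp (η * τ) * halfLineFT (fun y => xTransform u κ y τ) l)
    (ce.continuousOn.mul ((h.hasDecay.continuousOn_halfLineFT_xTransform κ hl).mono hsub))
    (fun τ hτ => ((hexp τ).mul (hasDerivAt_halfLineFT_xTransform h.hasDecay
      (h.dirDeriv hT (0, 0, 1)).hasDecay κ (⟨hτ.1, hτ.2.trans ht.2⟩ : τ ∈ Ioo 0 T) hl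
      fun x y hy σ hσ => h.hasDerivAt_t hy hσ)).congr_deriv
      (g' := -Complex.I * (Complex.exp (η * τ) * xTransform (Dy T (Dy T (Dy T u))) κ 0 τ)
        + l * (Complex.exp (η * τ) * xTransform (Dy T (Dy T u)) κ 0 τ)
        + Complex.I * (l ^ 2 + 2 * (κ : ℂ) ^ 2) * (Complex.exp (η * τ) * xTransform (Dy T u) κ 0 τ)
        - l * (l ^ 2 + 2 * (κ : ℂ) ^ 2) * (Complex.exp (η * τ) * xTransform u κ 0 τ))
      (by
        rw [halfLineFT_xTransform_Dt hT h hpde κ ⟨hτ.1, hτ.2.trans ht.2⟩ hl]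
        ring))
    (((i3.add i2).add i1).sub i0)
  rw [intervalIntegral.integral_sub ((i3.add i2).add i1) i0,
    intervalIntegral.integral_add (i3.add i2) i1, intervalIntegral.integral_add i3 i2] at key
  simp only [intervalIntegral.integral_const_mul, Complex.ofReal_zero, mul_zero, Complex.exp_zero,
    one_mul] at key
  rw [← key]
  rfl

theorem SmoothDecay.isC1Data {n : ℕ} {T : ℝ} (hT : 0 < T) {v : ℝ × ℝ × ℝ → ℂ}
    (h : SmoothDecay (n + 1) T v) (κ : ℝ) {t : ℝ} (ht : t ∈ Ioo 0 T) :
    IsC1Data t (xTransform v κ 0) (xTransform (Dt T v) κ 0) where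
  cont := (h.hasDecay.continuousOn_xTransform_t κ le_rfl).mono (Icc_subset_Icc_right ht.2.le)
  cont_deriv := ((h.dirDeriv hT _).hasDecay.continuousOn_xTransform_t κ le_rfl).mono
    (Icc_subset_Icc_right ht.2.le)
  hasDerivAt _ hτ := hasDerivAt_xTransform_t h.hasDecay (h.dirDeriv hT _).hasDecay κ le_rfl
    ⟨hτ.1, hτ.2.trans ht.2⟩ fun _ _ hσ => h.hasDerivAt_t le_rfl hσ

theorem isDecaying_boundaryData {T : ℝ} (hT : 0 < T) {u : ℝ × ℝ × ℝ → ℂ} (h : SmoothDecay 5 T u)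
    (κ x y : ℝ) {t : ℝ} (ht : t ∈ Ioo 0 T) :
    IsDecaying y (boundedRegion κ) (fun l => E κ l x y t * boundaryData T u κ l t) := by
  have h1 := h.dirDeriv hT (0, 1, 0)
  have h2 := h1.dirDeriv hT (0, 1, 0)
  have h3 := h2.dirDeriv hT (0, 1, 0)
  exact isDecaying_boundaryTerm ht.1.le (h.isC1Data hT κ ht) (h1.isC1Data hT κ ht)
    (h2.isC1Data hT κ ht) (h3.isC1Data hT κ ht) κ x y

/-! ### The integrand on the contour -/

theorem timeExponent_neg (κ : ℝ) (l : ℂ) : timeExponent κ (-l) = timeExponent κ l := by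
  simp [timeExponent]

theorem timeExponent_of_sq {κ : ℝ} {l ν : ℂ} (hν : ν ^ 2 = -l ^ 2 - 2 * (κ : ℂ) ^ 2) :
    timeExponent κ ν = timeExponent κ l := by
  rw [timeExponent, timeExponent, hν]
  ring

/-- Elimination of the unknown boundary values from the global relations at `-l` and `-ν`. -/
theorem eliminate_boundary_values {l ν k e U U' V V' S T₀ T₁ T₂ T₃ : ℂ} (hne : ν - l ≠ 0)
    (hν : ν ^ 2 = -l ^ 2 - 2 * k ^ 2)
    (hl : e * U - U' = -Complex.I * T₃ + -l * T₂ + Complex.I * ((-l) ^ 2 + 2 * k ^ 2) * T₁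
      - -l * ((-l) ^ 2 + 2 * k ^ 2) * T₀)
    (hn : e * V - V' = -Complex.I * T₃ + -ν * T₂ + Complex.I * ((-ν) ^ 2 + 2 * k ^ 2) * T₁
      - -ν * ((-ν) ^ 2 + 2 * k ^ 2) * T₀)
    (hS : (-ν - -l) * S = V - U) :
    (2 * l / (ν - l) * V' - (l + ν) / (ν - l) * U')
      + (2 * (l ^ 2 * ν + l * ν ^ 2) * T₀ + 2 * Complex.I * (l ^ 2 + l * ν) * T₁) =
    (-Complex.I * T₃ + l * T₂ + Complex.I * (l ^ 2 + 2 * k ^ 2) * T₁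
      - l * (l ^ 2 + 2 * k ^ 2) * T₀) - e * (U + 2 * l * S) := by
  -- With `2k²` expressed through `l` and `ν`, the claim becomes a rational identity in which `T₂`
  -- and `T₃` drop out.
  have hk : 2 * k ^ 2 = -l ^ 2 - ν ^ 2 := by linear_combination hν
  rw [hk] at hl hn ⊢
  have hU : U' = e * U - (e * U - U') := by ring
  have hV : V' = e * V - (e * V - V') := by ring
  rw [hl] at hU
  rw [hn] at hV
  have hVU : V = U + (-ν - -l) * S := by rw [hS]; ring
  rw [hU, hV, hVU]
  field_simp
  ring

/-- If `ν = l` then `l² = -κ²`, so `l = ±i|κ|`, and only the upper sign is compatible with `Im l ≥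
0`. -/
theorem sub_ne_zero_of_sq {κ : ℝ} {l ν : ℂ} (hν : ν ^ 2 = -l ^ 2 - 2 * (κ : ℂ) ^ 2)
    (hl : 0 ≤ l.im) (hne : l ≠ |κ| * Complex.I) : ν - l ≠ 0 := by
  intro h
  have h1 : ν = l := by linear_combination h
  rw [h1] at hν
  have hk : ((|κ| : ℝ) : ℂ) ^ 2 = (κ : ℂ) ^ 2 := by
    rw [← Complex.ofReal_pow, sq_abs, Complex.ofReal_pow]
  have h2 : (l - |κ| * Complex.I) * (l + |κ| * Complex.I) = 0 := by
    linear_combination hν / 2 - (((|κ| : ℝ) : ℂ) ^ 2) * Complex.I_sq + hk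
  rcases mul_eq_zero.1 h2 with h3 | h3
  · exact hne (sub_eq_zero.1 h3)
  · have h4 : l = -(|κ| * Complex.I) := by linear_combination h3
    have h5 : l.im = -|κ| := by rw [h4]; simp
    have h6 : |κ| = 0 := by linarith [abs_nonneg κ]
    apply hne
    rw [h4, h6]
    simp

theorem E_mul_exp (κ : ℝ) (l : ℂ) (x y t : ℝ) :
    E κ l x y t * Complex.exp (timeExponent κ l * t) =
      Complex.exp (Complex.I * κ * x) * Complex.exp (Complex.I * l * y) := by
  rw [E_eq, mul_assoc, ← Complex.exp_add (-timeExponent κ l * t), neg_mul, neg_add_cancel,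
    Complex.exp_zero, mul_one]

theorem HasDecay.integrable_prod {T : ℝ} {v : ℝ × ℝ × ℝ → ℂ} (h : HasDecay T v) (κ : ℝ) {t : ℝ}
    (ht : t ∈ Icc 0 T) {l : ℂ} (hl : l.im ≤ 0) :
    Integrable (fun p : ℝ × ℝ => Complex.exp (-Complex.I * p.1 * κ - Complex.I * p.2 * l) *
      v (p.1, p.2, t)) (volume.prod (volume.restrict (Ioi 0))) := by
  obtain ⟨C, -, hC⟩ := h.bound
  have hm : (volume : Measure ℝ).prod (volume.restrict (Ioi (0 : ℝ))) =
      (volume.prod volume).restrict (univ ×ˢ Ioi 0) := by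
    rw [← Measure.prod_restrict, Measure.restrict_univ]
  have hms : MeasurableSet ((univ : Set ℝ) ×ˢ Ioi (0 : ℝ)) :=
    MeasurableSet.univ.prod measurableSet_Ioi
  have hi : IntegrableOn (fun y : ℝ => ((1 + y) ^ 3)⁻¹) (Ioi 0) := by
    simpa only [one_mul] using integrableOn_inv_one_add_cube 1
  refine ((integrable_inv_one_add_abs_sq.const_mul C).mul_prod hi).mono' ?_ ?_
  · rw [hm]
    refine ContinuousOn.aestronglyMeasurable (ContinuousOn.mul (by fun_prop) ?_) hms
    exact h.cont.comp (by fun_prop) fun p hp => mem_closedDomain.2 ⟨le_of_lt hp.2, ht⟩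
  · rw [hm]
    refine (ae_restrict_iff' hms).2 (Eventually.of_forall fun p hp => ?_)
    have hp2 : 0 ≤ p.2 := le_of_lt hp.2
    rw [sub_eq_add_neg, Complex.exp_add, norm_mul, norm_mul, norm_exp_neg_I_mul_real, one_mul,
      ← neg_mul, ← neg_mul]
    exact (mul_le_of_le_one_left (norm_nonneg _) (norm_exp_neg_I_mul_le_one hp2 hl)).trans
      (hC p.1 p.2 t hp2 ht)

theorem halfSpaceFT_eq {T : ℝ} (hT : 0 < T) {u : ℝ × ℝ × ℝ → ℂ} (h : HasDecay T u)
    {u₀ : ℝ → ℝ → ℂ} (hu₀ : ∀ x y : ℝ, 0 < y → u (x, y, 0) = u₀ x y) (κ : ℝ) {l : ℂ}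
    (hl : l.im ≤ 0) :
    halfSpaceFT u₀ κ l = halfLineFT (fun y => xTransform u κ y 0) l := by
  have e : halfSpaceFT u₀ κ l = ∫ x : ℝ, ∫ y in Ioi (0 : ℝ),
      Complex.exp (-Complex.I * x * κ - Complex.I * y * l) * u (x, y, 0) := by
    rw [halfSpaceFT]
    congr 1
    ext x
    refine setIntegral_congr_fun measurableSet_Ioi fun y hy => ?_
    simp only [hu₀ x y hy]
  rw [e, integral_integral_swap (h.integrable_prod κ ⟨le_rfl, hT.le⟩ hl), halfLineFT]
  congr 1
  ext y
  rw [xTransform, ← integral_const_mul]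
  congr 1
  ext x
  rw [← mul_assoc, ← Complex.exp_add]
  congr 2
  ring

/-- The data are tied to `u` only for `0 < t < T`, so the integrands are compared on the open
interval. -/
theorem tTransform_eq_timeFT {T : ℝ} {g : ℝ → ℝ → ℂ} {v : ℝ × ℝ × ℝ → ℂ}
    (hg : ∀ x t : ℝ, t ∈ Ioo 0 T → g x t = v (x, 0, t)) (κ : ℝ) (η : ℂ) {t : ℝ}
    (ht : t ∈ Ioo 0 T) : tTransform g κ η t = timeFT (xTransform v κ 0) η t := by
  refine intervalIntegral.integral_congr_uIoo fun τ hτ => ?_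
  rw [uIoo_of_le ht.1.le] at hτ
  simp only [xFT, xTransform, fun x => hg x τ ⟨hτ.1, hτ.2.trans ht.2⟩]

/-- Since `G` contains only known data, the elimination must be paid for by transforms of the
solution at time `t`. There `E e^{ηt} = e^{iκx+ily}` has lost its time growth, and this makes the
extra term decay in the quadrants. -/
theorem E_mul_G_eq {T : ℝ} (hT : 0 < T) {u₀ g₀ g₁ : ℝ → ℝ → ℂ} {u : ℝ × ℝ × ℝ → ℂ}
    (h : SmoothDecay 5 T u) (hu : IsSolution T u₀ g₀ g₁ u) {ε κ : ℝ} (x y : ℝ) {t : ℝ}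
    (ht : t ∈ Ioo 0 T) {l ν : ℂ} (hν : nu ε κ l = ν) (hsq : ν ^ 2 = -l ^ 2 - 2 * (κ : ℂ) ^ 2)
    (hνi : 0 ≤ ν.im) (hl : 0 ≤ l.im) (hne : l ≠ |κ| * Complex.I) :
    E κ l x y t * G ε u₀ g₀ g₁ κ l t = E κ l x y t * boundaryData T u κ l t
      - Complex.exp (Complex.I * κ * x) * Complex.exp (Complex.I * l * y) *
        (halfLineFT (fun y => xTransform u κ y t) (-l)
          + 2 * l * ftSlope (fun y => xTransform u κ y t) (-l, -ν)) := by
  have hl' : (-l).im ≤ 0 := by simpa using hl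
  have hνi' : (-ν).im ≤ 0 := by simpa using hνi
  have t0 := tTransform_eq_timeFT (T := T) (g := g₀) (v := u)
    (fun x t ht => (hu.dirichlet x t ht.1 ht.2).symm) κ (timeExponent κ l) ht
  have t1 := tTransform_eq_timeFT (T := T) (g := g₁) (v := Dy T u)
    (fun x t ht => by
      rw [← hu.neumann x t ht.1 ht.2]
      exact (h.hasDerivWithinAt_y le_rfl (Ioo_subset_Icc_self ht)).derivWithin
        (uniqueDiffOn_Ici 0 0 self_mem_Ici)) κ (timeExponent κ l) ht
  have r1 := global_relation hT h hu.pde κ ht hl'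
  have r2 := global_relation hT h hu.pde κ ht hνi'
  rw [boundaryData, boundaryTerm] at r1 r2
  rw [timeExponent_neg] at r1
  rw [timeExponent_neg, timeExponent_of_sq hsq] at r2
  obtain ⟨i0, i1⟩ := h.hasDecay.integrableOn_xTransform κ (Ioo_subset_Icc_self ht)
  have key := eliminate_boundary_values (sub_ne_zero_of_sq hsq hl hne) hsq r1 r2
    (mul_ftSlope i0 i1 hl' hνi')
  rw [← E_mul_exp κ l x y t, mul_assoc (E κ l x y t), ← mul_sub, G, hν,
    halfSpaceFT_eq hT h.hasDecay hu.initial κ hl', halfSpaceFT_eq hT h.hasDecay hu.initial κ hνi']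
  change _ * (_ + (_ * tTransform g₀ κ (timeExponent κ l) t
    + _ * tTransform g₁ κ (timeExponent κ l) t)) = _
  rw [t0, t1, key, boundaryData, boundaryTerm]

/-! ### Decay in `κ` -/

/-- Two `x`-derivatives give the factor `κ²`; their transform obeys the same decay in `y`. -/
theorem SmoothDecay.exists_norm_xTransform_le_inv {n : ℕ} {T : ℝ} (hT : 0 < T)
    {u : ℝ × ℝ × ℝ → ℂ} (h : SmoothDecay (n + 2) T u) :
    ∃ C, 0 ≤ C ∧ ∀ κ y t : ℝ, 0 ≤ y → t ∈ Icc 0 T →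
      ‖xTransform u κ y t‖ ≤ C * (1 + κ ^ 2)⁻¹ * ((1 + y) ^ 3)⁻¹ := by
  have h1 := h.dirDeriv hT (1, 0, 0)
  have h2 := h1.dirDeriv hT (1, 0, 0)
  obtain ⟨C, hC0, hC⟩ := h.hasDecay.exists_norm_xTransform_le
  obtain ⟨C', hC0', hC'⟩ := h2.hasDecay.exists_norm_xTransform_le
  refine ⟨C + C', by positivity, fun κ y t hy ht => ?_⟩
  have e := h1.xTransform_Dx hT κ hy ht
  rw [h.xTransform_Dx hT κ hy ht] at e
  have e' : (1 + κ ^ 2) * ‖xTransform u κ y t‖ ≤ (C + C') * ((1 + y) ^ 3)⁻¹ := by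
    have : κ ^ 2 * ‖xTransform u κ y t‖ = ‖xTransform (Dx T (Dx T u)) κ y t‖ := by
      rw [e]
      simp only [norm_mul, Complex.norm_I, Complex.norm_real, Real.norm_eq_abs, one_mul]
      rw [← mul_assoc, abs_mul_abs_self, pow_two]
    rw [add_mul, add_mul, one_mul, this]
    exact add_le_add (hC κ y t hy ht) (hC' κ y t hy ht)
  rw [mul_right_comm, ← div_eq_mul_inv, le_div_iff₀ (by positivity), mul_comm]
  exact e'

theorem HasDecay.continuous_xTransform_freq {T : ℝ} {v : ℝ × ℝ × ℝ → ℂ} (h : HasDecay T v)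
    {y t : ℝ} (hy : 0 ≤ y) (ht : t ∈ Icc 0 T) : Continuous fun κ => xTransform v κ y t := by
  obtain ⟨C, hC0, hC⟩ := h.exists_bound
  exact continuous_of_dominated (bound := fun x => C * ((1 + |x|) ^ 2)⁻¹)
    (fun κ => (h.continuous_exp_mul κ hy ht).aestronglyMeasurable)
    (fun κ => Eventually.of_forall fun x => hC x κ y t hy ht)
    (integrable_inv_one_add_abs_sq.const_mul C) (Eventually.of_forall fun x => by fun_prop)

theorem SmoothDecay.integrable_xTransform_freq {n : ℕ} {T : ℝ} (hT : 0 < T)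
    {u : ℝ × ℝ × ℝ → ℂ} (h : SmoothDecay (n + 2) T u) {y t : ℝ} (hy : 0 ≤ y)
    (ht : t ∈ Icc 0 T) : Integrable fun κ => xTransform u κ y t := by
  obtain ⟨C, -, hC⟩ := h.exists_norm_xTransform_le_inv hT
  refine ((integrable_inv_one_add_sq.const_mul C).mul_const ((1 + y) ^ 3)⁻¹).mono'
    (h.hasDecay.continuous_xTransform_freq hy ht).aestronglyMeasurable
    (Eventually.of_forall fun κ => hC κ y t hy ht)

/-- Fourier inversion in `x`. -/
theorem SmoothDecay.integral_exp_mul_xTransform {n : ℕ} {T : ℝ} (hT : 0 < T)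
    {u : ℝ × ℝ × ℝ → ℂ} (h : SmoothDecay (n + 2) T u) (x : ℝ) {y t : ℝ} (hy : 0 ≤ y)
    (ht : t ∈ Icc 0 T) :
    ∫ κ : ℝ, Complex.exp (Complex.I * κ * x) * xTransform u κ y t =
      2 * Real.pi * u (x, y, t) :=
  fourier_inversion_angular (g := fun x => u (x, y, t))
    (by simpa using h.hasDecay.integrable 0 hy ht) (h.integrable_xTransform_freq hT hy ht)
    (h.hasDecay.continuous_x hy ht).continuousAt

theorem HasDecay.continuous_halfLineFT_xTransform_freq {T : ℝ} {v : ℝ × ℝ × ℝ → ℂ}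
    (h : HasDecay T v) {t : ℝ} (ht : t ∈ Icc 0 T) :
    Continuous fun p : ℝ × ℝ => halfLineFT (fun y => xTransform v p.1 y t) (p.2 : ℂ) := by
  obtain ⟨C, -, hC⟩ := h.exists_norm_xTransform_le
  refine continuous_of_dominated (bound := fun y => C * ((1 + y) ^ 3)⁻¹)
    (fun p => (integrableOn_exp_mul (h.integrableOn_xTransform p.1 ht).1
      (by simp)).aestronglyMeasurable)
    (fun p => ?_) (integrableOn_inv_one_add_cube C) ?_
  · refine (ae_restrict_iff' measurableSet_Ioi).2 (Eventually.of_forall fun y hy => ?_)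
    exact (norm_exp_mul_le (f := fun y => xTransform v p.1 y t) (le_of_lt hy) (by simp)).trans
      (hC p.1 y t (le_of_lt hy) ht)
  · refine (ae_restrict_iff' measurableSet_Ioi).2 (Eventually.of_forall fun y hy => ?_)
    exact Continuous.mul (by fun_prop)
      ((h.continuous_xTransform_freq (le_of_lt hy) ht).comp continuous_fst)

/-- Supplies the constant `M` of the oscillatory estimate with explicit decay in `κ`. The weights
`1` and `y` are both below `1+y`, so cubic decay in `y` leaves an integrable square. -/
theorem SmoothDecay.exists_moment_bound {n : ℕ} {T : ℝ} (hT : 0 < T)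
    {u : ℝ × ℝ × ℝ → ℂ} (h : SmoothDecay (n + 2) T u) {t : ℝ} (ht : t ∈ Icc 0 T) :
    ∃ M, ∀ κ : ℝ, ∫ y in Ioi (0 : ℝ), ‖xTransform u κ y t‖ ≤ M * (1 + κ ^ 2)⁻¹ ∧
      ∫ y in Ioi (0 : ℝ), ‖momentFun (fun y => xTransform u κ y t) y‖ ≤ M * (1 + κ ^ 2)⁻¹ := by
  obtain ⟨C, hC0, hC⟩ := h.exists_norm_xTransform_le_inv hT
  refine ⟨C * ∫ y in Ioi (0 : ℝ), ((1 + |y|) ^ 2)⁻¹, fun κ => ?_⟩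
  obtain ⟨i0, i1⟩ := h.hasDecay.integrableOn_xTransform κ ht
  rw [mul_right_comm, ← integral_const_mul]
  have hi : IntegrableOn (fun y : ℝ => C * (1 + κ ^ 2)⁻¹ * ((1 + |y|) ^ 2)⁻¹) (Ioi 0) :=
    (integrable_inv_one_add_abs_sq.const_mul _).integrableOn
  have hle : ∀ y : ℝ, 0 < y → (1 + y) * ‖xTransform u κ y t‖ ≤
      C * (1 + κ ^ 2)⁻¹ * ((1 + |y|) ^ 2)⁻¹ := by
    intro y hy
    rw [abs_of_pos hy]
    calc (1 + y) * ‖xTransform u κ y t‖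
        ≤ (1 + y) * (C * (1 + κ ^ 2)⁻¹ * ((1 + y) ^ 3)⁻¹) :=
          mul_le_mul_of_nonneg_left (hC κ y t hy.le ht) (by positivity)
      _ = _ := by field_simp
  constructor
  · refine setIntegral_mono_on i0.norm hi measurableSet_Ioi fun y hy => ?_
    refine le_trans ?_ (hle y hy)
    exact le_mul_of_one_le_left (norm_nonneg _) (by linarith [show 0 < y from hy])
  · refine setIntegral_mono_on (IntegrableOn.momentFun i1).norm hi measurableSet_Ioi fun y hy => ?_
    refine le_trans ?_ (hle y hy)
    have hy : 0 < y := hy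
    rw [momentFun, norm_mul, norm_mul, norm_neg, Complex.norm_I, one_mul, Complex.norm_real,
      Real.norm_of_nonneg hy.le]
    gcongr
    linarith

/-! ### The representation formula -/

theorem HasCurveIntegral.congr {γ : ℝ → ℂ} {F₁ F₂ : ℂ → ℂ} {I : ℂ}
    (hI : HasCurveIntegral γ F₁ I) (h : ∀ s, F₁ (γ s) = F₂ (γ s)) : HasCurveIntegral γ F₂ I := by
  simpa only [HasCurveIntegral, h] using hI

theorem HasRealLineIntegral.congr {F₁ F₂ : ℂ → ℂ} {I : ℂ} (hI : HasRealLineIntegral F₁ I)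
    (h : ∀ s : ℝ, F₁ s = F₂ s) : HasRealLineIntegral F₂ I := by
  obtain ⟨I₁, I₂, h₁, h₂, e⟩ := hI
  exact ⟨I₁, I₂, h₁.congr fun s => by simpa [negAxis] using h (-s), h₂.congr h, e⟩

/-- A parametric improper integral with continuous integrand is measurable in the parameter. -/
theorem measurable_of_hasRealLineIntegral {F : ℝ → ℂ → ℂ} {A : ℝ → ℂ}
    (hF : Continuous fun p : ℝ × ℝ => F p.1 p.2) (h : ∀ κ, HasRealLineIntegral (F κ) (A κ)) :
    Measurable A := by
  have hc : ∀ n : ℕ, Continuous fun κ : ℝ =>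
      (∫ s in (0 : ℝ)..n, F κ (-s)) + ∫ s in (0 : ℝ)..n, F κ s := fun n => by
    refine Continuous.add ?_ ?_
    · refine intervalIntegral.continuous_parametric_intervalIntegral_of_continuous' ?_ _ _
      have := hF.comp (continuous_fst.prodMk continuous_snd.neg : Continuous
        fun p : ℝ × ℝ => (p.1, -p.2))
      simpa [Function.comp_def, Function.uncurry_def] using this
    · exact intervalIntegral.continuous_parametric_intervalIntegral_of_continuous' hF _ _
  refine measurable_of_tendsto_metrizable (fun n => (hc n).measurable)
    (tendsto_pi_nhds.2 fun κ => ?_)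
  obtain ⟨I₁, I₂, h₁, h₂, e⟩ := h κ
  rw [e]
  refine (((h₁.2.neg).add h₂.2).comp tendsto_natCast_atTop_atTop).congr fun n => ?_
  simp only [Function.comp_def, deriv_negAxis, deriv_ofReal, mul_neg, mul_one, negAxis,
    intervalIntegral.integral_neg, neg_neg]

/-- Integrability of `A` combines the bound `M(1+κ²)⁻¹` on the moments with an oscillatory factor
independent of `κ`; measurability comes from the truncated integrals. -/
theorem SmoothDecay.exists_initial_integral {n : ℕ} {T : ℝ} (hT : 0 < T) {u : ℝ × ℝ × ℝ → ℂ}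
    (h : SmoothDecay (n + 2) T u) (x y : ℝ) {t : ℝ} (ht : 0 < t) :
    ∃ A : ℝ → ℂ, (∀ κ, HasRealLineIntegral
      (fun l => E κ l x y t * halfLineFT (fun y => xTransform u κ y 0) l) (A κ)) ∧
      Integrable A := by
  have h0 : (0 : ℝ) ∈ Icc 0 T := ⟨le_rfl, hT.le⟩
  obtain ⟨M, hM⟩ := h.exists_moment_bound hT h0
  have hi := fun κ => h.hasDecay.integrableOn_xTransform κ h0
  choose A hA hA' using fun κ => exists_hasRealLineIntegral ht κ x y (hi κ).1 (hi κ).2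
    (hM κ).1 (hM κ).2
  refine ⟨A, hA, ?_⟩
  have hm : Measurable A := by
    refine measurable_of_hasRealLineIntegral ?_ hA
    refine Continuous.mul ?_ (h.hasDecay.continuous_halfLineFT_xTransform_freq h0)
    unfold E
    fun_prop
  exact ((integrable_inv_one_add_sq.const_mul M).mul_const _).mono' hm.aestronglyMeasurable
    (Eventually.of_forall hA')

theorem SmoothDecay.isC2Decaying {n : ℕ} {T : ℝ} (hT : 0 < T) {u : ℝ × ℝ × ℝ → ℂ}
    (h : SmoothDecay (n + 2) T u) (κ : ℝ) {t : ℝ} (ht : t ∈ Icc 0 T) :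
    IsC2Decaying (fun y => xTransform u κ y t) (fun y => xTransform (Dy T u) κ y t)
      (fun y => xTransform (Dy T (Dy T u)) κ y t) := by
  have h1 := h.dirDeriv hT (0, 1, 0)
  have h2 := h1.dirDeriv hT (0, 1, 0)
  have hb : ∀ v, HasDecay T v → ∃ C, ∀ y, 0 ≤ y → ‖xTransform v κ y t‖ ≤ C * ((1 + y) ^ 3)⁻¹ := by
    intro v hv
    obtain ⟨C, -, hC⟩ := hv.exists_norm_xTransform_le
    exact ⟨C, fun y hy => hC κ y t hy ht⟩
  exact
    { cont := h.hasDecay.continuousOn_xTransform_y κ ht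
      cont' := h1.hasDecay.continuousOn_xTransform_y κ ht
      cont'' := h2.hasDecay.continuousOn_xTransform_y κ ht
      hasDerivAt := fun y hy => hasDerivAt_xTransform_y h.hasDecay h1.hasDecay κ hy ht
        fun _ _ hη => h.hasDerivAt_y hη ht
      hasDerivAt' := fun y hy => hasDerivAt_xTransform_y h1.hasDecay h2.hasDecay κ hy ht
        fun _ _ hη => h1.hasDerivAt_y hη ht
      bound := hb _ h.hasDecay
      bound' := hb _ h1.hasDecay
      bound'' := hb _ h2.hasDecay }

/-- The boundary integrals, evaluated by contour deformation and inversion in `y`. -/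
theorem boundary_integrals {T : ℝ} (hT : 0 < T) {u₀ g₀ g₁ : ℝ → ℝ → ℂ} {u : ℝ × ℝ × ℝ → ℂ}
    (h : SmoothDecay 5 T u) (hu : IsSolution T u₀ g₀ g₁ u) {ε : ℝ} (hε : 0 < ε)
    (hε' : ε < Real.pi / 4) (κ x : ℝ) {y t : ℝ} (hy : 0 < y) (ht : t ∈ Ioo 0 T) {A : ℂ}
    (hA : HasRealLineIntegral
      (fun l => E κ l x y t * halfLineFT (fun y => xTransform u κ y 0) l) A) :
    HasBoundaryIntegral κ (fun l => E κ l x y t * G ε u₀ g₀ g₁ κ l t)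
        (Complex.exp (Complex.I * κ * x) * (2 * Real.pi * xTransform u κ y t) - A) ∧
      HasAsymptoticBoundaryIntegral κ (fun l => E κ l x y t * G ε u₀ g₀ g₁ κ l t)
        (Complex.exp (Complex.I * κ * x) * (2 * Real.pi * xTransform u κ y t) - A) := by
  have ht' := Ioo_subset_Icc_self ht
  have hC2 := h.isC2Decaying hT κ ht'
  obtain ⟨i0, i1⟩ := h.hasDecay.integrableOn_xTransform κ ht'
  have i0' := ((h.dirDeriv hT (0, 1, 0)).hasDecay.integrableOn_xTransform κ ht').1
  obtain ⟨A₁, A₂, hA₁, hA₂, rfl⟩ := hA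
  obtain ⟨V₁, V₂, hV₁, hV₂, hV⟩ := hC2.hasRealLineIntegral (Complex.exp (Complex.I * κ * x)) hy
  -- The global relation on the real axis multiplied by `E`. It splits the integral of `E W` into
  -- the inversion integral of `û(κ,·,t)` and the integral defining `A`.
  have hreal : ∀ s : ℝ, Complex.exp (Complex.I * κ * x) * Complex.exp (Complex.I * s * y) *
      halfLineFT (fun y => xTransform u κ y t) s
      - E κ s x y t * halfLineFT (fun y => xTransform u κ y 0) s =
      E κ s x y t * boundaryData T u κ s t := by
    intro s
    rw [← global_relation hT h hu.pde κ ht (l := (s : ℂ)) (by simp), mul_sub, ← mul_assoc,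
      E_mul_exp]
  have hJ : HasCurveIntegral negAxis (fun l => E κ l x y t * boundaryData T u κ l t) (V₁ - A₁) :=
    (hV₁.sub hA₁).congr fun s => by simpa [negAxis] using hreal (-s)
  obtain ⟨I, hI, hB⟩ := contour_integrals hy (isDecaying_boundaryData hT h κ x y ht)
    (isDecaying_reflected y (fun l hl => hl.2) (isRootBranch_leftRoot κ) hC2.cont hC2.hasDerivAt
      i0 i0' i1 (Complex.exp (Complex.I * κ * x)))
    (isDecaying_reflected y (fun l hl => hl.2) (isRootBranch_rightRoot κ) hC2.cont hC2.hasDerivAt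
      i0 i0' i1 (Complex.exp (Complex.I * κ * x)))
    (f := fun l => E κ l x y t * G ε u₀ g₀ g₁ κ l t)
    (fun l hl hreg hne => E_mul_G_eq hT h hu x y ht (nu_eq_leftRoot hε hε' hl hreg)
      ((isRootBranch_leftRoot κ).sq l hl) ((isRootBranch_leftRoot κ).im_nonneg l hl) hl.2 hne)
    (fun l hl hne => E_mul_G_eq hT h hu x y ht (nu_eq_rightRoot hε hε' hl)
      ((isRootBranch_rightRoot κ).sq l hl) ((isRootBranch_rightRoot κ).im_nonneg l hl) hl.2 hne)
    hJ
  -- The positive-axis integral delivered by the deformation is identified, by uniqueness of the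
  -- limit, with the one known from inversion.
  have hI' : I = V₂ - A₂ := hI.unique ((hV₂.sub hA₂).congr hreal)
  have e : -(V₁ - A₁) + I =
      Complex.exp (Complex.I * κ * x) * (2 * Real.pi * xTransform u κ y t) - (-A₁ + A₂) := by
    rw [hV, hI']
    ring
  rwa [e] at hB

end BiharmonicSchrodinger

end

/-! ### Assembly of the formula by inversion in `x` -/

theorem mainTheorem1 :
    ∃ N : ℕ, ∀ (T : ℝ) (u₀ g₀ g₁ : ℝ → ℝ → ℂ) (u : ℝ × ℝ × ℝ → ℂ) (ε : ℝ),
      0 < T → 0 < ε → ε < Real.pi / 4 →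
      BiharmonicSchrodinger.SmoothDecaying N T u →
      BiharmonicSchrodinger.IsSolution T u₀ g₀ g₁ u →
      ∀ x y t : ℝ, 0 < y → 0 < t → t < T →
        ∃ A B : ℝ → ℂ,
          (∀ κ : ℝ, BiharmonicSchrodinger.HasRealLineIntegral
            (fun l => BiharmonicSchrodinger.E κ l x y t *
              BiharmonicSchrodinger.halfSpaceFT u₀ κ l) (A κ)) ∧
          (∀ κ : ℝ, BiharmonicSchrodinger.HasBoundaryIntegral κ
            (fun l => BiharmonicSchrodinger.E κ l x y t *
              BiharmonicSchrodinger.G ε u₀ g₀ g₁ κ l t) (B κ)) ∧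
          (∀ κ : ℝ, BiharmonicSchrodinger.HasAsymptoticBoundaryIntegral κ
            (fun l => BiharmonicSchrodinger.E κ l x y t *
              BiharmonicSchrodinger.G ε u₀ g₀ g₁ κ l t) (B κ)) ∧
          MeasureTheory.Integrable A MeasureTheory.volume ∧
          MeasureTheory.Integrable B MeasureTheory.volume ∧
          u (x, y, t) =
            1 / (2 * (Real.pi : ℂ)) ^ 2 * (∫ κ : ℝ, A κ) +
            1 / (2 * (Real.pi : ℂ)) ^ 2 * (∫ κ : ℝ, B κ) := by
  -- The order `5` serves the decay `(1+|x|)^{-2}(1+y)^{-3}`; it also covers the derivatives, of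
  -- which at most four are taken.
  refine ⟨5, fun T u₀ g₀ g₁ u ε hT hε hε' hdec hu x y t hy ht htT => ?_⟩
  have h := hdec.smoothDecay
  have ht' : t ∈ Set.Ioo 0 T := ⟨ht, htT⟩
  have htI := Set.Ioo_subset_Icc_self ht'
  obtain ⟨A, hA, hAi⟩ := h.exists_initial_integral hT x y ht
  have hV : MeasureTheory.Integrable fun κ : ℝ =>
      Complex.exp (Complex.I * κ * x) * (2 * Real.pi * BiharmonicSchrodinger.xTransform u κ y t) := by
    refine ((h.integrable_xTransform_freq hT hy.le htI).const_mul (2 * (Real.pi : ℂ))).bdd_mul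
      (c := 1) (Continuous.aestronglyMeasurable (by fun_prop))
      (Filter.Eventually.of_forall fun κ => ?_)
    rw [Complex.norm_exp]
    simp
  have hB := fun κ => BiharmonicSchrodinger.boundary_integrals hT h hu hε hε' κ x hy ht' (hA κ)
  -- The second witness is `2π e^{iκx} û(κ,y,t) - A(κ)`, the common value of the two contour
  -- integrals. Adding the integral of `A` cancels `A`, and inversion in `x` produces `(2π)² u`.
  refine ⟨A, _, fun κ => (hA κ).congr fun s => ?_, fun κ => (hB κ).1, fun κ => (hB κ).2, hAi,
    hV.sub hAi, ?_⟩
  · rw [BiharmonicSchrodinger.halfSpaceFT_eq hT h.hasDecay hu.initial κ (by simp)]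
  · have e : ∫ κ : ℝ, Complex.exp (Complex.I * κ * x) *
        (2 * Real.pi * BiharmonicSchrodinger.xTransform u κ y t) =
        2 * Real.pi * (2 * Real.pi * u (x, y, t)) := by
      rw [← h.integral_exp_mul_xTransform hT x hy.le htI, ← MeasureTheory.integral_const_mul]
      congr 1
      ext κ
      ring
    rw [MeasureTheory.integral_sub hV hAi, e]
    have hpi : (Real.pi : ℂ) ≠ 0 := Complex.ofReal_ne_zero.2 Real.pi_ne_zero
    field_simp
    ring
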